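/- Let $\mathfrak g$ be a finite-dimensional simple complex Lie algebra with Chevalley generators $e_k,f_k,h_k$ $(k\in I)$, let $\mathfrak h$ be the Cartan subalgebra spanned by the $h_k$ and $\mathfrak n$ the subalgebra generated by the $e_k$. Let $\langle\,,\rangle$ be the invariant form on $\mathfrak g$ normalized so that the induced form on $\mathfrak h^*$ satisfies $\langle\theta,\theta\rangle=2$ for the highest root $\theta$. Let $\sigma$ be a special automorphism of $\mathfrak g$, of order $m$. That is, either $\sigma$ is a diagram automorphism ($\sigma(e_k)=e_{\tau(k)}$, $\sigma(f_k)=f_{\tau(k)}$ for a permutation $\tau$ of $I$; the identity is allowed), or $\mathfrak g$ is of type $A_{2n}$ $(n\ge 1)$ and $\sigma$ or $\sigma^{-1}$ is the automorphism of order $4$ with $e_k\mapsto e_{\tau(k)}$ for $k\ne n,n+1$, $e_k\mapsto\sqrt{-1}\,e_{\tau(k)}$ for $k\in\{n,n+1\}$, and $f_\theta\mapsto f_\theta$ for the lowest root vector $f_\theta$, where $\tau(k)=2n+1-k$. Let $\mathfrak g^\sigma$ be the fixed point subalgebra. Its weights are taken with respect to the Cartan subalgebra $\mathfrak h^\sigma=\mathfrak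 h\cap\mathfrak g^\sigma$, and its positive roots are the weights of $\mathfrak h^\sigma$ on $\mathfrak n\cap\mathfrak g^\sigma$; let $\rho_\sigma$ be half the sum of its positive roots. The restriction of $\langle\,,\rangle$ to $\mathfrak h^\sigma$ is nondegenerate; the induced form on $(\mathfrak h^\sigma)^*$ is still denoted by $\langle\,,\rangle$. For $i\in\mathbb Z$ let $\mathfrak g_{\underline i}$ be the $e^{2\pi\mathrm i\, i/m}$-eigenspace of $\sigma$, which is a $\mathfrak g^\sigma$-module depending only on $\underline i=i \bmod m$, and let $\theta_{\underline i}$ be the maximal weight of $\mathfrak g_{\underline i}$, for the order in which $\lambda\le\lambda'$ if $\lambda'-\lambda$ is a sum of positive roots of $\mathfrak g^\sigma$. Let $V(\mu)$ be a finite-dimensional irreducible $\mathfrak g^\sigma$-module with highest weight $\mu$. Let $\mathcal B_{\underline 0}$ be a basis of $\mathfrak g^\sigma$ and $\{\check b\}_{b\in\mathcal B_{\underline 0}}$ the dual basis of $\mathfrak g^\sigma$ with respect to $\langle\,,\rangle$. Consider the operator $$C_\mu^{\underline i}:\mathfrak g_{\underline i}\otimes V(\mu)\to\mathfrak g_{\underline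 i}\otimes V(\mu),\qquad C_\mu^{\underline i}(x\otimes v)=\sum_{b\in\mathcal B_{\underline 0}}[b,x]\otimes\check b\cdot v .$$ Then, except when $\mathfrak g$ is of type $D_4$, $m=3$ and $\underline i=\underline 0$, every eigenvalue $e$ of $C_\mu^{\underline i}$ is real and satisfies $$-\langle\mu+2\rho_\sigma,\theta_{\underline i}\rangle\ \le\ e\ \le\ \langle\mu,\theta_{\underline i}\rangle .$$ -/

import Mathlib

open Module
open scoped TensorProduct

namespace TwistedCasimir

noncomputable section

/-! ### Chevalley generators, the normalized form, special automorphisms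

Chevalley generators `e i`, `f i`, `h i` of `L`, together with the Cartan subalgebra `H` spanned by
the `h i`, are Mathlib's `b : LieAlgebra.Basis ι H`. -/

section Chevalley

variable {ι L : Type*} [Fintype ι] [LieRing L] [LieAlgebra ℂ L] {H : LieSubalgebra ℂ L}

/-- `θ` is the highest root of the simple Lie algebra `L` with respect to the given Chevalley
generators: the weight of a nonzero vector of `L` that is annihilated by all `e i`. -/
def IsHighestRoot (b : LieAlgebra.Basis ι H) (θ : Dual ℂ H) : Prop :=
  ∃ x : L, x ≠ 0 ∧ (∀ h : H, ⁅(h : L), x⁆ = θ h • x) ∧ ∀ i, ⁅b.e i, x⁆ = 0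

/-- The invariant form on the simple Lie algebra `L` normalized by `⟨θ, θ⟩ = 2`, for `θ` the highest
root. If `(θ, θ) = θ (ν⁻¹ θ)` is the square length of `θ` for the Killing form, where
`ν : H ≃ H*` is the isomorphism given by the Killing form, this is
`((θ, θ) / 2)` times the Killing form. -/
def normalizedForm [FiniteDimensional ℂ L] [LieAlgebra.IsSimple ℂ L]
    (b : LieAlgebra.Basis ι H) (θ : Dual ℂ H) : LinearMap.BilinForm ℂ L :=
  letI := b.isCartanSubalgebra
  (θ ((LieAlgebra.IsKilling.cartanEquivDual H).symm θ) / 2) • killingForm ℂ L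

/-- `σ` is a diagram automorphism (the identity included): it permutes the Chevalley generators. -/
def IsDiagramAutomorphism (b : LieAlgebra.Basis ι H) (σ : L ≃ₗ⁅ℂ⁆ L) : Prop :=
  ∃ τ : Equiv.Perm ι, ∀ i, σ (b.e i) = b.e (τ i) ∧ σ (b.f i) = b.f (τ i)

/-- The automorphism `σ` of order four of `L` of type `A_{2n}`. The nodes of the Dynkin diagram
are numbered `0, …, 2n - 1`, so that the two middle ones are `n - 1` and `n`, and the nontrivial
diagram automorphism `τ` reverses the numbering. Then `σ (e k) = √-1 • e (τ k)` for the two middle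
nodes `k`, `σ (e k) = e (τ k)` for the others, and `σ` fixes the lowest root vectors, which are the
vectors annihilated by all `f i`. -/
def IsOrderFourAutomorphism (b : LieAlgebra.Basis ι H) (σ : L ≃ₗ⁅ℂ⁆ L) : Prop :=
  ∃ (n : ℕ) (u : Fin (2 * n) ≃ ι),
    (∀ j k, b.A (u j) (u k) = CartanMatrix.A (2 * n) j k) ∧
    (∀ k : Fin (2 * n), σ (b.e (u k)) =
      (if (k : ℕ) + 1 = n ∨ (k : ℕ) = n then Complex.I else 1) • b.e (u k.rev)) ∧
    ∀ y : L, (∀ i, ⁅b.f i, y⁆ = 0) → σ y = y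

/-- Special automorphisms, with respect to the given Chevalley generators. -/
def IsSpecial (b : LieAlgebra.Basis ι H) (σ : L ≃ₗ⁅ℂ⁆ L) : Prop :=
  IsDiagramAutomorphism b σ ∨ IsOrderFourAutomorphism b σ ∨ IsOrderFourAutomorphism b σ.symm

/-- The Lie algebra with the given Chevalley generators is of type `D₄`. -/
def IsTypeD4 (b : LieAlgebra.Basis ι H) : Prop :=
  ∃ u : Fin 4 ≃ ι, ∀ j k, b.A (u j) (u k) = CartanMatrix.D 4 j k

end Chevalley

/-! ### The grading defined by an automorphism of finite order -/

section Grading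

variable {L : Type*} [LieRing L] [LieAlgebra ℂ L]

/-- The fixed point subalgebra `L^σ`. -/
def fixedSubalgebra (σ : L ≃ₗ⁅ℂ⁆ L) : LieSubalgebra ℂ L where
  carrier := {x | σ x = x}
  add_mem' {x y} hx hy := by
    simp only [Set.mem_ofPred_eq] at *
    rw [map_add, hx, hy]
  zero_mem' := map_zero σ
  smul_mem' c x hx := by
    simp only [Set.mem_ofPred_eq] at *
    rw [map_smul, hx]
  lie_mem' {x y} hx hy := by
    change σ ⁅x, y⁆ = ⁅x, y⁆
    rw [LieEquiv.map_lie, show σ x = x from hx, show σ y = y from hy]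

/-- The order of `σ` as an automorphism. -/
def order (σ : L ≃ₗ⁅ℂ⁆ L) : ℕ := orderOf (σ.toLinearEquiv : L ≃ₗ[ℂ] L)

/-- The root of unity `ε = exp (2πi / m)`, for `m` the order of `σ`. -/
def rootOfUnity (σ : L ≃ₗ⁅ℂ⁆ L) : ℂ := Complex.exp (2 * Real.pi * Complex.I / order σ)

/-- The `ε ^ i`-eigenspace of `σ`, as a module over `L^σ`. -/
def gradedPiece (σ : L ≃ₗ⁅ℂ⁆ L) (i : ℤ) : LieSubmodule ℂ (fixedSubalgebra σ) L where
  carrier := {x | σ x = rootOfUnity σ ^ i • x}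
  add_mem' {x y} hx hy := by
    simp only [Set.mem_ofPred_eq] at *
    rw [map_add, hx, hy, smul_add]
  zero_mem' := by simp
  smul_mem' c x hx := by
    simp only [Set.mem_ofPred_eq] at *
    rw [map_smul, hx, smul_comm]
  lie_mem {x y} hy := by
    change σ ⁅(x : L), y⁆ = rootOfUnity σ ^ i • ⁅(x : L), y⁆
    rw [LieEquiv.map_lie, show σ (x : L) = x from x.2, show σ y = rootOfUnity σ ^ i • y from hy,
      lie_smul]

end Grading

/-! ### Weights of modules over the fixed point subalgebra

The Cartan subalgebra of `L^σ` is `T = H^σ = H ∩ L^σ`, and the nilradical of its Borel subalgebra is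
`N ∩ L^σ`, where `N` is the subalgebra of `L` generated by the `e i`. -/

section Weights

variable {ι L : Type*} [Fintype ι] [LieRing L] [LieAlgebra ℂ L] {H : LieSubalgebra ℂ L}

/-- The Cartan subalgebra `H ∩ L^σ` of `L^σ`. -/
def fixedCartan (H : LieSubalgebra ℂ L) (σ : L ≃ₗ⁅ℂ⁆ L) :
    LieSubalgebra ℂ (fixedSubalgebra σ) :=
  H.comap (fixedSubalgebra σ).incl

/-- The sum of the positive root spaces of `L^σ`. -/
def fixedNilradical (b : LieAlgebra.Basis ι H) (σ : L ≃ₗ⁅ℂ⁆ L) :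
    LieSubalgebra ℂ (fixedSubalgebra σ) :=
  (LieSubalgebra.lieSpan ℂ L (Set.range b.e)).comap (fixedSubalgebra σ).incl

/-- The positive roots of `L^σ`: the weights of `T` on `N ∩ L^σ`. -/
def positiveRoots (b : LieAlgebra.Basis ι H) (σ : L ≃ₗ⁅ℂ⁆ L) : Set (Dual ℂ (fixedCartan H σ)) :=
  {α | ∃ x ∈ fixedNilradical b σ, x ≠ 0 ∧
    ∀ h : fixedCartan H σ, ⁅(h : fixedSubalgebra σ), x⁆ = α h • x}

/-- Half the sum of the positive roots of `L^σ`. -/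
def rho (b : LieAlgebra.Basis ι H) (σ : L ≃ₗ⁅ℂ⁆ L) : Dual ℂ (fixedCartan H σ) :=
  (1 / 2 : ℂ) • ∑ᶠ (α) (_ : α ∈ positiveRoots b σ), α

/-- `lam` is a weight of the `L^σ`-module `M`. -/
def IsWeight (H : LieSubalgebra ℂ L) (σ : L ≃ₗ⁅ℂ⁆ L) (M : Type*) [AddCommGroup M] [Module ℂ M]
    [LieRingModule (fixedSubalgebra σ) M] (lam : Dual ℂ (fixedCartan H σ)) : Prop :=
  ∃ v : M, v ≠ 0 ∧ ∀ h : fixedCartan H σ, ⁅(h : fixedSubalgebra σ), v⁆ = lam h • v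

/-- `θ` is a maximal weight of the `L^σ`-module `M`, for the order in which `lam ≤ mu` if `mu - lam`
is a sum of positive roots of `L^σ`. -/
def IsMaximalWeight (b : LieAlgebra.Basis ι H) (σ : L ≃ₗ⁅ℂ⁆ L) (M : Type*) [AddCommGroup M]
    [Module ℂ M] [LieRingModule (fixedSubalgebra σ) M] (θ : Dual ℂ (fixedCartan H σ)) : Prop :=
  IsWeight H σ M θ ∧
    ∀ lam, IsWeight H σ M lam → lam - θ ∈ AddSubmonoid.closure (positiveRoots b σ) → lam = θ

/-- The `L^σ`-module `V` has a highest weight vector of weight `mu`; an irreducible `V` is then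
the module `V(mu)`. -/
def HasHighestWeight (b : LieAlgebra.Basis ι H) (σ : L ≃ₗ⁅ℂ⁆ L) (V : Type*) [AddCommGroup V]
    [Module ℂ V] [LieRingModule (fixedSubalgebra σ) V] (mu : Dual ℂ (fixedCartan H σ)) : Prop :=
  ∃ v : V, v ≠ 0 ∧ (∀ h : fixedCartan H σ, ⁅(h : fixedSubalgebra σ), v⁆ = mu h • v) ∧
    ∀ x ∈ fixedNilradical b σ, ⁅x, v⁆ = 0

/-- The restriction to `T` of a bilinear form on `L`, as the map `T → T*`, `x ↦ B x`. -/
def cartanToDual (B : LinearMap.BilinForm ℂ L) (H : LieSubalgebra ℂ L) (σ : L ≃ₗ⁅ℂ⁆ L) :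
    fixedCartan H σ →ₗ[ℂ] Dual ℂ (fixedCartan H σ) :=
  let incl : fixedCartan H σ →ₗ[ℂ] L :=
    (fixedSubalgebra σ).toSubmodule.subtype ∘ₗ (fixedCartan H σ).toSubmodule.subtype
  B.compl₁₂ incl incl

/-- The form `⟨lam, mu⟩` on `T*` induced by a form `B` on `L` whose restriction to `T` is
nondegenerate: the form that corresponds to `B` under the isomorphism `T ≃ T*` given by `B`, that
is, `⟨lam, mu⟩ = lam (x)` for the `x : T` with `B x = mu` on `T`. -/
def dualForm (B : LinearMap.BilinForm ℂ L) {H : LieSubalgebra ℂ L} {σ : L ≃ₗ⁅ℂ⁆ L}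
    (lam mu : Dual ℂ (fixedCartan H σ)) : ℂ :=
  lam (Function.invFun (cartanToDual B H σ) mu)

end Weights

/-- The operator `x ⊗ v ↦ ∑ k, [b k, x] ⊗ b' k • v` on `M ⊗ V`. -/
def casimirOperator {K κ : Type*} [Fintype κ] [LieRing K] [LieAlgebra ℂ K] (b b' : κ → K)
    (M V : Type*) [AddCommGroup M] [Module ℂ M] [LieRingModule K M] [LieModule ℂ K M]
    [AddCommGroup V] [Module ℂ V] [LieRingModule K V] [LieModule ℂ K V] :
    Module.End ℂ (M ⊗[ℂ] V) :=
  ∑ k, TensorProduct.map (LieModule.toEnd ℂ K M (b k)) (LieModule.toEnd ℂ K V (b' k))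

end

end TwistedCasimir

/-!
The operator `C = ∑ b ⊗ b'` is half of `Ω(M ⊗ V) - Ω(M) ⊗ 1 - 1 ⊗ Ω(V)`, where `Ω` is the Casimir
element of `K = L^σ`. Its eigenvalues are bounded without decomposing the tensor product.

*The bounds for a module between `-θ` and `θ`.* Let `M` be a `K`-module such that `θ - β` and
`θ + β` have nonnegative products with dominant weights, for all weights `β` of `M`. By dévissage
(`hasEigenvalue_casimirOperator_of_exact`) `M` may be assumed irreducible. Let `e` be an eigenvalue of
`C` and let `Q` be the quotient of `M ⊗ V` by the image of `C - e`. The Casimir element acts on `Q` by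
a scalar `c`, with `2e = c - Ω(M) - Ω(V)`. Since `M ⊗ V` is generated by the tensor product of a
lowest weight vector of `M` and a highest weight vector of `V`, its image in `Q` is not zero and
`⟨ν, ν + 2ρ⟩ ≤ c` for its weight `ν` (`SplitData.ip_le_casimir`); this gives the lower bound. The
upper bound comes from a primitive vector of `Q`, whose weight is a weight of `M ⊗ V`. The result is
`SplitData.IsPrim.bounds`, and it holds for every Lie algebra with a triangular decomposition in the
sense of `SplitData`.

*The weights of the eigenspaces of `σ`.* A special automorphism permutes the Chevalley generators up
to scalars (`IsSpecial.exists_isSpecialMonomial`). For the automorphism of order four only its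
values on the `e i` and on the lowest root vectors are given, and irreducibility of the adjoint
module determines those on the `h i` and `f i` (`map_h_of_lowest`, `map_f_of_map_h`). Averaging over
the powers of `σ` yields the triangular decomposition of `K` (`IsMonomial.exists_splitData`) and, for
each weight vector of an eigenspace `M` of `σ`, an opposite vector that completes it to an `sl₂`
(`IsMonomial.exists_opposite`). By the representation theory of this `sl₂`, if two weights of `M` have
a positive product, then their difference is a weight of `K`.

All weights of `M` lie between `-θ` and `θ` for every maximal weight `θ` (`SplitData.IsBase.weights_le`).
Indeed the weights of `M` are symmetric about `0`, because simple reflections lower the height of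
a positive weight or change its sign (`SplitData.IsBase.isWt_neg`). Any two maximal weights are equal:
they are dominant, so if neither is `0` their product is positive, as the Dynkin diagram of `L` is
connected, and they differ by a weight of `K`, hence are comparable. If `0` is a weight of `M`, then a
positive weight of `M` is a sum of positive roots of `K`. This is clear if all restrictions of simple
roots are roots of `K`. For the automorphism of order four, only twice the restriction `α` of the
middle simple roots is a root of `K`, but `σ ^ 2` is `1` on the Cartan subalgebra and `(-1) ^ n` on
vectors in whose weight `α` has coefficient `n`, so that `n` is even if `0` is a weight of `M`.
-/

set_option linter.unusedSectionVars false

namespace TwistedCasimir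

open scoped ComplexOrder

/-! ### Weights of modules over an abelian subalgebra -/

section WeightVectors

variable {K : Type*} [LieRing K] [LieAlgebra ℂ K] {T : LieSubalgebra ℂ K}
  {W : Type*} [AddCommGroup W] [Module ℂ W] [LieRingModule K W]
  {Q : Type*} [AddCommGroup Q] [Module ℂ Q] [LieRingModule K Q]

/-- `w` is a (possibly zero) weight vector of weight `ν` for the subalgebra `T`. -/
def IsWtVec (ν : Dual ℂ T) (w : W) : Prop := ∀ h : T, ⁅(h : K), w⁆ = ν h • w

variable (T W) in
/-- `ν` is a weight of `T` on `W`. -/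
def IsWt (ν : Dual ℂ T) : Prop := ∃ w : W, w ≠ 0 ∧ IsWtVec ν w

lemma IsWtVec.lie {K' : Type*} [LieRing K'] [LieAlgebra ℂ K'] {T' : LieSubalgebra ℂ K'}
    [LieRingModule K' W] {α ν : Dual ℂ T'} {x : K'} {w : W}
    (hx : IsWtVec α x) (hw : IsWtVec ν w) [LieModule ℂ K' W] : IsWtVec (α + ν) ⁅x, w⁆ := by
  intro h
  rw [leibniz_lie, hx h, hw h, lie_smul, smul_lie, ← add_smul, LinearMap.add_apply]

lemma IsWtVec.zero (ν : Dual ℂ T) : IsWtVec (W := W) ν 0 := fun h ↦ by simp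

lemma IsWtVec.add {ν : Dual ℂ T} {w w' : W} (hw : IsWtVec ν w) (hw' : IsWtVec ν w') :
    IsWtVec ν (w + w') :=
  fun h ↦ by rw [lie_add, hw h, hw' h, smul_add]

lemma IsWtVec.map {ν : Dual ℂ T} {w : W} (hw : IsWtVec ν w) (f : W →ₗ⁅ℂ, K⁆ Q) :
    IsWtVec ν (f w) :=
  fun h ↦ by rw [← LieModuleHom.map_lie, hw h, map_smul]

variable [LieModule ℂ K W] [LieModule ℂ K Q]

lemma IsWtVec.smul {ν : Dual ℂ T} {w : W} (hw : IsWtVec ν w) (c : ℂ) : IsWtVec ν (c • w) :=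
  fun h ↦ by rw [lie_smul, hw h, smul_comm]

lemma IsWtVec.tmul {ν ν' : Dual ℂ T} {w : W} {q : Q} (hw : IsWtVec ν w) (hq : IsWtVec ν' q) :
    IsWtVec (ν + ν') (w ⊗ₜ[ℂ] q) := fun h ↦ by
  rw [TensorProduct.LieModule.lie_tmul_right, hw h, hq h, ← TensorProduct.smul_tmul',
    TensorProduct.tmul_smul, ← add_smul, LinearMap.add_apply]

omit [LieModule ℂ K W] [LieModule ℂ K Q] in
lemma IsWt.map_injective {ν : Dual ℂ T} (h : IsWt T W ν) (f : W →ₗ⁅ℂ, K⁆ Q)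
    (hf : Function.Injective f) : IsWt T Q ν := by
  obtain ⟨w, hw0, hw⟩ := h
  exact ⟨f w, fun h0 ↦ hw0 (hf (h0.trans (map_zero f).symm)), hw.map f⟩

variable [IsLieAbelian T]

lemma IsWtVec.mem_genWeightSpace {ν : Dual ℂ T} {w : W} (hw : IsWtVec ν w) :
    w ∈ LieModule.genWeightSpace W (ν : T → ℂ) :=
  (LieModule.mem_genWeightSpace _ _ _).mpr fun x ↦ ⟨1, by
    simpa [sub_eq_zero] using hw x⟩

lemma isWt_iff_genWeightSpace_ne_bot [FiniteDimensional ℂ W] {ν : Dual ℂ T} :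
    IsWt T W ν ↔ LieModule.genWeightSpace W (ν : T → ℂ) ≠ ⊥ := by
  refine ⟨fun ⟨w, hw0, hw⟩ h ↦ hw0 ?_, fun h ↦ ?_⟩
  · simpa [h] using hw.mem_genWeightSpace
  · obtain ⟨w, hw0, hw⟩ := LieModule.exists_forall_lie_eq_smul ℂ T W ⟨ν, h⟩
    exact ⟨w, hw0, fun x ↦ hw x⟩

variable (T W) in
lemma finite_isWt [FiniteDimensional ℂ W] : {ν | IsWt T W ν}.Finite := by
  have := LieModule.finite_genWeightSpace_ne_bot ℂ T W
  refine Set.Finite.of_finite_image (f := fun ν : Dual ℂ T ↦ (ν : T → ℂ)) (this.subset ?_)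
    (fun a _ b _ h ↦ DFunLike.coe_injective h)
  rintro _ ⟨ν, hν, rfl⟩
  exact isWt_iff_genWeightSpace_ne_bot.mp hν

lemma IsWt.mem_of_iSup_eq_top [FiniteDimensional ℂ W] {ν : Dual ℂ T} (hν : IsWt T W ν)
    {X : Set (T → ℂ)} (hX : ⨆ χ ∈ X, LieModule.genWeightSpace W χ = ⊤) : (ν : T → ℂ) ∈ X :=
  (LieModule.iSupIndep_genWeightSpace ℂ T W).mem_of_biSup_eq_top hX
    (isWt_iff_genWeightSpace_ne_bot.mp hν)

/-- If weight vectors with weights in `X` span `W`, then all weights of `W` are in `X`. -/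
lemma IsWt.mem_of_span_eq_top [FiniteDimensional ℂ W] {ν : Dual ℂ T} (hν : IsWt T W ν)
    {X : Set (Dual ℂ T)} (hX : Submodule.span ℂ {w : W | ∃ χ ∈ X, IsWtVec χ w} = ⊤) : ν ∈ X := by
  have := hν.mem_of_iSup_eq_top (X := (fun ν : Dual ℂ T ↦ (ν : T → ℂ)) '' X) <| by
    rw [← LieSubmodule.toSubmodule_inj, LieSubmodule.top_toSubmodule, eq_top_iff, ← hX,
      Submodule.span_le]
    rintro w ⟨χ, hχ, hw⟩
    have h2 : LieModule.genWeightSpace W (χ : T → ℂ) ≤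
        ⨆ χ ∈ (fun ν : Dual ℂ T ↦ (ν : T → ℂ)) '' X, LieModule.genWeightSpace W χ :=
      le_iSup₂_of_le (χ : T → ℂ) ⟨χ, hχ, rfl⟩ le_rfl
    exact h2 hw.mem_genWeightSpace
  obtain ⟨χ, hχ, h⟩ := this
  rwa [← DFunLike.coe_injective h]

lemma IsWt.of_surjective [FiniteDimensional ℂ W] [FiniteDimensional ℂ Q] {ν : Dual ℂ T}
    (h : IsWt T Q ν) (f : W →ₗ⁅ℂ, K⁆ Q) (hf : Function.Surjective f) : IsWt T W ν := by
  let g : W →ₗ⁅ℂ, T⁆ Q := { (f : W →ₗ[ℂ] Q) with map_lie' := fun {x m} ↦ f.map_lie x m }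
  rw [isWt_iff_genWeightSpace_ne_bot]
  refine h.mem_of_iSup_eq_top (X := {χ | LieModule.genWeightSpace W χ ≠ ⊥}) ?_
  rw [eq_top_iff]
  rintro q -
  obtain ⟨w, rfl⟩ := hf q
  have hw : w ∈ (⨆ χ : T → ℂ, LieModule.genWeightSpace W χ) := by
    simp [LieModule.iSup_genWeightSpace_eq_top ℂ T W]
  have hle : (⨆ χ : T → ℂ, LieModule.genWeightSpace W χ) ≤
      LieSubmodule.comap g (⨆ χ ∈ {χ : T → ℂ | LieModule.genWeightSpace W χ ≠ ⊥},
        LieModule.genWeightSpace Q χ) := by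
    refine iSup_le fun χ ↦ ?_
    by_cases hχ : LieModule.genWeightSpace W χ = ⊥
    · simp [hχ]
    rw [← LieSubmodule.map_le_iff_le_comap]
    exact (LieModule.map_genWeightSpace_le g).trans (le_iSup₂_of_le χ hχ le_rfl)
  exact hle hw

variable (T W) in
lemma exists_isWt [FiniteDimensional ℂ W] [Nontrivial W] : ∃ ν, IsWt T W ν := by
  by_contra! h
  have h1 : (⨆ χ : T → ℂ, LieModule.genWeightSpace W χ) = ⊤ :=
    LieModule.iSup_genWeightSpace_eq_top ℂ T W
  have h2 : ∀ χ : T → ℂ, LieModule.genWeightSpace W χ = ⊥ := by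
    intro χ
    by_contra hχ
    obtain ⟨w, hw0, hw⟩ := LieModule.exists_forall_lie_eq_smul ℂ T W ⟨χ, hχ⟩
    exact h (LieModule.Weight.toLinear ℂ T W ⟨χ, hχ⟩) ⟨w, hw0, fun x ↦ hw x⟩
  simp only [h2, iSup_bot] at h1
  exact bot_ne_top h1

end WeightVectors

/-! ### Casimir elements -/

section DualBases

variable {K κ : Type*} [LieRing K] [LieAlgebra ℂ K] [Fintype κ]
  [DecidableEq κ] {B : LinearMap.BilinForm ℂ K} {b : Basis κ ℂ K} {b' : κ → K}

/-- The family `b'` is dual to the basis `b` for the form `B`. -/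
def IsDualBasis (B : LinearMap.BilinForm ℂ K) (b : Basis κ ℂ K) (b' : κ → K) : Prop :=
  ∀ j k, B (b j) (b' k) = if j = k then 1 else 0

lemma IsDualBasis.apply (h : IsDualBasis B b b') (j k : κ) :
    B (b j) (b' k) = if j = k then 1 else 0 := h j k

lemma IsDualBasis.sum_left (h : IsDualBasis B b b') (x : K) : ∑ k, B x (b' k) • b k = x := by
  conv_rhs => rw [← b.sum_repr x]
  refine Finset.sum_congr rfl fun k _ ↦ ?_
  congr 1
  conv_lhs => rw [← b.sum_repr x]
  simp only [map_sum, map_smul, LinearMap.sum_apply, LinearMap.smul_apply, h.apply, smul_eq_mul,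
    mul_ite, mul_one, mul_zero, Finset.sum_ite_eq', Finset.mem_univ, if_true]

lemma IsDualBasis.linearIndependent (h : IsDualBasis B b b') : LinearIndependent ℂ b' := by
  rw [Fintype.linearIndependent_iff]
  intro g hg i
  have := congrArg (B (b i)) hg
  simpa [h.apply] using this

lemma IsDualBasis.sum_right (h : IsDualBasis B b b') (y : K) : ∑ k, B (b k) y • b' k = y := by
  have hc : Fintype.card κ = finrank ℂ K := (finrank_eq_card_basis b).symm
  rcases isEmpty_or_nonempty κ with hκ | hκ
  · have : Subsingleton K := by
      have := b.repr.toEquiv.subsingleton_congr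
      exact this.mpr inferInstance
    exact Subsingleton.elim _ _
  set c := basisOfLinearIndependentOfCardEqFinrank h.linearIndependent hc with hcdef
  have hcb : ∀ k, c k = b' k := fun k ↦ by simp [hcdef]
  conv_rhs => rw [← c.sum_repr y]
  refine Finset.sum_congr rfl fun k _ ↦ ?_
  rw [hcb]
  congr 1
  conv_lhs => rw [← c.sum_repr y]
  simp only [map_sum, map_smul, hcb, h.apply, smul_eq_mul,
    mul_ite, mul_one, mul_zero, Finset.sum_ite_eq, Finset.mem_univ, if_true]

/-- The tensor `∑ k, b k ⊗ b' k` does not depend on the choice of the dual bases `b`, `b'`. -/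
lemma IsDualBasis.sum_eq {κ' X : Type*} [Fintype κ'] [DecidableEq κ'] [AddCommGroup X] [Module ℂ X]
    {c : Basis κ' ℂ K} {c' : κ' → K} (h : IsDualBasis B b b') (h' : IsDualBasis B c c')
    (F : K →ₗ[ℂ] K →ₗ[ℂ] X) : ∑ k, F (b k) (b' k) = ∑ j, F (c j) (c' j) := by
  calc ∑ k, F (b k) (b' k) = ∑ k, F (b k) (∑ j, B (c j) (b' k) • c' j) := by
        simp only [h'.sum_right]
    _ = ∑ j, F (∑ k, B (c j) (b' k) • b k) (c' j) := by
        simp only [map_sum, map_smul, LinearMap.sum_apply, LinearMap.smul_apply]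
        exact Finset.sum_comm
    _ = ∑ j, F (c j) (c' j) := by simp only [h.sum_left]

/-- The tensor `∑ k, b k ⊗ b' k` is symmetric if the form is. -/
lemma IsDualBasis.sum_swap {X : Type*} [AddCommGroup X] [Module ℂ X]
    (h : IsDualBasis B b b') (hB : ∀ x y, B x y = B y x) (F : K →ₗ[ℂ] K →ₗ[ℂ] X) :
    ∑ k, F (b' k) (b k) = ∑ k, F (b k) (b' k) := by
  calc ∑ k, F (b' k) (b k) = ∑ k, F (∑ j, B (b' k) (b' j) • b j) (b k) := by
        simp only [h.sum_left]
    _ = ∑ j, F (b j) (∑ k, B (b' j) (b' k) • b k) := by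
        simp only [map_sum, map_smul, LinearMap.sum_apply, LinearMap.smul_apply]
        rw [Finset.sum_comm]
        simp only [hB (b' _) (b' _)]
    _ = ∑ k, F (b k) (b' k) := by simp only [h.sum_left]

/-- The tensor `∑ k, b k ⊗ b' k` is invariant if the form is. -/
lemma IsDualBasis.sum_lie {X : Type*} [AddCommGroup X] [Module ℂ X]
    (h : IsDualBasis B b b') (hB : ∀ x y z, B ⁅x, y⁆ z = B x ⁅y, z⁆) (F : K →ₗ[ℂ] K →ₗ[ℂ] X)
    (x : K) : ∑ k, (F ⁅x, b k⁆ (b' k) + F (b k) ⁅x, b' k⁆) = 0 := by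
  have key : ∑ k, F ⁅x, b k⁆ (b' k) = ∑ j, F (b j) (-⁅x, b' j⁆) := by
    calc ∑ k, F ⁅x, b k⁆ (b' k) = ∑ k, F (∑ j, B ⁅x, b k⁆ (b' j) • b j) (b' k) := by
          simp only [h.sum_left]
      _ = ∑ j, F (b j) (∑ k, B (b k) (-⁅x, b' j⁆) • b' k) := by
          simp only [map_sum, map_smul, LinearMap.sum_apply, LinearMap.smul_apply]
          rw [Finset.sum_comm]
          refine Finset.sum_congr rfl fun j _ ↦ Finset.sum_congr rfl fun k _ ↦ ?_
          rw [← lie_skew, map_neg, LinearMap.neg_apply, hB, map_neg]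
      _ = _ := by simp only [h.sum_right]
  rw [Finset.sum_add_distrib, key, ← Finset.sum_add_distrib]
  exact Finset.sum_eq_zero fun k _ ↦ by rw [map_neg, neg_add_cancel]

end DualBases

section Casimir

variable {K κ : Type*} [LieRing K] [LieAlgebra ℂ K] [Fintype κ]
  {B : LinearMap.BilinForm ℂ K} {b : Basis κ ℂ K} {b' : κ → K}
  {S V Q : Type*} [AddCommGroup S] [Module ℂ S] [LieRingModule K S] [LieModule ℂ K S]
  [AddCommGroup V] [Module ℂ V] [LieRingModule K V] [LieModule ℂ K V]
  [AddCommGroup Q] [Module ℂ Q] [LieRingModule K Q] [LieModule ℂ K Q]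

/-- The action `w ↦ ∑ k, b k • b' k • w` of the Casimir element given by dual bases. -/
def casimirAct (b b' : κ → K) (w : S) : S := ∑ k, ⁅b k, ⁅b' k, w⁆⁆

/-- The bilinear map `(x, y) ↦ x • y • w`. -/
def lieLie (w : S) : K →ₗ[ℂ] K →ₗ[ℂ] S :=
  LinearMap.mk₂ ℂ (fun x y ↦ ⁅x, ⁅y, w⁆⁆) (by simp) (by simp) (by simp) (by simp)

lemma lieLie_apply (w : S) (x y : K) : lieLie w x y = ⁅x, ⁅y, w⁆⁆ := rfl

/-- The bilinear map `(x, y) ↦ x • s ⊗ y • v`. -/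
def lieTmulLie (s : S) (v : V) : K →ₗ[ℂ] K →ₗ[ℂ] S ⊗[ℂ] V :=
  LinearMap.mk₂ ℂ (fun x y ↦ ⁅x, s⁆ ⊗ₜ ⁅y, v⁆) (by simp [TensorProduct.add_tmul])
    (by simp [TensorProduct.smul_tmul']) (by simp [TensorProduct.tmul_add]) (by simp)

lemma lieTmulLie_apply (s : S) (v : V) (x y : K) :
    lieTmulLie s v x y = ⁅x, s⁆ ⊗ₜ ⁅y, v⁆ := rfl

lemma casimirAct_add (b b' : κ → K) (w w' : S) :
    casimirAct b b' (w + w') = casimirAct b b' w + casimirAct b b' w' := by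
  simp [casimirAct, Finset.sum_add_distrib]

lemma casimirAct_smul (b b' : κ → K) (c : ℂ) (w : S) :
    casimirAct b b' (c • w) = c • casimirAct b b' w := by
  simp [casimirAct, Finset.smul_sum]

lemma map_casimirAct (b b' : κ → K) (f : S →ₗ⁅ℂ, K⁆ Q) (w : S) :
    f (casimirAct b b' w) = casimirAct b b' (f w) := by
  simp [casimirAct]

lemma IsDualBasis.lie_casimirAct [DecidableEq κ] (h : IsDualBasis B b b')
    (hB : ∀ x y z, B ⁅x, y⁆ z = B x ⁅y, z⁆) (x : K) (w : S) :
    ⁅x, casimirAct b b' w⁆ = casimirAct b b' ⁅x, w⁆ := by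
  rw [← sub_eq_zero, ← h.sum_lie hB (lieLie w) x, casimirAct, casimirAct, lie_sum,
    ← Finset.sum_sub_distrib]
  refine Finset.sum_congr rfl fun k _ ↦ ?_
  simp only [lieLie_apply, lie_lie, lie_sub]
  abel

lemma casimirOperator_tmul (b b' : κ → K) (s : S) (v : V) :
    casimirOperator b b' S V (s ⊗ₜ v) = ∑ k, ⁅b k, s⁆ ⊗ₜ ⁅b' k, v⁆ := by
  simp [casimirOperator]

/-- The operator on the tensor product commutes with the action of the Lie algebra. -/
lemma IsDualBasis.lie_casimirOperator [DecidableEq κ] (h : IsDualBasis B b b')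
    (hB : ∀ x y z, B ⁅x, y⁆ z = B x ⁅y, z⁆) (x : K) (z : S ⊗[ℂ] V) :
    ⁅x, casimirOperator b b' S V z⁆ = casimirOperator b b' S V ⁅x, z⁆ := by
  induction z with
  | zero => simp
  | add z z' hz hz' => rw [map_add, lie_add, lie_add, map_add, hz, hz']
  | tmul s v =>
    rw [← sub_eq_zero, ← h.sum_lie hB (lieTmulLie s v) x, TensorProduct.LieModule.lie_tmul_right,
      map_add, casimirOperator_tmul, casimirOperator_tmul, casimirOperator_tmul, lie_sum,
      ← Finset.sum_add_distrib, ← Finset.sum_sub_distrib]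
    refine Finset.sum_congr rfl fun k _ ↦ ?_
    simp only [lieTmulLie_apply, lie_lie, TensorProduct.LieModule.lie_tmul_right,
      TensorProduct.sub_tmul, TensorProduct.tmul_sub]
    abel

/-- The operator on `S ⊗ V` is half the difference of the Casimir action on `S ⊗ V` and those on
the factors, here supposed to be scalar. -/
lemma IsDualBasis.casimirAct_tensor [DecidableEq κ] (h : IsDualBasis B b b') (hB : ∀ x y, B x y = B y x)
    {cS cV : ℂ} (hS : ∀ s : S, casimirAct b b' s = cS • s) (hV : ∀ v : V, casimirAct b b' v = cV • v)
    (z : S ⊗[ℂ] V) :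
    casimirAct b b' z = (2 : ℂ) • casimirOperator b b' S V z + (cS + cV) • z := by
  induction z with
  | zero => simp [casimirAct]
  | add z z' hz hz' => rw [casimirAct_add, hz, hz', map_add, smul_add, smul_add]; abel
  | tmul s v =>
    have h1 : casimirAct b b' (s ⊗ₜ[ℂ] v) = casimirAct b b' s ⊗ₜ v + s ⊗ₜ casimirAct b b' v +
        (∑ k, lieTmulLie s v (b' k) (b k) + ∑ k, lieTmulLie s v (b k) (b' k)) := by
      simp only [casimirAct, TensorProduct.LieModule.lie_tmul_right, lie_add,
        Finset.sum_add_distrib, lieTmulLie_apply, TensorProduct.sum_tmul,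
        TensorProduct.tmul_sum]
      abel
    rw [h1, h.sum_swap hB, hS, hV, casimirOperator_tmul, two_smul, add_smul,
      TensorProduct.smul_tmul', TensorProduct.tmul_smul]
    simp only [lieTmulLie_apply]
    abel

end Casimir

/-! ### Generation of irreducible modules -/

section Generation

variable {K V : Type*} [LieRing K] [LieAlgebra ℂ K] [AddCommGroup V] [Module ℂ V]
  [LieRingModule K V] [LieModule ℂ K V]

/-- The elements of `K` that map `v` to a multiple of `v`. -/
def lineStabilizer (K : Type*) [LieRing K] [LieAlgebra ℂ K] [LieRingModule K V] [LieModule ℂ K V]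
    (v : V) : Submodule ℂ K :=
  (ℂ ∙ v).comap ((LieModule.toEnd ℂ K V : K →ₗ[ℂ] End ℂ V).flip v)

lemma mem_lineStabilizer (x : K) (v : V) : x ∈ lineStabilizer K v ↔ ∃ c : ℂ, c • v = ⁅x, v⁆ :=
  Submodule.mem_span_singleton

/-- If a set `F` spans `K` together with the stabilizer of the line of `v`, then an irreducible
module is generated by `v` under the action of `F` alone. -/
lemma eq_top_of_lie_mem [LieModule.IsIrreducible ℂ K V] {F : Set K} {v : V} (hv : v ≠ 0)
    (hF : ∀ x, x ∈ Submodule.span ℂ F ⊔ lineStabilizer K v)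
    {X : Submodule ℂ V} (hvX : v ∈ X) (hX : ∀ y ∈ F, ∀ w ∈ X, ⁅y, w⁆ ∈ X) : X = ⊤ := by
  let W : Submodule ℂ V := sInf {Y | v ∈ Y ∧ ∀ y ∈ F, ∀ w ∈ Y, ⁅y, w⁆ ∈ Y}
  have hvW : v ∈ W := by
    simp only [W, Submodule.mem_sInf]
    exact fun Y hY ↦ hY.1
  have hfW : ∀ y ∈ F, ∀ w ∈ W, ⁅y, w⁆ ∈ W := by
    intro y hy w hw
    simp only [W, Submodule.mem_sInf] at hw ⊢
    exact fun Y hY ↦ hY.2 y hy w (hw Y hY)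
  have hWle : ∀ Y : Submodule ℂ V, v ∈ Y → (∀ y ∈ F, ∀ w ∈ Y, ⁅y, w⁆ ∈ Y) → W ≤ Y :=
    fun Y h1 h2 ↦ sInf_le ⟨h1, h2⟩
  -- the vectors of `W` that `K` maps into `W` form a subspace stable under `F`
  let N : Submodule ℂ V :=
    { carrier := {w | w ∈ W ∧ ∀ x : K, ⁅x, w⁆ ∈ W}
      add_mem' := fun {a b} ha hb ↦ ⟨W.add_mem ha.1 hb.1, fun x ↦ by
        rw [lie_add]; exact W.add_mem (ha.2 x) (hb.2 x)⟩
      zero_mem' := ⟨W.zero_mem, fun x ↦ by simp⟩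
      smul_mem' := fun c a ha ↦ ⟨W.smul_mem c ha.1, fun x ↦ by
        rw [lie_smul]; exact W.smul_mem c (ha.2 x)⟩ }
  have hWN : W ≤ N := by
    refine hWle N ⟨hvW, fun x ↦ ?_⟩ fun y hy w hw ↦ ⟨hfW y hy w hw.1, fun x ↦ ?_⟩
    · let S : Submodule ℂ K := W.comap ((LieModule.toEnd ℂ K V : K →ₗ[ℂ] End ℂ V).flip v)
      have hS : Submodule.span ℂ F ⊔ lineStabilizer K v ≤ S := by
        refine sup_le (Submodule.span_le.mpr fun y hy ↦ hfW y hy v hvW) fun y hy ↦ ?_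
        obtain ⟨c, hc⟩ := (mem_lineStabilizer y v).mp hy
        change ⁅y, v⁆ ∈ W
        rw [← hc]
        exact W.smul_mem c hvW
      exact hS (hF x)
    · rw [leibniz_lie]
      exact W.add_mem (hw.2 _) (hfW y hy _ (hw.2 x))
  let W' : LieSubmodule ℂ K V := { W with lie_mem := fun {x w} hw ↦ (hWN hw).2 x }
  have hW' : W' = ⊤ := by
    have : W' ≠ ⊥ := fun h ↦ hv <| by
      have : v ∈ W' := hvW
      simpa [h] using this
    exact (IsSimpleOrder.eq_bot_or_eq_top W').resolve_left this
  rw [eq_top_iff]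
  intro w _
  exact hWle X hvX hX (show w ∈ W' by simp [hW'])

end Generation

/-! ### Triangular decompositions -/

/-- A triangular decomposition of a Lie algebra `K` with an invariant form, relative to an abelian
subalgebra `T`: a finite set `pos` of weights (the positive roots, each of multiplicity one), root
vectors `e β` and `f β` for `β ∈ pos` that are dual to each other for the form and that span `K`
together with `T`, the elements `coh β = ⁅e β, f β⁆` of `T`, and an element `ht` of `T` on which the
positive roots are positive. Inequalities in `ℂ` include the assertion that the difference is
real. -/
structure SplitData {K : Type*} [LieRing K] [LieAlgebra ℂ K] (T : LieSubalgebra ℂ K) where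
  form : LinearMap.BilinForm ℂ K
  form_symm : ∀ x y, form x y = form y x
  form_lie : ∀ x y z, form ⁅x, y⁆ z = form x ⁅y, z⁆
  form_T : ∀ t : T, (∀ t' : T, form t t' = 0) → t = 0
  pos : Finset (Dual ℂ T)
  e : Dual ℂ T → K
  f : Dual ℂ T → K
  coh : Dual ℂ T → T
  lie_e_f : ∀ β ∈ pos, ⁅e β, f β⁆ = coh β
  isWtVec_e : ∀ β ∈ pos, IsWtVec β (e β)
  isWtVec_f : ∀ β ∈ pos, IsWtVec (-β) (f β)
  form_e_f : ∀ β ∈ pos, form (e β) (f β) = 1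
  span_eq_top : T.toSubmodule ⊔ Submodule.span ℂ (e '' pos) ⊔ Submodule.span ℂ (f '' pos) = ⊤
  ht : T
  ht_pos : ∀ β ∈ pos, 0 < β ht
  norm_pos : ∀ β ∈ pos, 0 < β (coh β)

namespace SplitData

variable {K : Type*} [LieRing K] [LieAlgebra ℂ K] {T : LieSubalgebra ℂ K} (D : SplitData T)

open scoped Classical in
/-- The opposite decomposition, in which positive and negative roots are interchanged. -/
noncomputable def op : SplitData T where
  form := D.form
  form_symm := D.form_symm
  form_lie := D.form_lie
  form_T := D.form_T
  pos := D.pos.image Neg.neg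
  e β := D.f (-β)
  f β := D.e (-β)
  coh β := -D.coh (-β)
  lie_e_f := by
    simp only [Finset.mem_image, forall_exists_index, and_imp, forall_apply_eq_imp_iff₂, neg_neg]
    intro β hβ
    rw [← lie_skew, D.lie_e_f β hβ]
    rfl
  isWtVec_e := by
    simp only [Finset.mem_image, forall_exists_index, and_imp, forall_apply_eq_imp_iff₂, neg_neg]
    exact D.isWtVec_f
  isWtVec_f := by
    simp only [Finset.mem_image, forall_exists_index, and_imp, forall_apply_eq_imp_iff₂, neg_neg]
    exact D.isWtVec_e
  form_e_f := by
    simp only [Finset.mem_image, forall_exists_index, and_imp, forall_apply_eq_imp_iff₂, neg_neg]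
    intro β hβ
    rw [D.form_symm, D.form_e_f β hβ]
  span_eq_top := by
    have h (g : Dual ℂ T → K) : (fun β ↦ g (-β)) '' (D.pos.image Neg.neg : Finset (Dual ℂ T)) =
        g '' D.pos := by
      rw [Finset.coe_image, Set.image_image]
      simp only [neg_neg]
    rw [← D.span_eq_top, sup_right_comm, h, h]
  ht := -D.ht
  ht_pos := by
    simp only [Finset.mem_image, forall_exists_index, and_imp, forall_apply_eq_imp_iff₂]
    intro β hβ
    simpa using D.ht_pos β hβ
  norm_pos := by
    simp only [Finset.mem_image, forall_exists_index, and_imp, forall_apply_eq_imp_iff₂]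
    intro β hβ
    simpa using D.norm_pos β hβ

lemma neg_mem_op_pos {β : Dual ℂ T} (hβ : β ∈ D.pos) : -β ∈ D.op.pos := by
  simpa [op] using hβ

/-- The weights of the form that pairs nonnegatively with every positive root. -/
def Dominant (ν : Dual ℂ T) : Prop := ∀ β ∈ D.pos, 0 ≤ ν (D.coh β)

lemma ne_zero_of_mem {β : Dual ℂ T} (hβ : β ∈ D.pos) : β ≠ 0 := by
  rintro rfl
  exact lt_irrefl _ (D.ht_pos 0 hβ)

lemma mem_of_forall {S : Submodule ℂ K} (hT : ∀ t : T, (t : K) ∈ S) (he : ∀ β ∈ D.pos, D.e β ∈ S)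
    (hf : ∀ β ∈ D.pos, D.f β ∈ S) (x : K) : x ∈ S := by
  have : (⊤ : Submodule ℂ K) ≤ S := by
    rw [← D.span_eq_top]
    refine sup_le (sup_le (fun t ht ↦ hT ⟨t, ht⟩) (Submodule.span_le.mpr ?_))
      (Submodule.span_le.mpr ?_)
    · rintro _ ⟨β, hβ, rfl⟩
      exact he β hβ
    · rintro _ ⟨β, hβ, rfl⟩
      exact hf β hβ
  exact this trivial

section Generation

variable {V : Type*} [AddCommGroup V] [Module ℂ V] [LieRingModule K V] [LieModule ℂ K V]

/-- `v` is a primitive (highest weight) vector of weight `μ`. -/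
structure IsPrim (μ : Dual ℂ T) (v : V) : Prop where
  ne_zero : v ≠ 0
  isWtVec : IsWtVec μ v
  lie_e : ∀ β ∈ D.pos, ⁅D.e β, v⁆ = 0

variable {D} in
/-- An irreducible module is generated by a primitive vector under the action of the negative root
vectors alone. -/
lemma IsPrim.eq_top [LieModule.IsIrreducible ℂ K V] {μ : Dual ℂ T} {v : V} (hv : D.IsPrim μ v)
    {X : Submodule ℂ V} (hvX : v ∈ X) (hX : ∀ β ∈ D.pos, ∀ w ∈ X, ⁅D.f β, w⁆ ∈ X) : X = ⊤ := by
  refine eq_top_of_lie_mem (F := D.f '' D.pos) hv.ne_zero (fun x ↦ ?_) hvX ?_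
  · refine D.mem_of_forall (fun t ↦ Submodule.mem_sup_right ?_)
      (fun β hβ ↦ Submodule.mem_sup_right ?_)
      (fun β hβ ↦ Submodule.mem_sup_left (Submodule.subset_span (Set.mem_image_of_mem D.f hβ))) x
    · exact (mem_lineStabilizer _ _).mpr ⟨μ t, (hv.isWtVec t).symm⟩
    · exact (mem_lineStabilizer _ _).mpr ⟨0, by rw [hv.lie_e β hβ, zero_smul]⟩
  · rintro _ ⟨β, hβ, rfl⟩ w hw
    exact hX β hβ w hw

variable {D} in
/-- An irreducible module is spanned by weight vectors of weights below the highest weight. -/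
lemma IsPrim.span_eq_top [LieModule.IsIrreducible ℂ K V] {μ : Dual ℂ T} {v : V}
    (hv : D.IsPrim μ v) :
    Submodule.span ℂ {w : V | ∃ ν, μ - ν ∈ AddSubmonoid.closure (D.pos : Set (Dual ℂ T)) ∧
      IsWtVec ν w} = ⊤ := by
  refine hv.eq_top (Submodule.subset_span ⟨μ, by simp, hv.isWtVec⟩) fun β hβ w hw ↦ ?_
  induction hw using Submodule.span_induction with
  | zero => simp
  | add a b _ _ ha hb => rw [lie_add]; exact add_mem ha hb
  | smul c a _ ha => rw [lie_smul]; exact Submodule.smul_mem _ c ha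
  | mem w hw =>
    obtain ⟨χ, hχ, hw⟩ := hw
    refine Submodule.subset_span ⟨-β + χ, ?_, (D.isWtVec_f β hβ).lie hw⟩
    have : μ - (-β + χ) = (μ - χ) + β := by abel
    rw [this]
    exact add_mem hχ (AddSubmonoid.subset_closure hβ)

end Generation

section InducedForm

variable [FiniteDimensional ℂ K]

/-- The isomorphism `T ≃ T*` given by the form. -/
noncomputable def toDual : T ≃ₗ[ℂ] Dual ℂ T :=
  LinearMap.linearEquivOfInjective
    (D.form.compl₁₂ T.toSubmodule.subtype T.toSubmodule.subtype)
    (by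
      rw [← LinearMap.ker_eq_bot, LinearMap.ker_eq_bot']
      exact fun t ht ↦ D.form_T t fun t' ↦ LinearMap.congr_fun ht t')
    Subspace.dual_finrank_eq.symm

lemma toDual_apply (t t' : T) : D.toDual t t' = D.form t t' := rfl

/-- The induced form on `T*`. -/
noncomputable def ip (lam mu : Dual ℂ T) : ℂ := lam (D.toDual.symm mu)

lemma ip_symm (lam mu : Dual ℂ T) : D.ip lam mu = D.ip mu lam := by
  have h1 : D.ip lam mu = D.form (D.toDual.symm lam) (D.toDual.symm mu) := by
    rw [← toDual_apply, LinearEquiv.apply_symm_apply, ip]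
  have h2 : D.ip mu lam = D.form (D.toDual.symm mu) (D.toDual.symm lam) := by
    rw [← toDual_apply, LinearEquiv.apply_symm_apply, ip]
  rw [h1, h2, D.form_symm]

lemma ip_add_left (a b c : Dual ℂ T) : D.ip (a + b) c = D.ip a c + D.ip b c := rfl

lemma ip_add_right (a b c : Dual ℂ T) : D.ip a (b + c) = D.ip a b + D.ip a c := by
  simp [ip]

lemma ip_sub_left (a b c : Dual ℂ T) : D.ip (a - b) c = D.ip a c - D.ip b c := rfl

lemma ip_sub_right (a b c : Dual ℂ T) : D.ip a (b - c) = D.ip a b - D.ip a c := by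
  simp [ip]

lemma ip_smul_left (r : ℂ) (a b : Dual ℂ T) : D.ip (r • a) b = r * D.ip a b := rfl

lemma ip_smul_right (r : ℂ) (a b : Dual ℂ T) : D.ip a (r • b) = r * D.ip a b := by
  simp [ip]

lemma ip_sum_right {α : Type*} (s : Finset α) (a : Dual ℂ T) (g : α → Dual ℂ T) :
    D.ip a (∑ i ∈ s, g i) = ∑ i ∈ s, D.ip a (g i) := by
  simp [ip]

lemma toDual_coh {β : Dual ℂ T} (hβ : β ∈ D.pos) : D.toDual (D.coh β) = β := by
  ext t
  rw [toDual_apply, ← D.lie_e_f β hβ, D.form_lie, ← lie_skew, D.isWtVec_f β hβ t, map_neg,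
    map_smul, D.form_e_f β hβ]
  simp

lemma ip_pos {β : Dual ℂ T} (hβ : β ∈ D.pos) (ν : Dual ℂ T) : D.ip ν β = ν (D.coh β) := by
  rw [ip, (LinearEquiv.symm_apply_eq _).mpr (D.toDual_coh hβ).symm]

variable {D} in
lemma Dominant.ip_nonneg {ν q : Dual ℂ T} (hν : D.Dominant ν)
    (hq : q ∈ AddSubmonoid.closure (D.pos : Set (Dual ℂ T))) : 0 ≤ D.ip ν q := by
  induction hq using AddSubmonoid.closure_induction with
  | zero => simp [ip]
  | add a b _ _ ha hb => rw [ip_add_right]; exact add_nonneg ha hb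
  | mem a ha => rw [D.ip_pos ha]; exact hν a ha

variable {D} in
lemma Dominant.add {ν ν' : Dual ℂ T} (hν : D.Dominant ν) (hν' : D.Dominant ν') :
    D.Dominant (ν + ν') := fun β hβ ↦ add_nonneg (hν β hβ) (hν' β hβ)

end InducedForm

end SplitData

namespace SplitData

/-! ### Reflections of weights -/

variable {K : Type*} [LieRing K] [LieAlgebra ℂ K] {T : LieSubalgebra ℂ K} (D : SplitData T)
  {W : Type*} [AddCommGroup W] [Module ℂ W] [LieRingModule K W] [LieModule ℂ K W]

lemma isSl2Triple {β : Dual ℂ T} (hβ : β ∈ D.pos) :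
    IsSl2Triple ((2 / β (D.coh β)) • (D.coh β : K)) (D.e β) ((2 / β (D.coh β)) • D.f β) := by
  have hn := (D.norm_pos β hβ).ne'
  have he : D.e β ≠ 0 := fun h ↦ by simpa [h] using D.form_e_f β hβ
  have h1 : ⁅(2 / β (D.coh β)) • (D.coh β : K), D.e β⁆ = 2 • D.e β := by
    rw [smul_lie, D.isWtVec_e β hβ, smul_smul, div_mul_cancel₀ _ hn, ofNat_smul_eq_nsmul]
  refine ⟨fun h ↦ ?_, ?_, h1, ?_⟩
  · rw [h, zero_lie] at h1
    have : (2 : ℂ) • D.e β = 0 := by rw [ofNat_smul_eq_nsmul, ← h1]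
    simp [he] at this
  · rw [lie_smul, D.lie_e_f β hβ]
  · rw [lie_smul, smul_lie, D.isWtVec_f β hβ, LinearMap.neg_apply, neg_smul, smul_neg, smul_neg,
      smul_smul (2 / β (D.coh β)) (β (D.coh β)), div_mul_cancel₀ _ hn, smul_comm,
      ofNat_smul_eq_nsmul]

lemma isWtVec_pow_e {β ν : Dual ℂ T} (hβ : β ∈ D.pos) {w : W} (hw : IsWtVec ν w) (n : ℕ) :
    IsWtVec (ν + n • β) ((LieModule.toEnd ℂ K W (D.e β) ^ n) w) := by
  induction n with
  | zero => simpa using hw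
  | succ n ih =>
    rw [pow_succ', Module.End.mul_apply, LieModule.toEnd_apply_apply]
    convert! (D.isWtVec_e β hβ).lie ih using 1
    rw [succ_nsmul]; abel

lemma isWtVec_pow_f {β ν : Dual ℂ T} (hβ : β ∈ D.pos) {w : W} (hw : IsWtVec ν w) (c : ℂ) (n : ℕ) :
    IsWtVec (ν - n • β) ((LieModule.toEnd ℂ K W (c • D.f β) ^ n) w) := by
  induction n with
  | zero => simpa using hw
  | succ n ih =>
    rw [pow_succ', Module.End.mul_apply, LieModule.toEnd_apply_apply, smul_lie]
    refine IsWtVec.smul ?_ c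
    convert! (D.isWtVec_f β hβ).lie ih using 1
    rw [succ_nsmul]; abel

/-- The part of the string of `ν` in the direction of a positive root that is obtained by lowering
the top of the string. -/
lemma exists_string [FiniteDimensional ℂ W] [IsLieAbelian T] {β ν : Dual ℂ T} (hβ : β ∈ D.pos)
    (hν : IsWt T W ν) : ∃ p l : ℕ, 2 * ν (D.coh β) = ((l : ℂ) - 2 * p) * β (D.coh β) ∧
      ∀ j ≤ l, IsWt T W (ν + p • β - j • β) := by
  obtain ⟨w, hw0, hw⟩ := hν
  have hn := (D.norm_pos β hβ).ne'
  let E := LieModule.toEnd ℂ K W (D.e β)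
  have hex : ∃ n, (E ^ n) w = 0 := by
    by_contra! h
    have hinj : Function.Injective fun n : ℕ ↦ ν + n • β := by
      intro m n hmn
      have : (m : ℂ) • β = (n : ℂ) • β := by simpa [Nat.cast_smul_eq_nsmul] using hmn
      exact_mod_cast smul_left_injective ℂ (D.ne_zero_of_mem hβ) this
    have hmem (n : ℕ) : ν + n • β ∈ {ν | IsWt T W ν} :=
      ⟨(E ^ n) w, h n, D.isWtVec_pow_e hβ hw n⟩
    exact Set.infinite_of_injective_forall_mem hinj hmem (finite_isWt T W)
  obtain ⟨p, hp1, hp2⟩ := Nat.exists_not_and_succ_of_not_zero_of_exists (p := fun n ↦ (E ^ n) w = 0)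
    (by simpa using hw0) hex
  have hwp := D.isWtVec_pow_e hβ hw p
  have P : (D.isSl2Triple hβ).HasPrimitiveVectorWith ((E ^ p) w)
      ((2 / β (D.coh β)) * (ν (D.coh β) + p * β (D.coh β))) :=
    { ne_zero := hp1
      lie_h := by
        rw [smul_lie, hwp, smul_smul]
        simp [E]
      lie_e := by
        rw [pow_succ', Module.End.mul_apply] at hp2
        exact hp2 }
  obtain ⟨l, hl⟩ := P.exists_nat
  refine ⟨p, l, ?_, fun j hj ↦ ⟨_, P.pow_toEnd_f_ne_zero_of_eq_nat hl hj, ?_⟩⟩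
  · rw [← hl]
    field_simp
    ring
  · exact D.isWtVec_pow_f hβ hwp _ j

/-- The weights of a finite-dimensional module are stable under the reflections in the roots. -/
lemma exists_reflection [FiniteDimensional ℂ W] [IsLieAbelian T] {β ν : Dual ℂ T} (hβ : β ∈ D.pos)
    (hν : IsWt T W ν) : ∃ k : ℤ, 2 * ν (D.coh β) = k * β (D.coh β) ∧ IsWt T W (ν - k • β) := by
  have hn := (D.norm_pos β hβ).ne'
  obtain ⟨p, l, h, hl⟩ := D.exists_string hβ hν
  by_cases hpl : p ≤ l
  · refine ⟨l - 2 * p, by push_cast; exact h, ?_⟩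
    convert! hl (l - p) (Nat.sub_le _ _) using 1
    rw [← natCast_zsmul, ← natCast_zsmul, Nat.cast_sub hpl]
    module
  · obtain ⟨q, l', h', hl'⟩ := D.op.exists_string (D.neg_mem_op_pos hβ) hν
    have h'' : 2 * ν (D.coh β) = (2 * (q : ℂ) - l') * β (D.coh β) := by
      simp only [op, neg_neg, map_neg, LinearMap.neg_apply] at h'
      linear_combination -h'
    have hk : (l : ℤ) - 2 * p = 2 * q - l' := by
      have := h.symm.trans h''
      exact_mod_cast mul_right_cancel₀ hn this
    refine ⟨2 * q - l', by push_cast; exact h'', ?_⟩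
    have hql : q ≤ l' := by lia
    convert! hl' (l' - q) (Nat.sub_le _ _) using 1
    rw [← natCast_zsmul, ← natCast_zsmul, Nat.cast_sub hql]
    module

lemma IsPrim.dominant [FiniteDimensional ℂ W] {D : SplitData T} {lam : Dual ℂ T} {w : W}
    (hw : D.IsPrim lam w) : D.Dominant lam := by
  intro β hβ
  have hn := D.norm_pos β hβ
  have P : (D.isSl2Triple hβ).HasPrimitiveVectorWith w ((2 / β (D.coh β)) * lam (D.coh β)) :=
    { ne_zero := hw.ne_zero
      lie_h := by rw [smul_lie, hw.isWtVec, smul_smul]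
      lie_e := hw.lie_e β hβ }
  obtain ⟨l, hl⟩ := P.exists_nat
  have : lam (D.coh β) = l * β (D.coh β) * (1 / 2 : ℂ) := by
    rw [← hl]
    field_simp [hn.ne']
  rw [this]
  have h2 : (0 : ℂ) ≤ 1 / 2 := by
    rw [Complex.le_def]; norm_num
  exact mul_nonneg (mul_nonneg (Nat.cast_nonneg l) hn.le) h2

/-! ### Half the sum of the positive roots -/

/-- Half the sum of the positive roots. -/
noncomputable def rho : Dual ℂ T := (1 / 2 : ℂ) • ∑ β ∈ D.pos, β

lemma isWt_of_mem_pos {β : Dual ℂ T} (hβ : β ∈ D.pos) : IsWt T K β :=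
  ⟨D.e β, fun h ↦ by simpa [h] using D.form_e_f β hβ, D.isWtVec_e β hβ⟩

lemma isWtVec_coe [IsLieAbelian T] (t : T) : IsWtVec (T := T) 0 (t : K) := fun t' ↦ by
  rw [← LieSubalgebra.coe_bracket, trivial_lie_zero]
  simp

/-- The weights of the adjoint module are `0` and the roots. -/
lemma eq_zero_or_mem_pos [FiniteDimensional ℂ K] [IsLieAbelian T] {ν : Dual ℂ T}
    (hν : IsWt T K ν) : ν = 0 ∨ ν ∈ D.pos ∨ -ν ∈ D.pos := by
  let X : Set (Dual ℂ T) := {ν | ν = 0 ∨ ν ∈ D.pos ∨ -ν ∈ D.pos}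
  refine hν.mem_of_span_eq_top (X := X) ?_
  have hX (χ : Dual ℂ T) (hχ : χ ∈ X) (x : K) (hx : IsWtVec χ x) :
      x ∈ Submodule.span ℂ {w : K | ∃ χ ∈ X, IsWtVec χ w} := Submodule.subset_span ⟨χ, hχ, hx⟩
  rw [eq_top_iff]
  intro x _
  exact D.mem_of_forall (fun t ↦ hX 0 (Or.inl rfl) _ (isWtVec_coe t))
    (fun β hβ ↦ hX β (Or.inr (Or.inl hβ)) _ (D.isWtVec_e β hβ))
    (fun β hβ ↦ hX (-β) (Or.inr (Or.inr (by simpa using hβ))) _ (D.isWtVec_f β hβ)) x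

/-- The reflection in a positive root `γ` maps the positive roots that pair negatively with `γ` to
positive roots that pair positively with `γ`, whence half the sum of the positive roots is
dominant. -/
lemma dominant_rho [FiniteDimensional ℂ K] [IsLieAbelian T] : D.Dominant D.rho := by
  classical
  intro γ hγ
  have hn := D.norm_pos γ hγ
  have hex (β : Dual ℂ T) : ∃ k : ℤ, β ∈ D.pos →
      2 * β (D.coh γ) = k * γ (D.coh γ) ∧ IsWt T K (β - k • γ) := by
    by_cases hβ : β ∈ D.pos
    · obtain ⟨k, hk⟩ := D.exists_reflection hγ (D.isWt_of_mem_pos hβ)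
      exact ⟨k, fun _ ↦ hk⟩
    · exact ⟨0, fun h ↦ (hβ h).elim⟩
  choose k hk using hex
  have hrefl (β : Dual ℂ T) (hβ : β ∈ D.pos) (hneg : k β < 0) :
      β - k β • γ ∈ D.pos ∧ k (β - k β • γ) = -k β := by
    have hht : 0 < (β - k β • γ) D.ht := by
      have h1 : (0 : ℂ) < ((-k β : ℤ) : ℂ) := by exact_mod_cast (by lia : 0 < -k β)
      have h2 : (β - k β • γ) D.ht = β D.ht + ((-k β : ℤ) : ℂ) * γ D.ht := by
        simp [sub_eq_add_neg]
      rw [h2]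
      exact add_pos (D.ht_pos β hβ) (mul_pos h1 (D.ht_pos γ hγ))
    have hmem : β - k β • γ ∈ D.pos := by
      rcases D.eq_zero_or_mem_pos (hk β hβ).2 with h | h | h
      · simp [h] at hht
      · exact h
      · have h3 := add_pos (D.ht_pos _ h) hht
        rw [LinearMap.neg_apply, neg_add_cancel] at h3
        exact (lt_irrefl _ h3).elim
    refine ⟨hmem, ?_⟩
    have h1 := (hk _ hmem).1
    have h2 := (hk β hβ).1
    have h3 : ((k (β - k β • γ) : ℤ) : ℂ) * γ (D.coh γ) = ((-k β : ℤ) : ℂ) * γ (D.coh γ) := by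
      rw [← h1]
      simp only [LinearMap.sub_apply, LinearMap.smul_apply, zsmul_eq_mul]
      push_cast
      linear_combination h2
    exact_mod_cast mul_right_cancel₀ hn.ne' h3
  have hsum : 0 ≤ ∑ β ∈ D.pos, k β := by
    rw [← Finset.sum_filter_add_sum_filter_not D.pos (fun β ↦ k β < 0)]
    have himg : ∑ β ∈ D.pos.filter (fun β ↦ k β < 0), -k β ≤
        ∑ β ∈ D.pos.filter (fun β ↦ ¬ k β < 0), k β := by
      calc ∑ β ∈ D.pos.filter (fun β ↦ k β < 0), -k β
          = ∑ β ∈ D.pos.filter (fun β ↦ k β < 0), k (β - k β • γ) := by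
            refine Finset.sum_congr rfl fun β hβ ↦ ?_
            rw [Finset.mem_filter] at hβ
            exact (hrefl β hβ.1 hβ.2).2.symm
        _ = ∑ δ ∈ (D.pos.filter (fun β ↦ k β < 0)).image (fun β ↦ β - k β • γ), k δ := by
            refine (Finset.sum_image ?_).symm
            intro β hβ β' hβ' h
            simp only [Finset.coe_filter, Set.mem_ofPred_eq] at hβ hβ'
            have h1 : k (β - k β • γ) = k (β' - k β' • γ) := congrArg k h
            rw [(hrefl β hβ.1 hβ.2).2, (hrefl β' hβ'.1 hβ'.2).2, neg_inj] at h1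
            simpa [h1] using h
        _ ≤ _ := by
            refine Finset.sum_le_sum_of_subset_of_nonneg ?_ ?_
            · intro δ hδ
              simp only [Finset.mem_image, Finset.mem_filter] at hδ ⊢
              obtain ⟨β, ⟨hβ, hneg⟩, rfl⟩ := hδ
              refine ⟨(hrefl β hβ hneg).1, ?_⟩
              rw [(hrefl β hβ hneg).2]
              lia
            · intro δ hδ _
              rw [Finset.mem_filter] at hδ
              lia
    rw [Finset.sum_neg_distrib] at himg
    lia
  have h4 : D.rho (D.coh γ) = ((∑ β ∈ D.pos, k β : ℤ) : ℂ) * γ (D.coh γ) * (1 / 4 : ℂ) := by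
    simp only [rho, LinearMap.smul_apply, LinearMap.sum_apply, smul_eq_mul, Int.cast_sum,
      Finset.sum_mul, Finset.mul_sum]
    refine Finset.sum_congr rfl fun β hβ ↦ ?_
    linear_combination (1 / 4 : ℂ) * (hk β hβ).1
  rw [h4]
  have h5 : (0 : ℂ) ≤ 1 / 4 := by
    rw [Complex.le_def]; norm_num
  exact mul_nonneg (mul_nonneg (by exact_mod_cast hsum) hn.le) h5

end SplitData

namespace SplitData

/-! ### Casimir eigenvalues -/

variable {K : Type*} [LieRing K] [LieAlgebra ℂ K] [FiniteDimensional ℂ K] {T : LieSubalgebra ℂ K}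
  [IsLieAbelian T] (D : SplitData T)

lemma form_eq_zero {a a' : Dual ℂ T} {x y : K} (hx : IsWtVec a x) (hy : IsWtVec a' y)
    (h : a + a' ≠ 0) : D.form x y = 0 := by
  by_contra h0
  refine h (LinearMap.ext fun t ↦ ?_)
  have h1 : D.form ⁅(t : K), x⁆ y = -D.form x ⁅(t : K), y⁆ := by
    rw [← lie_skew, map_neg, LinearMap.neg_apply, D.form_lie]
  rw [hx t, hy t, map_smul, map_smul, LinearMap.smul_apply, smul_eq_mul, smul_eq_mul] at h1
  have h2 : (a t + a' t) * D.form x y = 0 := by linear_combination h1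
  exact (mul_eq_zero.mp h2).resolve_right h0

lemma add_ne_zero_of_mem {β γ : Dual ℂ T} (hβ : β ∈ D.pos) (hγ : γ ∈ D.pos) : β + γ ≠ 0 := by
  intro h
  have := add_pos (D.ht_pos β hβ) (D.ht_pos γ hγ)
  rw [← LinearMap.add_apply, h] at this
  exact lt_irrefl _ this

/-- A basis of `K` consisting of a basis of `T` and the root vectors. -/
noncomputable def family : Fin (finrank ℂ T) ⊕ (D.pos ⊕ D.pos) → K
  | .inl i => (finBasis ℂ T i : T)
  | .inr (.inl β) => D.e β
  | .inr (.inr β) => D.f β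

/-- The family dual to `SplitData.family`. -/
noncomputable def dualFamily : Fin (finrank ℂ T) ⊕ (D.pos ⊕ D.pos) → K
  | .inl i => (D.toDual.symm ((finBasis ℂ T).coord i) : T)
  | .inr (.inl β) => D.f β
  | .inr (.inr β) => D.e β

open scoped Classical in
lemma form_family (j k : Fin (finrank ℂ T) ⊕ (D.pos ⊕ D.pos)) :
    D.form (D.family j) (D.dualFamily k) = if j = k then 1 else 0 := by
  rcases j with i | ⟨β, hβ⟩ | ⟨β, hβ⟩ <;> rcases k with j | ⟨γ, hγ⟩ | ⟨γ, hγ⟩ <;>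
    simp only [family, dualFamily, reduceCtorEq, if_false, Sum.inl.injEq, Sum.inr.injEq,
      Subtype.mk.injEq]
  · rw [D.form_symm, ← D.toDual_apply, LinearEquiv.apply_symm_apply, Basis.coord_apply,
      Basis.repr_self, Finsupp.single_apply]
  · exact D.form_eq_zero (isWtVec_coe _) (D.isWtVec_f γ hγ) (by simpa using D.ne_zero_of_mem hγ)
  · exact D.form_eq_zero (isWtVec_coe _) (D.isWtVec_e γ hγ) (by simpa using D.ne_zero_of_mem hγ)
  · exact D.form_eq_zero (D.isWtVec_e β hβ) (isWtVec_coe _) (by simpa using D.ne_zero_of_mem hβ)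
  · split_ifs with h
    · rw [h, D.form_e_f γ hγ]
    · exact D.form_eq_zero (D.isWtVec_e β hβ) (D.isWtVec_f γ hγ)
        (by rwa [← sub_eq_add_neg, sub_ne_zero])
  · exact D.form_eq_zero (D.isWtVec_e β hβ) (D.isWtVec_e γ hγ) (D.add_ne_zero_of_mem hβ hγ)
  · exact D.form_eq_zero (D.isWtVec_f β hβ) (isWtVec_coe _) (by simpa using D.ne_zero_of_mem hβ)
  · refine D.form_eq_zero (D.isWtVec_f β hβ) (D.isWtVec_f γ hγ) fun h ↦
      D.add_ne_zero_of_mem hβ hγ ?_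
    rw [← neg_eq_zero, neg_add, h]
  · split_ifs with h
    · rw [h, D.form_symm, D.form_e_f γ hγ]
    · refine D.form_eq_zero (D.isWtVec_f β hβ) (D.isWtVec_e γ hγ) fun h' ↦ h ?_
      rw [neg_add_eq_zero] at h'
      exact h'

open scoped Classical in
lemma exists_isDualBasis :
    ∃ c : Basis (Fin (finrank ℂ T) ⊕ (D.pos ⊕ D.pos)) ℂ K, ⇑c = D.family ∧
      IsDualBasis D.form c D.dualFamily := by
  have hli : LinearIndependent ℂ D.family := by
    rw [Fintype.linearIndependent_iff]
    intro g hg i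
    have := congrArg (fun x ↦ D.form x (D.dualFamily i)) hg
    simpa only [map_sum, map_smul, LinearMap.sum_apply, LinearMap.smul_apply, form_family,
      smul_eq_mul, mul_ite, mul_one, mul_zero, Finset.sum_ite_eq', Finset.mem_univ, if_true,
      map_zero, LinearMap.zero_apply] using this
  have hsp : ⊤ ≤ Submodule.span ℂ (Set.range D.family) := by
    intro x _
    refine D.mem_of_forall (fun t ↦ ?_) (fun β hβ ↦ ?_) (fun β hβ ↦ ?_) x
    · have h1 : (t : K) = ∑ i, (finBasis ℂ T).repr t i • D.family (.inl i) := by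
        have := congrArg T.toSubmodule.subtype ((finBasis ℂ T).sum_repr t).symm
        rw [map_sum] at this
        simp only [map_smul] at this
        exact this
      rw [h1]
      exact Submodule.sum_mem _ fun i _ ↦ Submodule.smul_mem _ _ (Submodule.subset_span ⟨_, rfl⟩)
    · exact Submodule.subset_span ⟨.inr (.inl ⟨β, hβ⟩), rfl⟩
    · exact Submodule.subset_span ⟨.inr (.inr ⟨β, hβ⟩), rfl⟩
  refine ⟨Basis.mk hli hsp, by simp, fun j k ↦ ?_⟩
  rw [Basis.mk_apply, D.form_family]

variable {W : Type*} [AddCommGroup W] [Module ℂ W] [LieRingModule K W] [LieModule ℂ K W]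
  {κ : Type*} [Fintype κ] [DecidableEq κ] {b : Basis κ ℂ K} {b' : κ → K}

/-- The Casimir action on a weight vector. -/
lemma casimirAct_of_isWtVec (hb : IsDualBasis D.form b b') {lam : Dual ℂ T} {w : W}
    (hw : IsWtVec lam w) : casimirAct b b' w =
      D.ip lam lam • w + ∑ β ∈ D.pos, (⁅D.e β, ⁅D.f β, w⁆⁆ + ⁅D.f β, ⁅D.e β, w⁆⁆) := by
  classical
  obtain ⟨c, hc, hcd⟩ := D.exists_isDualBasis
  have h1 : casimirAct b b' w = ∑ k, ⁅D.family k, ⁅D.dualFamily k, w⁆⁆ := by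
    have := hb.sum_eq hcd (lieLie w)
    simp only [lieLie_apply, hc] at this
    exact this
  rw [h1, Fintype.sum_sum_type, Fintype.sum_sum_type]
  congr 1
  · simp only [family, dualFamily, hw _, lie_smul, smul_smul, ← Finset.sum_smul]
    congr 1
    rw [ip]
    have h2 : lam = ∑ i, lam (finBasis ℂ T i) • (finBasis ℂ T).coord i := by
      refine (finBasis ℂ T).ext fun j ↦ ?_
      simp
    conv_rhs => enter [2, 2]; rw [h2]
    simp only [map_sum, map_smul, smul_eq_mul]
    exact Finset.sum_congr rfl fun i _ ↦ mul_comm _ _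
  · rw [← Finset.sum_add_distrib]
    exact Finset.sum_coe_sort D.pos fun β ↦ ⁅D.e β, ⁅D.f β, w⁆⁆ + ⁅D.f β, ⁅D.e β, w⁆⁆

lemma two_smul_rho : (2 : ℂ) • D.rho = ∑ β ∈ D.pos, β := by
  rw [rho, smul_smul]
  norm_num

variable {D} in
/-- The Casimir action on a primitive vector. -/
lemma IsPrim.casimirAct (hb : IsDualBasis D.form b b') {lam : Dual ℂ T} {w : W}
    (hw : D.IsPrim lam w) : casimirAct b b' w = D.ip lam (lam + (2 : ℂ) • D.rho) • w := by
  rw [D.casimirAct_of_isWtVec hb hw.isWtVec, ip_add_right, add_smul, two_smul_rho, ip_sum_right,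
    Finset.sum_smul]
  congr 1
  refine Finset.sum_congr rfl fun β hβ ↦ ?_
  rw [hw.lie_e β hβ, lie_zero, add_zero, leibniz_lie, hw.lie_e β hβ, lie_zero, add_zero,
    D.lie_e_f β hβ, hw.isWtVec, D.ip_pos hβ]

lemma op_rho : D.op.rho = -D.rho := by
  classical
  rw [rho, rho, ← smul_neg, ← Finset.sum_neg_distrib]
  congr 1
  exact Finset.sum_image fun a _ b _ h ↦ neg_injective h

variable {D} in
/-- The Casimir action on a lowest weight vector. -/
lemma IsPrim.casimirAct_op (hb : IsDualBasis D.form b b') {lam : Dual ℂ T} {w : W}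
    (hw : D.op.IsPrim lam w) :
    TwistedCasimir.casimirAct b b' w = D.ip lam (lam - (2 : ℂ) • D.rho) • w := by
  have h := hw.casimirAct (D := D.op) (b := b) (b' := b') hb
  rw [op_rho, smul_neg, ← sub_eq_add_neg] at h
  exact h

/-- On an irreducible module, the Casimir element acts by the scalar by which it acts on a
nonzero vector. -/
lemma casimirAct_eq_smul [LieModule.IsIrreducible ℂ K W] (hb : IsDualBasis D.form b b') {c : ℂ}
    {w : W} (hw0 : w ≠ 0) (hw : casimirAct b b' w = c • w) (v : W) : casimirAct b b' v = c • v := by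
  let N : LieSubmodule ℂ K W :=
    { carrier := {v | casimirAct b b' v = c • v}
      add_mem' := fun {x y} (hx : _ = _) (hy : _ = _) ↦ by
        change _ = _
        rw [casimirAct_add, hx, hy, smul_add]
      zero_mem' := by simp [casimirAct]
      smul_mem' := fun a x (hx : _ = _) ↦ by
        change _ = _
        rw [casimirAct_smul, hx, smul_comm]
      lie_mem := fun {x v} (hv : _ = _) ↦ by
        change _ = _
        rw [← hb.lie_casimirAct D.form_lie, hv, lie_smul] }
  have hN : N = ⊤ := (IsSimpleOrder.eq_bot_or_eq_top N).resolve_left fun h ↦ hw0 <| by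
    have : w ∈ N := hw
    simpa [h] using this
  exact (hN ▸ LieSubmodule.mem_top v : v ∈ N)

/-- Induction on weights, from above. -/
lemma isWt_induction [FiniteDimensional ℂ W] {p : Dual ℂ T → Prop}
    (h : ∀ ν, IsWt T W ν → (∀ ν', IsWt T W ν' → 0 < (ν' - ν) D.ht → p ν') → p ν)
    {ν : Dual ℂ T} (hν : IsWt T W ν) : p ν := by
  have : Finite {ν // IsWt T W ν} := finite_isWt T W
  let r : {ν // IsWt T W ν} → {ν // IsWt T W ν} → Prop := fun a a' ↦ 0 < (a.1 - a'.1) D.ht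
  have hirr : Std.Irrefl r := ⟨fun a ha ↦ by simp [r] at ha⟩
  have htr : IsTrans _ r := ⟨fun a b c hab hbc ↦ by
    have := add_pos hab hbc
    simpa [r] using this⟩
  have hwf : WellFounded r := Finite.wellFounded_of_trans_of_irrefl r
  exact hwf.induction (C := fun a ↦ p a.1) ⟨ν, hν⟩ fun a ih ↦
    h a.1 a.2 fun ν' hν' hlt ↦ ih ⟨ν', hν'⟩ hlt

variable (W) in
/-- A nonzero finite-dimensional module has a primitive vector. -/
lemma exists_isPrim [FiniteDimensional ℂ W] [Nontrivial W] :
    ∃ (lam : Dual ℂ T) (w : W), D.IsPrim lam w := by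
  obtain ⟨ν, hν⟩ := exists_isWt T W
  refine D.isWt_induction (W := W) (p := fun _ ↦ ∃ (lam : Dual ℂ T) (w : W), D.IsPrim lam w)
    (fun ν hν ih ↦ ?_) hν
  obtain ⟨w, hw0, hw⟩ := hν
  by_cases h : ∀ β ∈ D.pos, ⁅D.e β, w⁆ = 0
  · exact ⟨ν, w, hw0, hw, h⟩
  · push Not at h
    obtain ⟨β, hβ, h⟩ := h
    exact ih (β + ν) ⟨_, h, (D.isWtVec_e β hβ).lie hw⟩ (by simpa using D.ht_pos β hβ)

/-- If the Casimir element acts on a module by the scalar `c`, then `⟨ν, ν + 2ρ⟩ ≤ c` for every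
weight `ν`: adding to `ν` a suitable multiple of a root increases the left side, until a primitive
vector is reached. -/
lemma ip_le_casimir [FiniteDimensional ℂ W] (hb : IsDualBasis D.form b b') {c : ℂ}
    (hc : ∀ w : W, casimirAct b b' w = c • w) {ν : Dual ℂ T} (hν : IsWt T W ν) :
    D.ip ν (ν + (2 : ℂ) • D.rho) ≤ c := by
  refine D.isWt_induction (W := W) (p := fun ν ↦ D.ip ν (ν + (2 : ℂ) • D.rho) ≤ c)
    (fun ν hν ih ↦ ?_) hν
  obtain ⟨w, hw0, hw⟩ := hν
  by_cases h : ∀ β ∈ D.pos, ⁅D.e β, w⁆ = 0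
  · have hp : D.IsPrim ν w := ⟨hw0, hw, h⟩
    have := (hc w).symm.trans (hp.casimirAct hb)
    exact (smul_left_injective ℂ hw0 this).ge
  push Not at h
  obtain ⟨β, hβ, h⟩ := h
  have hn := D.norm_pos β hβ
  have hρ := D.dominant_rho β hβ
  obtain ⟨k, hk, hrefl⟩ := D.exists_reflection hβ ⟨w, hw0, hw⟩
  -- it suffices to find a weight `ν + qβ` with `q > 0` and `q + k ≥ 0`
  suffices h : ∃ q : ℕ, 0 < q ∧ 0 ≤ q + k ∧ IsWt T W (ν + (q : ℂ) • β) by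
    obtain ⟨q, hq, hqk, hwt⟩ := h
    have hq' : (0 : ℂ) < q := by exact_mod_cast hq
    have hqk' : (0 : ℂ) ≤ q + k := by exact_mod_cast hqk
    refine le_trans ?_ (ih _ hwt ?_)
    · rw [← sub_nonneg]
      have h1 : D.ip (ν + (q : ℂ) • β) (ν + (q : ℂ) • β + (2 : ℂ) • D.rho) -
          D.ip ν (ν + (2 : ℂ) • D.rho) =
          q * ((q + k) * β (D.coh β)) + 2 * q * D.rho (D.coh β) := by
        have h2 : D.ip β β = β (D.coh β) := D.ip_pos hβ β
        have h3 : D.ip ν β = ν (D.coh β) := D.ip_pos hβ ν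
        have h4 : D.ip D.rho β = D.rho (D.coh β) := D.ip_pos hβ D.rho
        simp only [ip_add_left, ip_add_right, ip_smul_left, ip_smul_right]
        rw [D.ip_symm β ν, D.ip_symm β D.rho, h2, h3, h4]
        linear_combination (q : ℂ) * hk
      rw [h1]
      exact add_nonneg (mul_nonneg hq'.le (mul_nonneg hqk' hn.le))
        (mul_nonneg (mul_nonneg zero_le_two hq'.le) hρ)
    · simpa using mul_pos hq' (D.ht_pos β hβ)
  by_cases hk0 : 0 ≤ k
  · refine ⟨1, one_pos, by push_cast; lia, ⁅D.e β, w⁆, h, ?_⟩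
    convert! (D.isWtVec_e β hβ).lie hw using 1
    rw [Nat.cast_one, one_smul, add_comm]
  · refine ⟨(-k).toNat, by lia, by lia, ?_⟩
    convert! hrefl using 1
    have : (((-k).toNat : ℤ) : ℂ) = ((-k : ℤ) : ℂ) := by
      rw [Int.toNat_of_nonneg (by lia)]
    rw [Int.cast_natCast] at this
    rw [this, Int.cast_smul_eq_zsmul, neg_smul, sub_eq_add_neg]

end SplitData

namespace SplitData

/-! ### Bounds for the eigenvalues on a tensor product -/

variable {K : Type*} [LieRing K] [LieAlgebra ℂ K] [FiniteDimensional ℂ K] {T : LieSubalgebra ℂ K}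
  [IsLieAbelian T] (D : SplitData T)
  {κ : Type*} [Fintype κ] [DecidableEq κ] {b : Basis κ ℂ K} {b' : κ → K}
  {S V : Type*} [AddCommGroup S] [Module ℂ S] [LieRingModule K S] [LieModule ℂ K S]
  [AddCommGroup V] [Module ℂ V] [LieRingModule K V] [LieModule ℂ K V]

variable {D} in
/-- The tensor product of irreducible modules is generated by the tensor product of a lowest and a
highest weight vector. -/
lemma eq_top_of_tmul_mem [LieModule.IsIrreducible ℂ K S] [LieModule.IsIrreducible ℂ K V]
    {β μ : Dual ℂ T} {s : S} {v : V} (hs : D.op.IsPrim β s) (hv : D.IsPrim μ v)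
    (R : LieSubmodule ℂ K (S ⊗[ℂ] V)) (hR : s ⊗ₜ v ∈ R) : R = ⊤ := by
  have h1 (s' : S) : s' ⊗ₜ v ∈ R := by
    let X : Submodule ℂ S := R.toSubmodule.comap ((TensorProduct.mk ℂ S V).flip v)
    have hX : X = ⊤ := by
      refine hs.eq_top (X := X) hR fun γ hγ w hw ↦ ?_
      simp only [op, Finset.mem_image] at hγ
      obtain ⟨γ, hγ, rfl⟩ := hγ
      have h2 : ⁅D.e γ, w ⊗ₜ[ℂ] v⁆ ∈ R := R.lie_mem hw
      rw [TensorProduct.LieModule.lie_tmul_right, hv.lie_e γ hγ, TensorProduct.tmul_zero,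
        add_zero] at h2
      simpa [op] using! h2
    exact (hX ▸ Submodule.mem_top : s' ∈ X)
  have h2 (v' : V) : ∀ s' : S, s' ⊗ₜ v' ∈ R := by
    let Y : Submodule ℂ V :=
      { carrier := {v' | ∀ s' : S, s' ⊗ₜ v' ∈ R}
        add_mem' := fun {x y} hx hy s' ↦ by
          rw [TensorProduct.tmul_add]; exact R.add_mem (hx s') (hy s')
        zero_mem' := fun s' ↦ by simp
        smul_mem' := fun c x hx s' ↦ by
          rw [TensorProduct.tmul_smul]; exact R.smul_mem c (hx s') }
    have hY : Y = ⊤ := by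
      refine hv.eq_top (X := Y) h1 fun γ hγ w hw s' ↦ ?_
      have h3 : ⁅D.f γ, s' ⊗ₜ[ℂ] w⁆ ∈ R := R.lie_mem (hw s')
      rw [TensorProduct.LieModule.lie_tmul_right] at h3
      exact (R.add_mem_iff_right (hw _)).mp h3
    exact (hY ▸ Submodule.mem_top : v' ∈ Y)
  rw [eq_top_iff]
  rintro z -
  induction z with
  | zero => simp
  | add x y hx hy => exact add_mem hx hy
  | tmul s' v' => exact h2 v' s'

variable {D} in
lemma IsPrim.sub_mem_closure_tensor [LieModule.IsIrreducible ℂ K S]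
    [LieModule.IsIrreducible ℂ K V] [FiniteDimensional ℂ S] [FiniteDimensional ℂ V]
    {α μ ν : Dual ℂ T} {s : S} {v : V} (hs : D.IsPrim α s) (hv : D.IsPrim μ v)
    (hν : IsWt T (S ⊗[ℂ] V) ν) :
    α + μ - ν ∈ AddSubmonoid.closure (D.pos : Set (Dual ℂ T)) := by
  refine hν.mem_of_span_eq_top
    (X := {ν | α + μ - ν ∈ AddSubmonoid.closure (D.pos : Set (Dual ℂ T))}) ?_
  rw [eq_top_iff]
  rintro z -
  set Z := Submodule.span ℂ {w : S ⊗[ℂ] V |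
    ∃ χ ∈ {ν | α + μ - ν ∈ AddSubmonoid.closure (D.pos : Set (Dual ℂ T))}, IsWtVec χ w} with hZ
  induction z with
  | zero => simp
  | add x y hx hy => exact add_mem hx hy
  | tmul s' v' =>
    have hs' : s' ∈ Submodule.span ℂ _ := hs.span_eq_top ▸ Submodule.mem_top
    have hv' : v' ∈ Submodule.span ℂ _ := hv.span_eq_top ▸ Submodule.mem_top
    induction hs' using Submodule.span_induction with
    | zero => simp
    | add x y _ _ hx hy => rw [TensorProduct.add_tmul]; exact add_mem hx hy
    | smul c x _ hx => rw [← TensorProduct.smul_tmul']; exact Submodule.smul_mem _ c hx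
    | mem x hx =>
      induction hv' using Submodule.span_induction with
      | zero => simp
      | add x y _ _ hx hy => rw [TensorProduct.tmul_add]; exact add_mem hx hy
      | smul c x _ hx => rw [TensorProduct.tmul_smul]; exact Submodule.smul_mem _ c hx
      | mem y hy =>
        obtain ⟨χ, hχ, hx⟩ := hx
        obtain ⟨χ', hχ', hy⟩ := hy
        refine Submodule.subset_span ⟨χ + χ', ?_, hx.tmul hy⟩
        have : α + μ - (χ + χ') = (α - χ) + (μ - χ') := by abel
        change α + μ - (χ + χ') ∈ AddSubmonoid.closure _
        rw [this]
        exact add_mem hχ hχ'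

variable {D} in
/-- The bounds for an irreducible first factor all of whose weights lie between `-θ` and `θ`.

The eigenvalue `e` also occurs on the quotient `Q` of `S ⊗ V` by the image of the operator minus
`e`, on which the Casimir element acts by a scalar. The upper bound follows from the fact that the
highest weight of a submodule of `Q` is at most the sum of those of `S` and `V`, the lower bound
from the fact that the sum of the lowest weight of `S` and the highest weight of `V` is a weight
of `Q`. -/
theorem IsPrim.bounds_of_irreducible [LieModule.IsIrreducible ℂ K S] [LieModule.IsIrreducible ℂ K V]
    [FiniteDimensional ℂ S] [FiniteDimensional ℂ V] (hb : IsDualBasis D.form b b')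
    {θ μ : Dual ℂ T} {v : V} (hv : D.IsPrim μ v)
    (hθ : ∀ β, IsWt T S β → ∀ ν, D.Dominant ν → 0 ≤ D.ip ν (θ - β) ∧ 0 ≤ D.ip ν (θ + β))
    {e : ℂ} (he : (casimirOperator b b' S V).HasEigenvalue e) :
    -D.ip (μ + (2 : ℂ) • D.rho) θ ≤ e ∧ e ≤ D.ip μ θ := by
  have hSnt : Nontrivial S := LieModule.nontrivial_of_isIrreducible ℂ K S
  obtain ⟨α, s, hs⟩ := D.exists_isPrim S
  obtain ⟨β, t, ht⟩ := D.op.exists_isPrim S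
  set cS := D.ip α (α + (2 : ℂ) • D.rho) with hcS
  set cV := D.ip μ (μ + (2 : ℂ) • D.rho) with hcV
  have hS := D.casimirAct_eq_smul hb hs.ne_zero (hs.casimirAct hb)
  have hV := D.casimirAct_eq_smul hb hv.ne_zero (hv.casimirAct hb)
  have hcS' : cS = D.ip β (β - (2 : ℂ) • D.rho) :=
    smul_left_injective ℂ ht.ne_zero ((hS t).symm.trans (ht.casimirAct_op hb))
  let F : S ⊗[ℂ] V →ₗ⁅ℂ, K⁆ S ⊗[ℂ] V :=
    { casimirOperator b b' S V - e • LinearMap.id with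
      map_lie' := fun {x z} ↦ by
        change casimirOperator b b' S V ⁅x, z⁆ - e • ⁅x, z⁆ =
          ⁅x, casimirOperator b b' S V z - e • z⁆
        rw [lie_sub, lie_smul, hb.lie_casimirOperator D.form_lie] }
  have hF (z : S ⊗[ℂ] V) : F z = casimirOperator b b' S V z - e • z := rfl
  have hR : F.range ≠ ⊤ := by
    intro h
    have hsurj : Function.Surjective (F : S ⊗[ℂ] V →ₗ[ℂ] S ⊗[ℂ] V) :=
      fun z ↦ (LieModuleHom.mem_range F z).mp (h ▸ LieSubmodule.mem_top z)
    have hinj := LinearMap.injective_iff_surjective.mpr hsurj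
    obtain ⟨z, hz⟩ := he.exists_hasEigenvector
    refine hz.2 (hinj ?_)
    rw [map_zero]
    change F z = 0
    rw [hF, hz.apply_eq_smul, sub_self]
  let Q := (S ⊗[ℂ] V) ⧸ F.range
  let π : S ⊗[ℂ] V →ₗ⁅ℂ, K⁆ Q := LieSubmodule.Quotient.mk' F.range
  have hπ : Function.Surjective π := LieSubmodule.Quotient.surjective_mk' F.range
  have hfin : FiniteDimensional ℂ Q := Module.Finite.of_surjective (π : S ⊗[ℂ] V →ₗ[ℂ] Q) hπ
  have hlow : π (t ⊗ₜ v) ≠ 0 := fun h ↦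
    hR (eq_top_of_tmul_mem ht hv _ ((LieSubmodule.Quotient.mk_eq_zero (N := F.range)).mp h))
  have hnt : Nontrivial Q := ⟨_, _, hlow⟩
  have hQ (q : Q) : TwistedCasimir.casimirAct b b' q = (2 * e + (cS + cV)) • q := by
    obtain ⟨z, rfl⟩ := hπ q
    have h0 : π (F z) = 0 := 
      (LieSubmodule.Quotient.mk_eq_zero (N := F.range)).mpr ((LieModuleHom.mem_range F _).mpr ⟨z, rfl⟩)
    rw [hF, map_sub, map_smul, sub_eq_zero] at h0
    rw [← map_casimirAct, hb.casimirAct_tensor D.form_symm hS hV, map_add, map_smul, map_smul, h0,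
      smul_smul, ← add_smul]
  have hhalf : (0 : ℂ) ≤ 1 / 2 := by
    rw [Complex.le_def]; norm_num
  constructor
  · have hwt : IsWt T Q (β + μ) := ⟨_, hlow, (ht.isWtVec.tmul hv.isWtVec).map π⟩
    have h1 := D.ip_le_casimir hb hQ hwt
    have h2 := (hθ β ⟨t, ht.ne_zero, ht.isWtVec⟩ μ hv.dominant).2
    have h3 := (hθ β ⟨t, ht.ne_zero, ht.isWtVec⟩ D.rho D.dominant_rho).2
    rw [← sub_nonneg] at h1 ⊢
    have h4 : e - -D.ip (μ + (2 : ℂ) • D.rho) θ = 1 / 2 *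
        ((2 * e + (cS + cV) - D.ip (β + μ) (β + μ + (2 : ℂ) • D.rho)) +
          (2 * D.ip μ (θ + β) + 4 * D.ip D.rho (θ + β))) := by
      rw [hcS', hcV]
      simp only [ip_add_left, ip_add_right, ip_sub_right, ip_smul_left, ip_smul_right]
      rw [D.ip_symm β μ, D.ip_symm D.rho β]
      ring
    rw [h4]
    exact mul_nonneg hhalf (add_nonneg h1 (add_nonneg (mul_nonneg zero_le_two h2)
      (mul_nonneg zero_le_four h3)))
  · obtain ⟨lam, q, hq⟩ := D.exists_isPrim Q
    have hlam : IsWt T (S ⊗[ℂ] V) lam := IsWt.of_surjective ⟨q, hq.ne_zero, hq.isWtVec⟩ π hπ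
    have hδ := hs.sub_mem_closure_tensor hv hlam
    have hc : 2 * e + (cS + cV) = D.ip lam (lam + (2 : ℂ) • D.rho) :=
      smul_left_injective ℂ hq.ne_zero ((hQ q).symm.trans (hq.casimirAct hb))
    have h1 := hs.dominant.ip_nonneg hδ
    have h2 := hv.dominant.ip_nonneg hδ
    have h3 := hq.dominant.ip_nonneg hδ
    have h4 := D.dominant_rho.ip_nonneg hδ
    have h5 := (hθ α ⟨s, hs.ne_zero, hs.isWtVec⟩ μ hv.dominant).1
    rw [← sub_nonneg]
    have h6 : D.ip μ θ - e = 1 / 2 * (2 * D.ip μ (θ - α) + (D.ip α (α + μ - lam) +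
        D.ip μ (α + μ - lam) + D.ip lam (α + μ - lam) + 2 * D.ip D.rho (α + μ - lam))) := by
      have h7 : e = (D.ip lam (lam + (2 : ℂ) • D.rho) - (cS + cV)) / 2 := by
        rw [← hc]; ring
      rw [h7, hcS, hcV]
      simp only [ip_add_right, ip_sub_right, ip_smul_right]
      rw [D.ip_symm lam α, D.ip_symm lam μ, D.ip_symm α μ, D.ip_symm D.rho α, D.ip_symm D.rho μ,
        D.ip_symm D.rho lam]
      ring
    rw [h6]
    exact mul_nonneg hhalf (add_nonneg (mul_nonneg zero_le_two h5) (add_nonneg (add_nonneg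
      (add_nonneg h1 h2) h3) (mul_nonneg zero_le_two h4)))

end SplitData

section Devissage

variable {K : Type*} [LieRing K] [LieAlgebra ℂ K] {κ : Type*} [Fintype κ] (b b' : κ → K)
  {M N P V : Type*} [AddCommGroup M] [Module ℂ M] [LieRingModule K M] [LieModule ℂ K M]
  [AddCommGroup N] [Module ℂ N] [LieRingModule K N] [LieModule ℂ K N]
  [AddCommGroup P] [Module ℂ P] [LieRingModule K P] [LieModule ℂ K P]
  [AddCommGroup V] [Module ℂ V] [LieRingModule K V] [LieModule ℂ K V]

lemma rTensor_casimirOperator (f : M →ₗ⁅ℂ, K⁆ P) (z : M ⊗[ℂ] V) :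
    (f : M →ₗ[ℂ] P).rTensor V (casimirOperator b b' M V z) =
      casimirOperator b b' P V ((f : M →ₗ[ℂ] P).rTensor V z) := by
  induction z with
  | zero => simp
  | add x y hx hy => simp only [map_add, hx, hy]
  | tmul m v => simp [casimirOperator_tmul]

/-- In a short exact sequence, an eigenvalue for the middle term is one for an outer term. -/
lemma hasEigenvalue_casimirOperator_of_exact [FiniteDimensional ℂ M] [FiniteDimensional ℂ N]
    [FiniteDimensional ℂ P] [FiniteDimensional ℂ V]
    (i : N →ₗ⁅ℂ, K⁆ M) (p : M →ₗ⁅ℂ, K⁆ P) (hi : Function.Injective i)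
    (hp : Function.Surjective p) (hip : Function.Exact i p) {e : ℂ}
    (he : (casimirOperator b b' M V).HasEigenvalue e) :
    (casimirOperator b b' N V).HasEigenvalue e ∨ (casimirOperator b b' P V).HasEigenvalue e := by
  obtain ⟨z, hz⟩ := he.exists_hasEigenvector
  by_cases h : (p : M →ₗ[ℂ] P).rTensor V z = 0
  · left
    have hex := rTensor_exact V (f := (i : N →ₗ[ℂ] M)) (g := (p : M →ₗ[ℂ] P)) hip hp
    obtain ⟨y, hy⟩ := (hex z).mp h
    have hinj : Function.Injective ((i : N →ₗ[ℂ] M).rTensor V) :=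
      Module.Flat.rTensor_preserves_injective_linearMap _ hi
    refine Module.End.hasEigenvalue_of_hasEigenvector (x := y)
      ⟨Module.End.mem_eigenspace_iff.mpr (hinj ?_), fun h0 ↦ hz.2 ?_⟩
    · rw [rTensor_casimirOperator, hy, hz.apply_eq_smul, map_smul, hy]
    · rw [← hy, h0, map_zero]
  · right
    refine Module.End.hasEigenvalue_of_hasEigenvector (x := (p : M →ₗ[ℂ] P).rTensor V z)
      ⟨Module.End.mem_eigenspace_iff.mpr ?_, h⟩
    rw [← rTensor_casimirOperator, hz.apply_eq_smul, map_smul]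

end Devissage

namespace SplitData

variable {K : Type*} [LieRing K] [LieAlgebra ℂ K] [FiniteDimensional ℂ K] {T : LieSubalgebra ℂ K}
  [IsLieAbelian T] {D : SplitData T}
  {κ : Type*} [Fintype κ] [DecidableEq κ] {b : Basis κ ℂ K} {b' : κ → K}

/-- The bounds for an arbitrary first factor all of whose weights lie between `-θ` and `θ`. -/
theorem IsPrim.bounds {V : Type*} [AddCommGroup V] [Module ℂ V] [LieRingModule K V]
    [LieModule ℂ K V] [LieModule.IsIrreducible ℂ K V] [FiniteDimensional ℂ V]
    (hb : IsDualBasis D.form b b') {θ μ : Dual ℂ T} {v : V} (hv : D.IsPrim μ v) {e : ℂ} (n : ℕ) :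
    ∀ {M : Type*} [AddCommGroup M] [Module ℂ M] [LieRingModule K M] [LieModule ℂ K M]
    [FiniteDimensional ℂ M], finrank ℂ M = n →
    (∀ β, IsWt T M β → ∀ ν, D.Dominant ν → 0 ≤ D.ip ν (θ - β) ∧ 0 ≤ D.ip ν (θ + β)) →
    (casimirOperator b b' M V).HasEigenvalue e →
    -D.ip (μ + (2 : ℂ) • D.rho) θ ≤ e ∧ e ≤ D.ip μ θ := by
  induction n using Nat.strong_induction_on with
  | _ n ih =>
  intro M _ _ _ _ _ hn hθ he
  by_cases hirr : ∀ N : LieSubmodule ℂ K M, N ≠ ⊥ → N = ⊤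
  · have hnt : Nontrivial M := by
      by_contra h
      rw [not_nontrivial_iff_subsingleton] at h
      obtain ⟨z, hz⟩ := he.exists_hasEigenvector
      exact hz.2 (Subsingleton.elim _ _)
    have := LieModule.IsIrreducible.mk hirr
    exact hv.bounds_of_irreducible hb hθ he
  · push Not at hirr
    obtain ⟨N, hN0, hN1⟩ := hirr
    have hfin : FiniteDimensional ℂ (M ⧸ N) := Module.Finite.of_surjective
      (LieSubmodule.Quotient.mk' N : M →ₗ[ℂ] M ⧸ N) (LieSubmodule.Quotient.surjective_mk' N)
    have hN0' : N.toSubmodule ≠ ⊥ := by simpa using hN0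
    have hN1' : N.toSubmodule ≠ ⊤ := by simpa using hN1
    have h1 : finrank ℂ N < n := hn ▸ Submodule.finrank_lt hN1'
    have h2 : finrank ℂ (M ⧸ N) < n := by
      have h3 : finrank ℂ (M ⧸ N) + finrank ℂ N = finrank ℂ M :=
        Submodule.finrank_quotient_add_finrank N.toSubmodule
      have h4 : finrank ℂ N ≠ 0 := fun h0 ↦ hN0' (Submodule.finrank_eq_zero.mp h0)
      lia
    have hex : Function.Exact N.incl (LieSubmodule.Quotient.mk' N) := fun m ↦ by
      rw [LieSubmodule.Quotient.mk_eq_zero]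
      simp
    rcases hasEigenvalue_casimirOperator_of_exact b b' N.incl (LieSubmodule.Quotient.mk' N)
      Subtype.val_injective (LieSubmodule.Quotient.surjective_mk' N) hex he with h | h
    · exact ih _ h1 rfl (fun β hβ ↦ hθ β (hβ.map_injective N.incl Subtype.val_injective)) h
    · exact ih _ h2 rfl (fun β hβ ↦ hθ β (hβ.of_surjective _
        (LieSubmodule.Quotient.surjective_mk' N))) h

end SplitData

namespace SplitData

/-! ### Modules with a unique maximal weight -/

variable {K : Type*} [LieRing K] [LieAlgebra ℂ K] [FiniteDimensional ℂ K] {T : LieSubalgebra ℂ K}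
  [IsLieAbelian T] (D : SplitData T)
  {M : Type*} [AddCommGroup M] [Module ℂ M] [LieRingModule K M] [LieModule ℂ K M]
  [FiniteDimensional ℂ M]

lemma nonneg_of_two_mul_nonneg {z : ℂ} (h : 0 ≤ 2 * z) : 0 ≤ z := by
  rw [Complex.le_def] at h ⊢
  exact ⟨by simpa using h.1, (by simpa using h.2 : z.im = 0).symm⟩

/-- `θ` is a weight of `M` above which, for the order defined by the positive roots, there is no
other weight. -/
def IsMaximal (M : Type*) [AddCommGroup M] [Module ℂ M] [LieRingModule K M]
    (θ : Dual ℂ T) : Prop :=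
  IsWt T M θ ∧ ∀ ν, IsWt T M ν → ν - θ ∈ AddSubmonoid.closure (D.pos : Set (Dual ℂ T)) → ν = θ

variable {D} in
lemma IsMaximal.dominant {θ : Dual ℂ T} (hθ : D.IsMaximal M θ) : D.Dominant θ := by
  intro γ hγ
  have hn := D.norm_pos γ hγ
  obtain ⟨k, hk, hw⟩ := D.exists_reflection hγ hθ.1
  rcases le_or_gt 0 k with hk0 | hk0
  · have : (0 : ℂ) ≤ 2 * θ (D.coh γ) := by
      rw [hk]; exact mul_nonneg (by exact_mod_cast hk0) hn.le
    exact nonneg_of_two_mul_nonneg this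
  · exfalso
    obtain ⟨n, hn'⟩ := Int.eq_ofNat_of_zero_le (neg_nonneg.mpr hk0.le)
    have h1 : θ - k • γ - θ = n • γ := by
      rw [sub_sub_cancel_left, ← neg_smul, hn', natCast_zsmul]
    have h2 := hθ.2 _ hw (h1 ▸ nsmul_mem (AddSubmonoid.subset_closure hγ) n)
    rw [sub_eq_self] at h2
    rcases smul_eq_zero.mp h2 with h | h
    · exact hk0.ne h
    · exact D.ne_zero_of_mem hγ h

lemma closure_ht {q : Dual ℂ T} (hq : q ∈ AddSubmonoid.closure (D.pos : Set (Dual ℂ T))) :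
    q = 0 ∨ 0 < q D.ht := by
  induction hq using AddSubmonoid.closure_induction with
  | zero => exact .inl rfl
  | add a b _ _ ha hb =>
    rcases ha with rfl | ha
    · simpa using hb
    · rcases hb with rfl | hb
      · simpa using Or.inr ha
      · exact .inr (add_pos ha hb)
  | mem a ha => exact .inr (D.ht_pos a ha)

lemma exists_isMaximal {ν : Dual ℂ T} (hν : IsWt T M ν) :
    ∃ θ, D.IsMaximal M θ ∧ θ - ν ∈ AddSubmonoid.closure (D.pos : Set (Dual ℂ T)) := by
  refine D.isWt_induction (W := M) (p := fun ν ↦ ∃ θ, D.IsMaximal M θ ∧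
    θ - ν ∈ AddSubmonoid.closure (D.pos : Set (Dual ℂ T))) (fun ν hν ih ↦ ?_) hν
  by_cases h : ∀ ν', IsWt T M ν' → ν' - ν ∈ AddSubmonoid.closure (D.pos : Set (Dual ℂ T)) → ν' = ν
  · exact ⟨ν, ⟨hν, h⟩, by simp⟩
  · push Not at h
    obtain ⟨ν', hν', hle, hne⟩ := h
    obtain ⟨θ, hθ, hθle⟩ := ih ν' hν'
      ((D.closure_ht hle).resolve_left fun h ↦ hne (sub_eq_zero.mp h))
    refine ⟨θ, hθ, ?_⟩
    rw [← sub_add_sub_cancel θ ν' ν]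
    exact add_mem hθle hle

/-- Each element of the finite family `a` is a positive root or half of one, the family is linearly
independent (in the form that there are dual coweights), and its diagram is connected. -/
structure IsBase {J : Type*} (a : J → Dual ℂ T) : Prop where
  exists_coweight : ∀ g : J → ℂ, ∃ t : T, ∀ j, a j t = g j
  mem_pos : ∀ j, a j ∈ D.pos ∨ (2 : ℂ) • a j ∈ D.pos
  ip_nonpos : ∀ i j, i ≠ j → D.ip (a i) (a j) ≤ 0
  connected : ∀ S : Set J, S.Nonempty → Sᶜ.Nonempty → ∃ i ∈ S, ∃ j ∈ Sᶜ, D.ip (a i) (a j) ≠ 0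

variable {D} {J : Type*} [Fintype J] {a : J → Dual ℂ T}

lemma IsBase.coeff (ha : D.IsBase a) {c d : J → ℂ} (h : ∑ j, c j • a j = ∑ j, d j • a j) :
    c = d := by
  classical
  funext i
  obtain ⟨t, ht⟩ := ha.exists_coweight (Pi.single i 1)
  have := LinearMap.congr_fun h t
  simpa [ht, Pi.single_apply] using this

lemma IsBase.ip_self_pos (ha : D.IsBase a) (j : J) : 0 < D.ip (a j) (a j) := by
  rcases ha.mem_pos j with h | h
  · rw [D.ip_pos h]; exact D.norm_pos _ h
  · have := D.norm_pos _ h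
    rw [← D.ip_pos h, ip_smul_left, ip_smul_right] at this
    refine lt_of_le_of_ne (nonneg_of_two_mul_nonneg (nonneg_of_two_mul_nonneg this.le)) fun h0 ↦ ?_
    simp [← h0] at this

lemma IsBase.ip_nonneg (ha : D.IsBase a) {ν : Dual ℂ T} (hν : D.Dominant ν) (j : J) :
    0 ≤ D.ip ν (a j) := by
  rcases ha.mem_pos j with hj | hj
  · rw [D.ip_pos hj]; exact hν _ hj
  · have := hν _ hj
    rw [← D.ip_pos hj, ip_smul_right] at this
    exact nonneg_of_two_mul_nonneg this

lemma IsBase.exists_reflection (ha : D.IsBase a) {ν : Dual ℂ T} (hν : IsWt T M ν) (j : J) :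
    ∃ k : ℤ, 2 * D.ip ν (a j) = k * D.ip (a j) (a j) ∧ IsWt T M (ν - k • a j) := by
  rcases ha.mem_pos j with h | h
  · simp only [D.ip_pos h]
    exact D.exists_reflection h hν
  · obtain ⟨k, hk, hw⟩ := D.exists_reflection h hν
    refine ⟨2 * k, ?_, ?_⟩
    · rw [← D.ip_pos h, ← D.ip_pos h, ip_smul_left, ip_smul_right, ip_smul_right] at hk
      push_cast
      linear_combination hk / 2
    · convert! hw using 2
      rw [← Int.cast_smul_eq_zsmul ℂ, ← Int.cast_smul_eq_zsmul ℂ, smul_smul]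
      push_cast
      ring_nf

/-- A set of weights that is stable under the simple reflections is stable under negation: a simple
reflection lowers the height of a positive weight, unless it changes its sign. -/
lemma IsBase.neg_mem (ha : D.IsBase a) {X : Set (Dual ℂ T)}
    (hX : ∀ ν ∈ X, ∃ n : J → ℕ, ν = ∑ j, (n j : ℂ) • a j ∨ ν = -∑ j, (n j : ℂ) • a j)
    (hrefl : ∀ ν ∈ X, ∀ j, ∃ k : ℤ, 2 * D.ip ν (a j) = k * D.ip (a j) (a j) ∧ ν - k • a j ∈ X)
    (hpos : ∀ ν ∈ X, ν ≠ 0 → 0 < D.ip ν ν) (s : ℕ) :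
    ∀ n : J → ℕ, ∑ j, n j = s → ∑ j, (n j : ℂ) • a j ∈ X → -∑ j, (n j : ℂ) • a j ∈ X := by
  classical
  induction s using Nat.strong_induction_on with
  | _ s ih =>
  intro n hs hn
  set β := ∑ j, (n j : ℂ) • a j with hβ
  by_cases hβ0 : β = 0
  · rwa [hβ0, neg_zero, ← hβ0]
  have hββ := hpos β hn hβ0
  choose k hk hkX using hrefl β hn
  -- some simple root has a positive product with `β`
  obtain ⟨i, hi⟩ : ∃ i, 0 < n i ∧ 0 < k i := by
    by_contra! hcon
    refine hββ.not_ge ?_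
    conv_lhs => rw [hβ, ip_sum_right]
    refine Finset.sum_nonpos fun j _ ↦ ?_
    rw [ip_smul_right]
    rcases Nat.eq_zero_or_pos (n j) with h | h
    · simp [h]
    · refine mul_nonpos_of_nonneg_of_nonpos (by positivity) ?_
      have h1 : D.ip β (a j) = (k j / 2 : ℂ) * D.ip (a j) (a j) := by linear_combination hk j / 2
      rw [h1]
      refine mul_nonpos_of_nonpos_of_nonneg ?_ (ha.ip_self_pos j).le
      have h2 : (k j : ℂ) ≤ 0 := by exact_mod_cast hcon j h
      exact div_nonpos_of_nonpos_of_nonneg h2 (by norm_num)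
  have hai := (ha.ip_self_pos i).ne'
  have hβ' : β - k i • a i = ∑ j, ((n j : ℂ) - if j = i then (k i : ℂ) else 0) • a j := by
    simp [sub_smul, Finset.sum_sub_distrib, hβ, ite_smul, Int.cast_smul_eq_zsmul]
  obtain ⟨m, hm | hm⟩ := hX _ (hkX i)
  · have hcoef := ha.coeff (hβ'.symm.trans hm)
    have hmj (j : J) : (m j : ℤ) = n j - if j = i then k i else 0 := by
      have := congrFun hcoef j
      have h2 : (m j : ℂ) = ((n j - if j = i then k i else 0 : ℤ) : ℂ) := by
        rw [← this]; push_cast; rfl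
      exact_mod_cast h2
    have hlt : ∑ j, m j < s := by
      rw [← hs]
      refine Finset.sum_lt_sum (fun j _ ↦ ?_) ⟨i, Finset.mem_univ i, ?_⟩
      · have := hmj j
        split_ifs at this <;> lia
      · have := hmj i
        rw [if_pos rfl] at this
        lia
    have h1 := ih _ hlt m rfl (hm ▸ hkX i)
    rw [← hm] at h1
    obtain ⟨k', hk', hk'X⟩ := hrefl _ h1 i
    have : (k' : ℂ) = k i := by
      refine mul_right_cancel₀ hai ?_
      rw [← hk', show -(β - k i • a i) = (k i : ℂ) • a i - β by
        rw [neg_sub, Int.cast_smul_eq_zsmul], ip_sub_left, ip_smul_left]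
      linear_combination -hk i
    have : k' = k i := by exact_mod_cast this
    rw [this] at hk'X
    convert! hk'X using 1
    abel
  · rw [← Finset.sum_neg_distrib] at hm
    simp only [← neg_smul] at hm
    have hcoef := ha.coeff (hβ'.symm.trans hm)
    have hnj (j : J) (hj : j ≠ i) : n j = 0 := by
      have := congrFun hcoef j
      rw [if_neg hj, sub_zero] at this
      have h2 : (n j : ℤ) = -m j := by exact_mod_cast this
      lia
    have hβi : β = (n i : ℂ) • a i := by
      rw [hβ]
      exact Finset.sum_eq_single i (fun j _ hj ↦ by simp [hnj j hj]) (by simp)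
    have h2 : (k i : ℂ) = 2 * n i := by
      refine mul_right_cancel₀ hai ?_
      rw [← hk i, hβi, ip_smul_left]
      ring
    convert! hkX i using 1
    rw [← Int.cast_smul_eq_zsmul ℂ, h2, mul_smul, ← hβi, two_smul]
    abel

/-- The weights of `M` are symmetric about `0`. -/
lemma IsBase.isWt_neg (ha : D.IsBase a)
    (hM : ∀ ν, IsWt T M ν → ∃ n : J → ℕ, ν = ∑ j, (n j : ℂ) • a j ∨ ν = -∑ j, (n j : ℂ) • a j)
    (hpos : ∀ ν, IsWt T M ν → ν ≠ 0 → 0 < D.ip ν ν) {ν : Dual ℂ T} (hν : IsWt T M ν) :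
    IsWt T M (-ν) := by
  have hneg (a b : Dual ℂ T) : D.ip (-a) b = -D.ip a b := rfl
  obtain ⟨n, rfl | rfl⟩ := hM ν hν
  · exact ha.neg_mem (X := {ν | IsWt T M ν}) hM (fun ν hν j ↦ ha.exists_reflection hν j) hpos _ n
      rfl hν
  · rw [neg_neg]
    have h := ha.neg_mem (X := {ν | IsWt T M (-ν)}) (fun ν hν ↦ ?_) (fun ν hν j ↦ ?_)
      (fun ν hν hν0 ↦ ?_) _ n rfl hν
    · simpa using h
    · obtain ⟨n, h | h⟩ := hM _ hν
      · exact ⟨n, .inr (by rw [← h, neg_neg])⟩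
      · exact ⟨n, .inl (neg_injective h)⟩
    · obtain ⟨k, hk, hw⟩ := ha.exists_reflection hν j
      refine ⟨-k, ?_, ?_⟩
      · rw [hneg] at hk
        push_cast
        linear_combination -hk
      · change IsWt T M (-(ν - -k • a j))
        convert! hw using 1
        rw [neg_smul]
        abel
    · have := hpos _ hν (neg_ne_zero.mpr hν0)
      rwa [hneg, D.ip_symm, hneg, neg_neg] at this

/-- A nonzero dominant weight has a positive product with every nonzero dominant weight. -/
lemma IsBase.ip_dominant_pos (ha : D.IsBase a) {θ ν : Dual ℂ T} (hθ : D.Dominant θ)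
    (hν : D.Dominant ν) {n m : J → ℕ} (hn : θ = ∑ j, (n j : ℂ) • a j)
    (hm : ν = ∑ j, (m j : ℂ) • a j) (hθ0 : θ ≠ 0) (hνν : 0 < D.ip ν ν) : 0 < D.ip θ ν := by
  -- `θ` has full support, since the diagram is connected
  have hsupp (j : J) : n j ≠ 0 := by
    by_contra hj
    obtain ⟨i, hi, j, hj, hij⟩ := ha.connected {i | n i ≠ 0} (by
      by_contra hemp
      rw [Set.not_nonempty_iff_eq_empty, Set.eq_empty_iff_forall_notMem] at hemp
      refine hθ0 (hn.trans (Finset.sum_eq_zero fun i _ ↦ ?_))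
      have : n i = 0 := by simpa using hemp i
      simp [this]) ⟨j, by simpa using hj⟩
    have hj0 : n j = 0 := by simpa using hj
    have h1 := ha.ip_nonneg hθ j
    have hterm (l : J) : (n l : ℂ) * D.ip (a j) (a l) ≤ 0 := by
      by_cases hl : j = l
      · simp [← hl, hj0]
      · exact mul_nonpos_of_nonneg_of_nonpos (by positivity) (ha.ip_nonpos j l hl)
    rw [D.ip_symm, hn, ip_sum_right] at h1
    simp only [ip_smul_right] at h1
    have h2 := (Finset.sum_eq_zero_iff_of_nonpos fun l _ ↦ hterm l).mp
      (le_antisymm (Finset.sum_nonpos fun l _ ↦ hterm l) h1) i (Finset.mem_univ i)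
    rcases mul_eq_zero.mp h2 with h | h
    · exact hi (by exact_mod_cast h)
    · exact hij (by rw [D.ip_symm]; exact h)
  have hterm (j : J) : 0 ≤ (n j : ℂ) * D.ip ν (a j) := mul_nonneg (by positivity) (ha.ip_nonneg hν j)
  have hsum : D.ip θ ν = ∑ j, (n j : ℂ) * D.ip ν (a j) := by
    rw [D.ip_symm, hn, ip_sum_right]
    simp only [ip_smul_right]
  rw [hsum]
  refine lt_of_le_of_ne (Finset.sum_nonneg fun j _ ↦ hterm j) fun h0 ↦ hνν.ne' ?_
  have h1 := (Finset.sum_eq_zero_iff_of_nonneg fun j _ ↦ hterm j).mp h0.symm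
  conv_lhs => rw [hm, ← hm, D.ip_symm]
  conv_lhs => rw [show D.ip ν ν = D.ip ν (∑ j, (m j : ℂ) • a j) by rw [← hm], ip_sum_right]
  refine Finset.sum_eq_zero fun j _ ↦ ?_
  rw [ip_smul_right]
  rcases mul_eq_zero.mp (h1 j (Finset.mem_univ j)) with h | h
  · exact absurd (by exact_mod_cast h) (hsupp j)
  · rw [h, mul_zero]

/-- All weights of `M` lie between `-θ` and `θ`, for a maximal weight `θ`. -/
theorem IsBase.weights_le (ha : D.IsBase a)
    (hM : ∀ ν, IsWt T M ν → ∃ n : J → ℕ, ν = ∑ j, (n j : ℂ) • a j ∨ ν = -∑ j, (n j : ℂ) • a j)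
    (hpos : ∀ ν, IsWt T M ν → ν ≠ 0 → 0 < D.ip ν ν)
    (h0 : IsWt T M 0 → ∀ n : J → ℕ, IsWt T M (∑ j, (n j : ℂ) • a j) →
      ∑ j, (n j : ℂ) • a j ∈ AddSubmonoid.closure (D.pos : Set (Dual ℂ T)))
    (hsub : ∀ ν ν', IsWt T M ν → IsWt T M ν' → 0 < D.ip ν ν' → IsWt T K (ν - ν'))
    {θ : Dual ℂ T} (hθ : D.IsMaximal M θ) {β : Dual ℂ T} (hβ : IsWt T M β) :
    θ - β ∈ AddSubmonoid.closure (D.pos : Set (Dual ℂ T)) ∧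
      θ + β ∈ AddSubmonoid.closure (D.pos : Set (Dual ℂ T)) := by
  have hmax {ν : Dual ℂ T} (hν : D.IsMaximal M ν) : ∃ n : J → ℕ, ν = ∑ j, (n j : ℂ) • a j := by
    obtain ⟨n, hn | hn⟩ := hM ν hν.1
    · exact ⟨n, hn⟩
    · by_cases hν0 : ν = 0
      · exact ⟨0, by simpa using hν0⟩
      · refine absurd (hpos ν hν.1 hν0) (not_lt_of_ge ?_)
        conv_lhs => rw [show D.ip ν ν = -D.ip ν (∑ j, (n j : ℂ) • a j) by
          nth_rw 2 [hn]; rw [← neg_one_smul ℂ, ip_smul_right, neg_one_mul], ip_sum_right]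
        rw [neg_nonpos]
        refine Finset.sum_nonneg fun j _ ↦ ?_
        rw [ip_smul_right]
        exact mul_nonneg (by positivity) (ha.ip_nonneg hν.dominant j)
  have huniq {ν : Dual ℂ T} (hν : D.IsMaximal M ν) : ν = θ := by
    obtain ⟨n, hn⟩ := hmax hθ
    obtain ⟨m, hm⟩ := hmax hν
    by_cases hθ0 : θ = 0
    · refine hθ.2 ν hν.1 ?_
      rw [hθ0, sub_zero, hm]
      exact h0 (hθ0 ▸ hθ.1) m (hm ▸ hν.1)
    by_cases hν0 : ν = 0
    · refine (hν.2 θ hθ.1 ?_).symm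
      rw [hν0, sub_zero, hn]
      exact h0 (hν0 ▸ hν.1) n (hn ▸ hθ.1)
    have hip := ha.ip_dominant_pos hθ.dominant hν.dominant hn hm hθ0 (hpos ν hν.1 hν0)
    rcases D.eq_zero_or_mem_pos (hsub θ ν hθ.1 hν.1 hip) with h | h | h
    · exact (sub_eq_zero.mp h).symm
    · exact (hν.2 θ hθ.1 (AddSubmonoid.subset_closure h)).symm
    · exact hθ.2 ν hν.1 (AddSubmonoid.subset_closure (by rwa [neg_sub] at h))
  have hle {β : Dual ℂ T} (hβ : IsWt T M β) :
      θ - β ∈ AddSubmonoid.closure (D.pos : Set (Dual ℂ T)) := by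
    obtain ⟨ν, hν, h⟩ := D.exists_isMaximal hβ
    rwa [huniq hν] at h
  exact ⟨hle hβ, by simpa using hle (ha.isWt_neg hM hpos hβ)⟩

end SplitData

/-! ### Simple Lie algebras with Chevalley generators -/

section Span

variable {L : Type*} [LieRing L] [LieAlgebra ℂ L]

/-- A set that is closed under the bracket spans a subalgebra. -/
lemma lieSpan_le_span {s S : Set L} (hs : s ⊆ S) (hS : ∀ x ∈ S, ∀ y ∈ S, ⁅x, y⁆ ∈ S) {x : L}
    (hx : x ∈ LieSubalgebra.lieSpan ℂ L s) : x ∈ Submodule.span ℂ S := by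
  induction hx using LieSubalgebra.lieSpan_induction with
  | mem x hx => exact Submodule.subset_span (hs hx)
  | zero => exact zero_mem _
  | add x y _ _ hx hy => exact add_mem hx hy
  | smul c x _ hx => exact Submodule.smul_mem _ c hx
  | lie x y hxs hys hx hy =>
    clear hxs hys
    induction hx using Submodule.span_induction with
    | mem x hx =>
      induction hy using Submodule.span_induction with
      | mem y hy => exact Submodule.subset_span (hS x hx y hy)
      | zero => simp
      | add a b _ _ ha hb => rw [lie_add]; exact add_mem ha hb
      | smul c a _ ha => rw [lie_smul]; exact Submodule.smul_mem _ c ha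
    | zero => simp
    | add a b _ _ ha hb => rw [add_lie]; exact add_mem ha hb
    | smul c a _ ha => rw [smul_lie]; exact Submodule.smul_mem _ c ha

/-- If the eigenvectors of `ad x` of eigenvalue `n` and lying in `P n`, for all `n`, span, then
`P n` contains all eigenvectors of eigenvalue `n`. -/
lemma mem_of_lie_eq_smul {x : L} (P : ℂ → Submodule ℂ L)
    (h : Submodule.span ℂ {y | ∃ n : ℂ, ⁅x, y⁆ = n • y ∧ y ∈ P n} = ⊤) {n : ℂ} {y : L}
    (hy : ⁅x, y⁆ = n • y) : y ∈ P n := by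
  let E : ℂ → Submodule ℂ L := (LieModule.toEnd ℂ L L x).eigenspace
  have hmem {n : ℂ} {y : L} (hy : ⁅x, y⁆ = n • y) : y ∈ E n := Module.End.mem_eigenspace_iff.mpr hy
  have hind : iSupIndep E := Module.End.eigenspaces_iSupIndep _
  have htop : ⨆ n, E n ⊓ P n = ⊤ := by
    rw [eq_top_iff, ← h, Submodule.span_le]
    rintro y ⟨n, hy, hyP⟩
    exact Submodule.mem_iSup_of_mem n ⟨hmem hy, hyP⟩
  have := (hind.le_iff_eq_of_iSup_eq_top htop).mp fun n ↦ inf_le_left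
  have h2 := hmem hy
  rw [← this] at h2
  exact h2.2

end Span

section Chevalley

variable {ι L : Type*} [Fintype ι] [LieRing L] [LieAlgebra ℂ L] {H : LieSubalgebra ℂ L}
  (b : LieAlgebra.Basis ι H)

lemma mem_of_forall_generators {S : LieSubalgebra ℂ L} (he : ∀ i, b.e i ∈ S) (hf : ∀ i, b.f i ∈ S)
    (x : L) : x ∈ S := by
  have h : LieSubalgebra.lieSpan ℂ L (Set.range b.e ∪ Set.range b.f) ≤ S := by
    rw [LieSubalgebra.lieSpan_le]
    rintro _ (⟨i, rfl⟩ | ⟨i, rfl⟩)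
    exacts [he i, hf i]
  rw [b.span_ef] at h
  exact h (LieSubalgebra.mem_top x)

lemma span_eq_top_of_generators {S : Set L} (he : ∀ i, b.e i ∈ S) (hf : ∀ i, b.f i ∈ S)
    (hS : ∀ x ∈ S, ∀ y ∈ S, ⁅x, y⁆ ∈ S) : Submodule.span ℂ S = ⊤ := by
  rw [eq_top_iff]
  rintro x -
  refine lieSpan_le_span (s := Set.range b.e ∪ Set.range b.f) ?_ hS ?_
  · rintro _ (⟨i, rfl⟩ | ⟨i, rfl⟩)
    exacts [he i, hf i]
  · rw [b.span_ef]
    trivial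

/-- The subspaces `P n` contain the eigenvectors of `ad x` of eigenvalue `n`, if they are compatible
with the bracket and contain the generators. -/
lemma mem_of_lie_eq_smul_of_generators {x : L} (P : ℂ → Submodule ℂ L)
    (hP : ∀ n m, ∀ y ∈ P n, ∀ z ∈ P m, ⁅y, z⁆ ∈ P (n + m)) {g : ι → ℂ}
    (he : ∀ i, ⁅x, b.e i⁆ = g i • b.e i) (hf : ∀ i, ⁅x, b.f i⁆ = -g i • b.f i)
    (heP : ∀ i, b.e i ∈ P (g i)) (hfP : ∀ i, b.f i ∈ P (-g i)) {n : ℂ} {y : L}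
    (hy : ⁅x, y⁆ = n • y) : y ∈ P n := by
  refine mem_of_lie_eq_smul P (span_eq_top_of_generators b (fun i ↦ ⟨_, he i, heP i⟩)
    (fun i ↦ ⟨_, hf i, hfP i⟩) ?_) hy
  rintro u ⟨n, hu, huP⟩ v ⟨m, hv, hvP⟩
  refine ⟨n + m, ?_, hP n m u huP v hvP⟩
  rw [leibniz_lie, hu, hv, smul_lie, lie_smul, add_smul]

lemma lie_e_eq (h : H) (i : ι) : ⁅(h : L), b.e i⁆ = b.baseSupp i h • b.e i :=
  (b.baseSupp_apply_smul_e i h).symm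

lemma lie_f_eq (h : H) (i : ι) : ⁅(h : L), b.f i⁆ = -b.baseSupp i h • b.f i := by
  rw [neg_smul, b.baseSupp_apply_smul_f, neg_neg]
  rfl

lemma h_mem (i : ι) : b.h i ∈ H := (b.h' i).2

lemma mem_cartan_iff {x : L} : x ∈ H ↔ ∃ c : ι → ℂ, x = ∑ i, c i • b.h i := by
  have : x ∈ H ↔ x ∈ Submodule.span ℂ (Set.range b.h) := by
    rw [← LieSubalgebra.mem_toSubmodule, b.coe_cartan_eq_span]
  rw [this, Submodule.mem_span_range_iff_exists_fun]
  simp only [eq_comm]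

/-- There are elements of the Cartan subalgebra on which the simple roots take prescribed values. -/
lemma exists_baseSupp_eq (g : ι → ℂ) : ∃ h : H, ∀ i, b.baseSupp i h = g i := by
  classical
  let A : Matrix ι ι ℂ := b.A.map (Int.castRingHom ℂ)
  have hA : IsUnit A.det := by
    have h1 : A.det = (b.A.det : ℂ) := (RingHom.map_det (Int.castRingHom ℂ) b.A).symm
    rw [h1, isUnit_iff_ne_zero]
    exact_mod_cast b.nondegen.det_ne_zero
  let c : ι → ℂ := A⁻¹.mulVec g
  have hc : A.mulVec c = g := by
    rw [Matrix.mulVec_mulVec, Matrix.mul_nonsing_inv _ hA, Matrix.one_mulVec]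
  refine ⟨∑ j, c j • b.h' j, fun i ↦ ?_⟩
  rw [map_sum, ← congrFun hc i, Matrix.mulVec, dotProduct]
  refine Finset.sum_congr rfl fun j _ ↦ ?_
  rw [map_smul, b.baseSupp_apply_h', smul_eq_mul, mul_comm]
  rfl

variable [FiniteDimensional ℂ L]

/-- The off-diagonal entries of the Cartan matrix are nonpositive, and simple root vectors commute
where they vanish: `e j` is a lowest weight vector for the `sl₂` attached to `i`. -/
lemma cartanMatrix_nonpos {i j : ι} (hij : i ≠ j) :
    b.A i j ≤ 0 ∧ (b.A i j = 0 → ⁅b.e j, b.e i⁆ = 0) := by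
  have P : (b.sl2 j).symm.HasPrimitiveVectorWith (b.e i) (-b.A i j : ℂ) :=
    { ne_zero := (b.sl2 i).e_ne_zero
      lie_h := by rw [neg_lie, b.lie_h_e, neg_smul, Int.cast_smul_eq_zsmul]
      lie_e := by rw [← lie_skew, b.lie_e_f_ne i j hij, neg_zero] }
  obtain ⟨n, hn⟩ := P.exists_nat
  have hn' : b.A i j = -n := by
    have : (b.A i j : ℂ) = ((-n : ℤ) : ℂ) := by push_cast; linear_combination -hn
    exact_mod_cast this
  refine ⟨by lia, fun h0 ↦ ?_⟩
  have hn0 : n = 0 := by lia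
  subst hn0
  simpa using P.pow_toEnd_f_eq_zero_of_eq_nat hn

variable [LieAlgebra.IsSimple ℂ L]

lemma eq_zero_of_lie_generators {x : L} (he : ∀ i, ⁅b.e i, x⁆ = 0) (hf : ∀ i, ⁅b.f i, x⁆ = 0) :
    x = 0 := by
  have h : x ∈ LieAlgebra.center ℂ L := by
    rw [LieModule.mem_maxTrivSubmodule]
    intro y
    let S : LieSubalgebra ℂ L :=
      { carrier := {y | ⁅y, x⁆ = 0}
        add_mem' := fun {y z} (hy : _ = _) (hz : _ = _) ↦ by
          change _ = _
          rw [add_lie, hy, hz, add_zero]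
        zero_mem' := zero_lie x
        smul_mem' := fun c y (hy : _ = _) ↦ by
          change _ = _
          rw [smul_lie, hy, smul_zero]
        lie_mem' := fun {y z} (hy : _ = _) (hz : _ = _) ↦ by
          change _ = _
          rw [lie_lie, hy, hz, lie_zero, lie_zero, sub_zero] }
    exact mem_of_forall_generators b (S := S) he hf y
  rwa [LieAlgebra.center_eq_bot, LieSubmodule.mem_bot] at h

lemma cartan_ext {h h' : H} (hh : ∀ i, b.baseSupp i h = b.baseSupp i h') : h = h' := by
  rw [← sub_eq_zero, ← Subtype.val_inj]
  refine eq_zero_of_lie_generators b (fun i ↦ ?_) fun i ↦ ?_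
  · rw [← lie_skew, lie_e_eq, map_sub, hh, sub_self, zero_smul, neg_zero]
  · rw [← lie_skew, lie_f_eq, map_sub, hh, sub_self, neg_zero, zero_smul, neg_zero]

omit [LieAlgebra.IsSimple ℂ L] [FiniteDimensional ℂ L] in
lemma exists_triangular (x : L) : ∃ u ∈ H, ∃ v ∈ LieSubalgebra.lieSpan ℂ L (Set.range b.f),
    ∃ w ∈ LieSubalgebra.lieSpan ℂ L (Set.range b.e), x = u + v + w := by
  have hx : x ∈ iSup ![H.toLieSubmodule, b.borelLower, b.borelUpper] := by
    rw [b.iSup_cartan_borelLower_borelUpper_eq_top]; trivial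
  have hx' : x ∈ (H.toLieSubmodule ⊔ b.borelLower) ⊔ b.borelUpper := by simpa using hx
  rw [LieSubmodule.mem_sup] at hx'
  obtain ⟨u, hu, z, hz, rfl⟩ := hx'
  rw [LieSubmodule.mem_sup] at hu
  obtain ⟨v, hv, w, hw, rfl⟩ := hu
  exact ⟨v, hv, w, hw, z, hz, rfl⟩

/-- The principal grading: an eigenvector of `ad h₀`, where all simple roots are `1` on `h₀`, lies
in the Cartan subalgebra or in the subalgebra generated by the `e i` or by the `f i`. -/
lemma mem_of_height {h₀ : H} (h1 : ∀ i, b.baseSupp i h₀ = 1) {n : ℂ} {x : L}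
    (hx : ⁅(h₀ : L), x⁆ = n • x) :
    (n = 0 → x ∈ H) ∧ (0 < n → x ∈ LieSubalgebra.lieSpan ℂ L (Set.range b.e)) ∧
      (n < 0 → x ∈ LieSubalgebra.lieSpan ℂ L (Set.range b.f)) := by
  classical
  have := b.isLieAbelian_cartan
  let P : ℂ → Submodule ℂ L := fun n ↦ if n = 0 then H.toSubmodule else
    if 0 < n then (LieSubalgebra.lieSpan ℂ L (Set.range b.e)).toSubmodule else
      (LieSubalgebra.lieSpan ℂ L (Set.range b.f)).toSubmodule
  have hP0 : P 0 = H.toSubmodule := if_pos rfl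
  have hPpos {n : ℂ} (hn : 0 < n) :
      P n = (LieSubalgebra.lieSpan ℂ L (Set.range b.e)).toSubmodule := by
    simp only [P, if_neg hn.ne', if_pos hn]
  have hPneg {n : ℂ} (hn : n < 0) :
      P n = (LieSubalgebra.lieSpan ℂ L (Set.range b.f)).toSubmodule := by
    simp only [P, if_neg hn.ne, if_neg hn.not_gt]
  have htop : Submodule.span ℂ {y : L | ∃ n : ℂ, ⁅(h₀ : L), y⁆ = n • y ∧ y ∈ P n} = ⊤ := by
    set U := Submodule.span ℂ {y : L | ∃ n : ℂ, ⁅(h₀ : L), y⁆ = n • y ∧ y ∈ P n} with hU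
    have hH (y : L) (hy : y ∈ H) : y ∈ U := by
      refine Submodule.subset_span ⟨0, ?_, by rwa [hP0]⟩
      rw [zero_smul]
      exact congrArg Subtype.val (trivial_lie_zero H H h₀ ⟨y, hy⟩)
    have hE (y : L) (hy : y ∈ LieSubalgebra.lieSpan ℂ L (Set.range b.e)) : y ∈ U := by
      refine Submodule.span_mono ?_ (lieSpan_le_span (S := {y : L | ∃ n : ℂ, 0 < n ∧
        ⁅(h₀ : L), y⁆ = n • y ∧ y ∈ LieSubalgebra.lieSpan ℂ L (Set.range b.e)}) ?_ ?_ hy)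
      · rintro y ⟨n, hn, hy, hyE⟩
        exact ⟨n, hy, by rwa [hPpos hn]⟩
      · rintro _ ⟨i, rfl⟩
        exact ⟨1, one_pos, by rw [lie_e_eq, h1], LieSubalgebra.subset_lieSpan ⟨i, rfl⟩⟩
      · rintro u ⟨n, hn, hu, hu'⟩ v ⟨m, hm, hv, hv'⟩
        refine ⟨n + m, add_pos hn hm, ?_, LieSubalgebra.lie_mem _ hu' hv'⟩
        rw [leibniz_lie, hu, hv, smul_lie, lie_smul, add_smul]
    have hF (y : L) (hy : y ∈ LieSubalgebra.lieSpan ℂ L (Set.range b.f)) : y ∈ U := by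
      refine Submodule.span_mono ?_ (lieSpan_le_span (S := {y : L | ∃ n : ℂ, n < 0 ∧
        ⁅(h₀ : L), y⁆ = n • y ∧ y ∈ LieSubalgebra.lieSpan ℂ L (Set.range b.f)}) ?_ ?_ hy)
      · rintro y ⟨n, hn, hy, hyE⟩
        exact ⟨n, hy, by rwa [hPneg hn]⟩
      · rintro _ ⟨i, rfl⟩
        exact ⟨-1, by simp, by rw [lie_f_eq, h1], LieSubalgebra.subset_lieSpan ⟨i, rfl⟩⟩
      · rintro u ⟨n, hn, hu, hu'⟩ v ⟨m, hm, hv, hv'⟩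
        refine ⟨n + m, add_neg hn hm, ?_, LieSubalgebra.lie_mem _ hu' hv'⟩
        rw [leibniz_lie, hu, hv, smul_lie, lie_smul, add_smul]
    rw [eq_top_iff]
    rintro y -
    obtain ⟨v, hv, w, hw, z, hz, rfl⟩ := exists_triangular b y
    exact add_mem (add_mem (hH v hv) (hF w hw)) (hE z hz)
  have h := mem_of_lie_eq_smul P htop hx
  refine ⟨?_, fun hn ↦ by rwa [hPpos hn] at h, fun hn ↦ by rwa [hPneg hn] at h⟩
  rintro rfl
  rwa [hP0] at h

/-- The Dynkin diagram is connected. -/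
lemma exists_cartanMatrix_ne_zero {S : Set ι} (hS : S.Nonempty) (hS' : Sᶜ.Nonempty) :
    ∃ i ∈ S, ∃ j ∈ Sᶜ, b.A j i ≠ 0 := by
  classical
  have := b.isCartanSubalgebra
  obtain ⟨i, hi⟩ := hS
  obtain ⟨j, hj⟩ := hS'
  by_contra! h
  refine hj ?_
  have := b.base.induction_on_cartanMatrix (fun k ↦ b.baseSupportEquiv.symm k ∈ S)
    (i := b.baseSupportEquiv i) (j := b.baseSupportEquiv j) (by simpa using hi) fun k l hk hkl ↦ ?_
  · simpa using this
  · by_contra hl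
    refine hkl ?_
    rw [b.cartanMatrix_base_eq]
    exact h _ hk _ hl

end Chevalley

/-! ### Positivity of the normalized form -/

section Form

open LieAlgebra LieAlgebra.IsKilling LieModule

variable {ι L : Type*} [Fintype ι] [LieRing L] [LieAlgebra ℂ L] {H : LieSubalgebra ℂ L}
  (b : LieAlgebra.Basis ι H) [FiniteDimensional ℂ L] [LieAlgebra.IsSimple ℂ L]

include b in
/-- The Killing form is positive on the elements of the Cartan subalgebra on which all roots are
real. -/
lemma killingForm_pos [H.IsCartanSubalgebra] {x : H} (hx : ∀ γ : Weight ℂ H L, ∃ r : ℝ, γ x = r)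
    (hx0 : x ≠ 0) : 0 < killingForm ℂ L x x := by
  have h1 : killingForm ℂ L x x = ∑ γ ∈ H.root, γ x * γ x := by
    have := LinearMap.congr_fun₂ (restrict_killingForm_eq_sum (K := ℂ) (L := L) (H := H)) x x
    simp only [LinearMap.sum_apply, LinearMap.smulRight_apply, LinearMap.smul_apply] at this
    exact this
  have hnn (γ : Weight ℂ H L) : 0 ≤ γ x * γ x := by
    obtain ⟨r, hr⟩ := hx γ
    rw [hr, ← Complex.ofReal_mul]
    exact_mod_cast mul_self_nonneg r
  rw [h1]
  refine lt_of_le_of_ne (Finset.sum_nonneg fun γ _ ↦ hnn γ) fun h0 ↦ hx0 ?_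
  have h2 := (Finset.sum_eq_zero_iff_of_nonneg fun γ _ ↦ hnn γ).mp h0.symm
  refine cartan_ext b fun i ↦ ?_
  have := h2 _ (b.baseSupp' i).2
  rw [map_zero]
  exact mul_self_eq_zero.mp this

lemma weight_real (r : ι → ℝ) [H.IsCartanSubalgebra] (γ : Weight ℂ H L) :
    ∃ s : ℝ, γ (∑ i, (r i : ℂ) • b.h' i : H) = s := by
  have h (i : ι) : ∃ s : ℝ, γ (b.h' i) = s := by
    rw [← b.coroot_eq_h', apply_coroot_eq_cast']
    exact ⟨_, (Complex.ofReal_intCast _).symm⟩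
  choose s hs using h
  refine ⟨∑ i, r i * s i, ?_⟩
  have : γ (∑ i, (r i : ℂ) • b.h' i : H) = Weight.toLinear ℂ H L γ (∑ i, (r i : ℂ) • b.h' i : H) := rfl
  rw [this, map_sum]
  push_cast
  refine Finset.sum_congr rfl fun i _ ↦ ?_
  rw [map_smul, ← hs]
  rfl

/-- The square length of the highest root for the Killing form is positive: it is `4` divided by
that of the coroot. -/
lemma highestRoot_pos [H.IsCartanSubalgebra] {θ : Dual ℂ H} (hθ : IsHighestRoot b θ) :
    0 < θ ((cartanEquivDual H).symm θ) := by
  obtain ⟨x, hx0, hx, hxe⟩ := hθ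
  have := b.isLieAbelian_cartan
  have hgen : x ∈ genWeightSpace L (θ : H → ℂ) :=
    (mem_genWeightSpace _ _ _).mpr fun h ↦ ⟨1, by simpa [sub_eq_zero] using hx h⟩
  let α : Weight ℂ H L := ⟨θ, fun h ↦ hx0 (by simpa [h] using hgen)⟩
  have hα : α.toLinear = θ := rfl
  have hα0 : α.IsNonZero := by
    intro h0
    have hxH : x ∈ H := by
      have h1 : (θ : H → ℂ) = 0 := h0
      have h2 : x ∈ rootSpace H (0 : H → ℂ) := by rwa [h1] at hgen
      rwa [rootSpace_zero_eq] at h2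
    refine hx0 (congrArg Subtype.val (cartan_ext b (h := ⟨x, hxH⟩) (h' := 0) fun i ↦ ?_))
    have h3 := lie_e_eq b ⟨x, hxH⟩ i
    rw [← lie_skew, hxe, neg_zero] at h3
    rw [map_zero]
    exact (smul_eq_zero.mp h3.symm).resolve_right (b.sl2 i).e_ne_zero
  set t := (cartanEquivDual H).symm θ with ht
  have hcor : coroot α = (2 * (θ t)⁻¹) • t := by
    rw [coroot, mul_smul, ofNat_smul_eq_nsmul ℂ 2]
    rfl
  have hcor2 : θ (coroot α) = 2 := root_apply_coroot hα0
  have hθt : θ t ≠ 0 := by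
    intro h0
    rw [hcor, h0] at hcor2
    simp at hcor2
  have hcor0 : coroot α ≠ 0 := fun h ↦ by rw [h, map_zero] at hcor2; norm_num at hcor2
  have hpos := killingForm_pos b (x := coroot α) (fun γ ↦ by
    rw [apply_coroot_eq_cast']
    exact ⟨_, (Complex.ofReal_intCast _).symm⟩) hcor0
  have htt : killingForm ℂ L t t = θ t := by
    have h1 : cartanEquivDual H t = θ := by rw [ht, LinearEquiv.apply_symm_apply]
    have h2 := LinearMap.congr_fun h1 t
    rw [← h2, cartanEquivDual_apply_apply]
    rfl
  have h4 : killingForm ℂ L (coroot α) (coroot α) = 4 * (θ t)⁻¹ := by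
    rw [hcor]
    change killingForm ℂ L ((2 * (θ t)⁻¹) • (t : L)) ((2 * (θ t)⁻¹) • (t : L)) = _
    rw [map_smul, map_smul, LinearMap.smul_apply, htt, smul_eq_mul, smul_eq_mul]
    field_simp
    ring
  rw [h4] at hpos
  have h5 : (0 : ℂ) < (θ t)⁻¹ := by
    have := mul_pos (show (0 : ℂ) < ((1 / 4 : ℝ) : ℂ) by norm_num) hpos
    rwa [← mul_assoc, show ((1 / 4 : ℝ) : ℂ) * 4 = 1 by push_cast; norm_num, one_mul] at this
  exact RCLike.inv_pos.mp h5

variable {θ : Dual ℂ H}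

lemma normalizedForm_def [H.IsCartanSubalgebra] (x y : L) :
    normalizedForm b θ x y = (θ ((cartanEquivDual H).symm θ) / 2) * killingForm ℂ L x y := rfl

lemma normalizedForm_symm (x y : L) : normalizedForm b θ x y = normalizedForm b θ y x := by
  have := b.isCartanSubalgebra
  rw [normalizedForm_def, normalizedForm_def, LieModule.traceForm_comm]

lemma normalizedForm_lie (x y z : L) :
    normalizedForm b θ ⁅x, y⁆ z = normalizedForm b θ x ⁅y, z⁆ := by
  have := b.isCartanSubalgebra
  rw [normalizedForm_def, normalizedForm_def, LieModule.traceForm_apply_lie_apply]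

lemma normalizedForm_equiv (σ : L ≃ₗ⁅ℂ⁆ L) (x y : L) :
    normalizedForm b θ (σ x) (σ y) = normalizedForm b θ x y := by
  have := b.isCartanSubalgebra
  rw [normalizedForm_def, normalizedForm_def, LieAlgebra.killingForm_of_equiv_apply]

variable (hθ : IsHighestRoot b θ)
include hθ

lemma normalizedForm_nondegenerate {x : L} (hx : ∀ y, normalizedForm b θ x y = 0) : x = 0 := by
  have := b.isCartanSubalgebra
  have hc := (highestRoot_pos b hθ).ne'
  refine (LieAlgebra.IsKilling.killingForm_nondegenerate ℂ L).1 x fun y ↦ ?_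
  have := hx y
  rw [normalizedForm_def] at this
  exact (mul_eq_zero.mp this).resolve_left (div_ne_zero hc two_ne_zero)

/-- The normalized form is positive on the real span of the `h i`. -/
lemma normalizedForm_pos (r : ι → ℝ) (h0 : ∑ i, (r i : ℂ) • b.h i ≠ 0) :
    0 < normalizedForm b θ (∑ i, (r i : ℂ) • b.h i) (∑ i, (r i : ℂ) • b.h i) := by
  have := b.isCartanSubalgebra
  have hsum : ((∑ i, (r i : ℂ) • b.h' i : H) : L) = ∑ i, (r i : ℂ) • b.h i := by
    rw [AddSubmonoidClass.coe_finsetSum]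
    rfl
  rw [normalizedForm_def]
  refine mul_pos (div_pos (highestRoot_pos b hθ) two_pos) ?_
  rw [← hsum]
  refine killingForm_pos b (fun γ ↦ weight_real b r γ) fun h ↦ h0 ?_
  rw [← hsum, h]
  rfl

lemma normalizedForm_e_f_pos (i : ι) : 0 < normalizedForm b θ (b.e i) (b.f i) := by
  classical
  have h1 : normalizedForm b θ (b.h i) (b.h i) = 2 * normalizedForm b θ (b.e i) (b.f i) := by
    nth_rw 1 [← (b.sl2 i).lie_e_f]
    rw [normalizedForm_lie, ← lie_skew, (b.sl2 i).lie_h_f_nsmul, neg_neg, map_nsmul, nsmul_eq_mul]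
    norm_num
  have h2 : ∑ j, ((if j = i then 1 else 0 : ℝ) : ℂ) • b.h j = b.h i := by simp
  have h3 := normalizedForm_pos b hθ (fun j ↦ if j = i then 1 else 0)
  rw [h2, h1] at h3
  have h4 := h3 (b.sl2 i).h_ne_zero
  refine lt_of_le_of_ne (SplitData.nonneg_of_two_mul_nonneg h4.le) fun h ↦ ?_
  simp [← h] at h4

omit hθ in
lemma normalizedForm_h (h : H) (i : ι) :
    normalizedForm b θ h (b.h i) = b.baseSupp i h * normalizedForm b θ (b.e i) (b.f i) := by
  rw [← (b.sl2 i).lie_e_f, ← normalizedForm_lie, lie_e_eq, map_smul, LinearMap.smul_apply,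
    smul_eq_mul]

end Form

/-! ### Automorphisms that permute the Chevalley generators up to scalars -/

section Monomial

variable {ι L : Type*} [Fintype ι] [LieRing L] [LieAlgebra ℂ L] {H : LieSubalgebra ℂ L}

/-- The automorphism `σ`, of finite order, permutes the Chevalley generators up to scalars. -/
structure IsMonomial (b : LieAlgebra.Basis ι H) (σ : L ≃ₗ⁅ℂ⁆ L) (τ : Equiv.Perm ι) (c : ι → ℂ)
    (N : ℕ) : Prop where
  c_ne_zero : ∀ i, c i ≠ 0
  map_e : ∀ i, σ (b.e i) = c i • b.e (τ i)
  map_f : ∀ i, σ (b.f i) = (c i)⁻¹ • b.f (τ i)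
  pos : 0 < N
  iterate : ∀ x, σ^[N] x = x

/-- The sum of the vectors `ζ ^ k • σ ^ k x`, which is up to a factor the component of `x` in the
eigenspace of `σ` for `ζ⁻¹`. -/
noncomputable def twistedSum (σ : L ≃ₗ⁅ℂ⁆ L) (ζ : ℂ) (N : ℕ) (x : L) : L :=
  ∑ k ∈ Finset.range N, ζ ^ k • σ^[k] x

lemma iterate_lie (σ : L ≃ₗ⁅ℂ⁆ L) (k : ℕ) (x y : L) : σ^[k] ⁅x, y⁆ = ⁅σ^[k] x, σ^[k] y⁆ := by
  induction k generalizing x y with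
  | zero => rfl
  | succ k ih => rw [Function.iterate_succ_apply, LieEquiv.map_lie, ih]; rfl

lemma iterate_smul (σ : L ≃ₗ⁅ℂ⁆ L) (k : ℕ) (c : ℂ) (x : L) : σ^[k] (c • x) = c • σ^[k] x := by
  induction k generalizing x with
  | zero => rfl
  | succ k ih => rw [Function.iterate_succ_apply, map_smul, ih]; rfl

lemma iterate_of_eq_smul {σ : L ≃ₗ⁅ℂ⁆ L} {ζ : ℂ} {x : L} (hx : σ x = ζ • x) (k : ℕ) :
    σ^[k] x = ζ ^ k • x := by
  induction k with
  | zero => simp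
  | succ k ih => rw [Function.iterate_succ_apply', ih, map_smul, hx, smul_smul, pow_succ]

lemma map_twistedSum {σ : L ≃ₗ⁅ℂ⁆ L} {ζ : ℂ} {N : ℕ} (hζ : ζ ^ N = 1) (hζ0 : ζ ≠ 0)
    (hN : ∀ x, σ^[N] x = x) (x : L) : σ (twistedSum σ ζ N x) = ζ⁻¹ • twistedSum σ ζ N x := by
  have h1 : ζ • σ (twistedSum σ ζ N x) = twistedSum σ ζ N x := by
    have h2 : ζ • σ (twistedSum σ ζ N x) = ∑ k ∈ Finset.range N, ζ ^ (k + 1) • σ^[k + 1] x := by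
      rw [twistedSum, map_sum, Finset.smul_sum]
      refine Finset.sum_congr rfl fun k _ ↦ ?_
      rw [map_smul, smul_smul, pow_succ', Function.iterate_succ_apply']
    have h3 := Finset.sum_range_succ (fun k ↦ ζ ^ k • σ^[k] x) N
    rw [Finset.sum_range_succ', hζ, hN] at h3
    rw [h2]
    simpa [twistedSum] using h3
  rw [← h1, smul_smul, inv_mul_cancel₀ hζ0, one_smul, h1]

variable [FiniteDimensional ℂ L] [LieAlgebra.IsSimple ℂ L] {b : LieAlgebra.Basis ι H}
  {σ : L ≃ₗ⁅ℂ⁆ L} {τ : Equiv.Perm ι} {c : ι → ℂ} {N : ℕ} (hσ : IsMonomial b σ τ c N)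

namespace IsMonomial

include hσ

lemma map_h (i : ι) : σ (b.h i) = b.h (τ i) := by
  rw [← (b.sl2 i).lie_e_f, ← (b.sl2 (τ i)).lie_e_f, LieEquiv.map_lie, hσ.map_e, hσ.map_f, smul_lie,
    lie_smul, smul_smul, mul_inv_cancel₀ (hσ.c_ne_zero i), one_smul]

lemma iterate_h (k : ℕ) (i : ι) : σ^[k] (b.h i) = b.h (τ^[k] i) := by
  induction k with
  | zero => rfl
  | succ k ih => rw [Function.iterate_succ_apply', ih, hσ.map_h, ← Function.iterate_succ_apply' τ]

lemma map_mem {h : L} (hh : h ∈ H) : σ h ∈ H := by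
  obtain ⟨r, rfl⟩ := (mem_cartan_iff b).mp hh
  rw [map_sum]
  refine sum_mem fun i _ ↦ ?_
  rw [map_smul, hσ.map_h]
  exact LieSubalgebra.smul_mem _ _ (h_mem b _)

lemma baseSupp_map (h : H) (i : ι) :
    b.baseSupp (τ i) ⟨σ h, hσ.map_mem h.2⟩ = b.baseSupp i h := by
  have h1 := congrArg σ (lie_e_eq b h i)
  rw [LieEquiv.map_lie, map_smul, hσ.map_e, lie_smul, smul_comm] at h1
  have h2 := lie_e_eq b ⟨σ h, hσ.map_mem h.2⟩ (τ i)
  have h3 := smul_right_injective L (hσ.c_ne_zero i) h1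
  rw [h2] at h3
  exact smul_left_injective ℂ (b.sl2 (τ i)).e_ne_zero h3

end IsMonomial

/-! ### Weights for the Cartan subalgebra of the fixed points -/

variable (H σ) in
/-- The inclusion of the Cartan subalgebra `H ∩ L^σ` of the fixed points in `H`. -/
def toCartan : fixedCartan H σ →ₗ[ℂ] H where
  toFun t := ⟨(t : fixedSubalgebra σ), t.2⟩
  map_add' _ _ := rfl
  map_smul' _ _ := rfl

variable (b σ) in
/-- The restriction of a simple root. -/
noncomputable def fixedRoot (i : ι) : Dual ℂ (fixedCartan H σ) := b.baseSupp i ∘ₗ toCartan H σ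

lemma coe_toCartan (t : fixedCartan H σ) : (toCartan H σ t : L) = (t : fixedSubalgebra σ) := rfl

lemma map_coe (x : fixedSubalgebra σ) : σ (x : L) = x := x.2

lemma iterate_coe (x : fixedSubalgebra σ) (k : ℕ) : σ^[k] (x : L) = x :=
  Function.iterate_fixed (map_coe x) k

variable (b σ) in
include b in
lemma isLieAbelian_fixedCartan : IsLieAbelian (fixedCartan H σ) := by
  have := b.isLieAbelian_cartan
  refine ⟨fun t t' ↦ ?_⟩
  have h := congrArg Subtype.val (trivial_lie_zero H H (toCartan H σ t) (toCartan H σ t'))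
  exact Subtype.ext (Subtype.ext h)

variable (b σ) in
lemma isWtVec_e (i : ι) : IsWtVec (fixedRoot b σ i) (b.e i) :=
  fun t ↦ lie_e_eq b (toCartan H σ t) i

variable (b σ) in
lemma isWtVec_f (i : ι) : IsWtVec (-fixedRoot b σ i) (b.f i) :=
  fun t ↦ lie_f_eq b (toCartan H σ t) i

lemma isWtVec_cartan [IsLieAbelian H] {h : L} (hh : h ∈ H) :
    IsWtVec (T := fixedCartan H σ) 0 h := fun t ↦ by
  rw [LinearMap.zero_apply, zero_smul]
  exact congrArg Subtype.val (trivial_lie_zero H H (toCartan H σ t) ⟨h, hh⟩)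

lemma IsWtVec.lie_ambient {ν ν' : Dual ℂ (fixedCartan H σ)} {x y : L} (hx : IsWtVec ν x)
    (hy : IsWtVec ν' y) : IsWtVec (ν + ν') ⁅x, y⁆ := fun t ↦ by
  change ⁅((t : fixedSubalgebra σ) : L), ⁅x, y⁆⁆ = _
  have h1 : ⁅((t : fixedSubalgebra σ) : L), x⁆ = ν t • x := hx t
  have h2 : ⁅((t : fixedSubalgebra σ) : L), y⁆ = ν' t • y := hy t
  rw [leibniz_lie, h1, h2, smul_lie, lie_smul, LinearMap.add_apply, add_smul]

lemma IsWtVec.iterate {ν : Dual ℂ (fixedCartan H σ)} {x : L} (hx : IsWtVec ν x) (k : ℕ) :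
    IsWtVec ν (σ^[k] x) := fun t ↦ by
  have h := congrArg (σ^[k]) (hx t)
  rw [iterate_smul] at h
  rw [← h]
  change ⁅((t : fixedSubalgebra σ) : L), _⁆ = σ^[k] ⁅((t : fixedSubalgebra σ) : L), x⁆
  rw [iterate_lie, iterate_coe]

lemma IsWtVec.twistedSum {ν : Dual ℂ (fixedCartan H σ)} {x : L} (hx : IsWtVec ν x) (ζ : ℂ)
    (N : ℕ) : IsWtVec ν (twistedSum σ ζ N x) := by
  rw [TwistedCasimir.twistedSum]
  refine Finset.sum_induction _ (fun x ↦ IsWtVec ν x) (fun _ _ ↦ IsWtVec.add) (IsWtVec.zero ν)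
    fun k _ ↦ (hx.iterate k).smul _

variable (b σ) in
/-- The sums of restrictions of simple roots. -/
def rootCone : Set (Dual ℂ (fixedCartan H σ)) :=
  {ν | ∃ n : ι → ℕ, n ≠ 0 ∧ ν = ∑ i, (n i : ℂ) • fixedRoot b σ i}

lemma fixedRoot_mem_rootCone (i : ι) : fixedRoot b σ i ∈ rootCone b σ := by
  classical
  exact ⟨Pi.single i 1, by simp, by simp [Pi.single_apply, ite_smul]⟩

lemma rootCone_add {ν ν' : Dual ℂ (fixedCartan H σ)} (hν : ν ∈ rootCone b σ)
    (hν' : ν' ∈ rootCone b σ) : ν + ν' ∈ rootCone b σ := by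
  obtain ⟨n, hn, rfl⟩ := hν
  obtain ⟨m, hm, rfl⟩ := hν'
  refine ⟨n + m, fun h ↦ hn ?_, ?_⟩
  · funext i
    have := congrFun h i
    simp only [Pi.add_apply, Pi.zero_apply] at this ⊢
    lia
  · simp [add_smul, Finset.sum_add_distrib]

lemma mem_span_rootCone_e {x : L} (hx : x ∈ LieSubalgebra.lieSpan ℂ L (Set.range b.e)) :
    x ∈ Submodule.span ℂ {w : L | ∃ χ ∈ rootCone b σ, IsWtVec χ w} := by
  refine lieSpan_le_span ?_ ?_ hx
  · rintro _ ⟨i, rfl⟩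
    exact ⟨_, fixedRoot_mem_rootCone i, isWtVec_e b σ i⟩
  · rintro u ⟨χ, hχ, hu⟩ v ⟨χ', hχ', hv⟩
    exact ⟨χ + χ', rootCone_add hχ hχ', hu.lie_ambient hv⟩

lemma mem_span_rootCone_f {x : L} (hx : x ∈ LieSubalgebra.lieSpan ℂ L (Set.range b.f)) :
    x ∈ Submodule.span ℂ {w : L | ∃ χ, -χ ∈ rootCone b σ ∧ IsWtVec χ w} := by
  refine lieSpan_le_span ?_ ?_ hx
  · rintro _ ⟨i, rfl⟩
    exact ⟨_, by simpa using fixedRoot_mem_rootCone i, isWtVec_f b σ i⟩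
  · rintro u ⟨χ, hχ, hu⟩ v ⟨χ', hχ', hv⟩
    exact ⟨χ + χ', by rw [neg_add]; exact rootCone_add hχ hχ', hu.lie_ambient hv⟩

variable (b σ) in
lemma span_isWtVec : Submodule.span ℂ {w : L | ∃ χ ∈ {χ : Dual ℂ (fixedCartan H σ) |
    χ = 0 ∨ χ ∈ rootCone b σ ∨ -χ ∈ rootCone b σ}, IsWtVec χ w} = ⊤ := by
  have := b.isLieAbelian_cartan
  rw [eq_top_iff]
  rintro x -
  obtain ⟨u, hu, v, hv, w, hw, rfl⟩ := exists_triangular b x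
  refine add_mem (add_mem (Submodule.subset_span ⟨0, .inl rfl, isWtVec_cartan hu⟩)
    (Submodule.span_mono ?_ (mem_span_rootCone_f (σ := σ) hv)))
    (Submodule.span_mono ?_ (mem_span_rootCone_e (σ := σ) hw))
  · rintro y ⟨χ, hχ, hy⟩
    exact ⟨χ, .inr (.inr hχ), hy⟩
  · rintro y ⟨χ, hχ, hy⟩
    exact ⟨χ, .inr (.inl hχ), hy⟩

lemma isWt_cases {ν : Dual ℂ (fixedCartan H σ)} (b : LieAlgebra.Basis ι H)
    (hν : IsWt (fixedCartan H σ) L ν) : ν = 0 ∨ ν ∈ rootCone b σ ∨ -ν ∈ rootCone b σ := by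
  have := isLieAbelian_fixedCartan b σ
  exact hν.mem_of_span_eq_top (span_isWtVec b σ)

namespace IsMonomial

include hσ

lemma fixedRoot_perm (i : ι) : fixedRoot b σ (τ i) = fixedRoot b σ i := by
  ext t
  have h := hσ.baseSupp_map (toCartan H σ t) i
  have h2 : (⟨σ (toCartan H σ t), hσ.map_mem (toCartan H σ t).2⟩ : H) = toCartan H σ t :=
    Subtype.ext (map_coe (t : fixedSubalgebra σ))
  rw [h2] at h
  exact h

lemma fixedRoot_iterate (k : ℕ) (i : ι) : fixedRoot b σ (τ^[k] i) = fixedRoot b σ i := by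
  induction k with
  | zero => rfl
  | succ k ih => rw [Function.iterate_succ_apply', hσ.fixedRoot_perm, ih]

lemma exists_coweight {g : ι → ℂ} (hg : ∀ i, g (τ i) = g i) :
    ∃ t : fixedCartan H σ, ∀ i, fixedRoot b σ i t = g i := by
  obtain ⟨h, hh⟩ := exists_baseSupp_eq b g
  have hfix : (⟨σ h, hσ.map_mem h.2⟩ : H) = h := cartan_ext b fun i ↦ by
    obtain ⟨j, rfl⟩ := τ.surjective i
    rw [hσ.baseSupp_map, hh, hh, hg]
  exact ⟨⟨⟨h, congrArg Subtype.val hfix⟩, h.2⟩, fun i ↦ hh i⟩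

/-- Weight vectors of weight `0` lie in the Cartan subalgebra, and those whose weight is a sum of
simple roots in the subalgebra generated by the `e i`. -/
lemma mem_of_isWtVec {ν : Dual ℂ (fixedCartan H σ)} {x : L} (hx : IsWtVec ν x) :
    (ν = 0 → x ∈ H) ∧ (ν ∈ rootCone b σ → x ∈ LieSubalgebra.lieSpan ℂ L (Set.range b.e)) := by
  obtain ⟨t, ht⟩ := hσ.exists_coweight (g := fun _ ↦ 1) fun _ ↦ rfl
  have h := mem_of_height b (h₀ := toCartan H σ t) ht (hx t)
  refine ⟨fun hν ↦ h.1 (by rw [hν]; rfl), fun ⟨n, hn, hν⟩ ↦ h.2.1 ?_⟩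
  obtain ⟨i, hi⟩ := Function.ne_iff.mp hn
  rw [hν, LinearMap.sum_apply]
  simp only [LinearMap.smul_apply, ht, smul_eq_mul, mul_one]
  have : 0 < ∑ i, n i := Finset.sum_pos' (fun _ _ ↦ Nat.zero_le _)
    ⟨i, Finset.mem_univ i, Nat.pos_of_ne_zero hi⟩
  exact_mod_cast this

lemma rootCone_ht {t : fixedCartan H σ} (ht : ∀ i, fixedRoot b σ i t = 1)
    {ν : Dual ℂ (fixedCartan H σ)} (hν : ν ∈ rootCone b σ) : 0 < ν t := by
  obtain ⟨n, hn, rfl⟩ := hν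
  obtain ⟨i, hi⟩ := Function.ne_iff.mp hn
  rw [LinearMap.sum_apply]
  simp only [LinearMap.smul_apply, ht, smul_eq_mul, mul_one]
  have : 0 < ∑ i, n i := Finset.sum_pos' (fun _ _ ↦ Nat.zero_le _)
    ⟨i, Finset.mem_univ i, Nat.pos_of_ne_zero hi⟩
  exact_mod_cast this

end IsMonomial

end Monomial

/-! ### The root decomposition of the fixed point subalgebra -/

section FixedForm

variable {ι L : Type*} [Fintype ι] [LieRing L] [LieAlgebra ℂ L] {H : LieSubalgebra ℂ L}

/-- The real span of the `h i`. -/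
def realCartan (b : LieAlgebra.Basis ι H) : AddSubgroup L where
  carrier := {x | ∃ r : ι → ℝ, x = ∑ i, (r i : ℂ) • b.h i}
  add_mem' := by
    rintro _ _ ⟨r, rfl⟩ ⟨s, rfl⟩
    exact ⟨r + s, by simp [add_smul, Finset.sum_add_distrib]⟩
  zero_mem' := ⟨0, by simp⟩
  neg_mem' := by
    rintro _ ⟨r, rfl⟩
    exact ⟨-r, by simp⟩

lemma smul_mem_realCartan {b : LieAlgebra.Basis ι H} {x : L} (hx : x ∈ realCartan b) (s : ℝ) :
    (s : ℂ) • x ∈ realCartan b := by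
  obtain ⟨r, rfl⟩ := hx
  exact ⟨fun i ↦ s * r i, by simp only [Finset.smul_sum, smul_smul, Complex.ofReal_mul]⟩

lemma h_mem_realCartan (b : LieAlgebra.Basis ι H) (i : ι) : b.h i ∈ realCartan b := by
  classical
  exact ⟨fun j ↦ if j = i then 1 else 0, by simp⟩

variable [FiniteDimensional ℂ L] [LieAlgebra.IsSimple ℂ L] {b : LieAlgebra.Basis ι H}
  {σ : L ≃ₗ⁅ℂ⁆ L} {τ : Equiv.Perm ι} {c : ι → ℂ} {N : ℕ} {θ : Dual ℂ H}

lemma normalizedForm_iterate (k : ℕ) (x y : L) :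
    normalizedForm b θ (σ^[k] x) (σ^[k] y) = normalizedForm b θ x y := by
  induction k with
  | zero => rfl
  | succ k ih =>
    rw [Function.iterate_succ_apply', Function.iterate_succ_apply', normalizedForm_equiv, ih]

/-- Weight vectors are orthogonal unless their weights are opposite. -/
lemma normalizedForm_eq_zero {ν ν' : Dual ℂ (fixedCartan H σ)} {x y : L} (hx : IsWtVec ν x)
    (hy : IsWtVec ν' y) (h : normalizedForm b θ x y ≠ 0) : ν' = -ν := by
  rw [eq_neg_iff_add_eq_zero]
  refine LinearMap.ext fun t ↦ ?_
  have h1 : ⁅((t : fixedSubalgebra σ) : L), x⁆ = ν t • x := hx t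
  have h2 : ⁅((t : fixedSubalgebra σ) : L), y⁆ = ν' t • y := hy t
  have h3 := normalizedForm_lie b (θ := θ) x (t : fixedSubalgebra σ) y
  rw [← lie_skew, h1, h2, map_neg, LinearMap.neg_apply, map_smul, map_smul, LinearMap.smul_apply,
    smul_eq_mul, smul_eq_mul] at h3
  have h4 : (ν' t + ν t) * normalizedForm b θ x y = 0 := by linear_combination -h3
  exact (mul_eq_zero.mp h4).resolve_right h

lemma exists_isWtVec_normalizedForm_ne_zero (hθ : IsHighestRoot b θ) {x : L} (hx0 : x ≠ 0) :
    ∃ (χ : Dual ℂ (fixedCartan H σ)) (w : L), IsWtVec χ w ∧ normalizedForm b θ x w ≠ 0 := by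
  by_contra! hcon
  refine hx0 (normalizedForm_nondegenerate b hθ fun y ↦ ?_)
  have hy : y ∈ Submodule.span ℂ {w : L | ∃ χ ∈ {χ : Dual ℂ (fixedCartan H σ) |
      χ = 0 ∨ χ ∈ rootCone b σ ∨ -χ ∈ rootCone b σ}, IsWtVec χ w} := by
    rw [span_isWtVec]; trivial
  induction hy using Submodule.span_induction with
  | mem y hy =>
    obtain ⟨χ, -, hy⟩ := hy
    exact hcon χ y hy
  | zero => exact map_zero _
  | add a b _ _ ha hb => rw [map_add, ha, hb, add_zero]
  | smul c a _ ha => rw [map_smul, ha, smul_zero]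

/-- The weights of the subalgebra generated by the `e i` are sums of simple roots. -/
lemma mem_rootCone_of_mem_lieSpan (hθ : IsHighestRoot b θ) {ν : Dual ℂ (fixedCartan H σ)} {x : L}
    (hx0 : x ≠ 0) (hx : IsWtVec ν x) (hxe : x ∈ LieSubalgebra.lieSpan ℂ L (Set.range b.e)) :
    ν ∈ rootCone b σ := by
  obtain ⟨χ, w, hw, hxw⟩ := exists_isWtVec_normalizedForm_ne_zero (σ := σ) hθ hx0
  by_contra hν
  have hχ := normalizedForm_eq_zero hx hw hxw
  refine hxw ?_
  have hxe' := mem_span_rootCone_e (σ := σ) hxe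
  clear hxw hxe hx hx0
  induction hxe' using Submodule.span_induction with
  | mem y hy =>
    obtain ⟨χ', hχ', hy⟩ := hy
    by_contra h0
    have := normalizedForm_eq_zero hy hw h0
    rw [hχ, neg_inj] at this
    exact hν (this ▸ hχ')
  | zero => rw [map_zero, LinearMap.zero_apply]
  | add a b _ _ ha hb => rw [map_add, LinearMap.add_apply, ha, hb, add_zero]
  | smul c a _ ha => rw [map_smul, LinearMap.smul_apply, ha, smul_zero]

namespace IsMonomial

variable (hσ : IsMonomial b σ τ c N) (hθ : IsHighestRoot b θ)
include hσ

lemma normalizedForm_perm (i : ι) : normalizedForm b θ (b.e (τ i)) (b.f (τ i)) =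
    normalizedForm b θ (b.e i) (b.f i) := by
  rw [← normalizedForm_equiv b σ (b.e i), hσ.map_e, hσ.map_f, map_smul, map_smul,
    LinearMap.smul_apply, smul_smul, inv_mul_cancel₀ (hσ.c_ne_zero i), one_smul]

lemma normalizedForm_iterate_perm (k : ℕ) (i : ι) :
    normalizedForm b θ (b.e (τ^[k] i)) (b.f (τ^[k] i)) = normalizedForm b θ (b.e i) (b.f i) := by
  induction k with
  | zero => rfl
  | succ k ih => rw [Function.iterate_succ_apply', hσ.normalizedForm_perm, ih]

include hθ

/-- The element of the Cartan subalgebra of the fixed points that corresponds to the restriction of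
a simple root is a positive multiple of the sum of the conjugates of the coroot. -/
lemma exists_dual_fixedRoot (i : ι) : ∃ (t : fixedCartan H σ) (r : ℝ), 0 < r ∧
    ((t : fixedSubalgebra σ) : L) = (r : ℂ) • ∑ k ∈ Finset.range N, b.h (τ^[k] i) ∧
    ∀ t' : fixedCartan H σ, normalizedForm b θ (t' : fixedSubalgebra σ) (t : fixedSubalgebra σ) =
      fixedRoot b σ i t' := by
  have hd := normalizedForm_e_f_pos b hθ i
  set d := normalizedForm b θ (b.e i) (b.f i) with hd'
  have hdr : (d.re : ℂ) = d := Complex.ext rfl (Complex.lt_def.mp hd).2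
  have hd0 : 0 < d.re := (Complex.lt_def.mp hd).1
  have hN : (0 : ℝ) < N := Nat.cast_pos.mpr hσ.pos
  have hs : σ (twistedSum σ 1 N (b.h i)) = twistedSum σ 1 N (b.h i) := by
    have := map_twistedSum (σ := σ) (one_pow N) one_ne_zero hσ.iterate (b.h i)
    rwa [inv_one, one_smul] at this
  have hs' : twistedSum σ 1 N (b.h i) = ∑ k ∈ Finset.range N, b.h (τ^[k] i) := by
    rw [twistedSum]
    refine Finset.sum_congr rfl fun k _ ↦ ?_
    rw [one_pow, one_smul, hσ.iterate_h]
  rw [hs'] at hs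
  have hr : 0 < (N * d.re)⁻¹ := inv_pos.mpr (mul_pos hN hd0)
  refine ⟨⟨⟨(((N * d.re)⁻¹ : ℝ) : ℂ) • ∑ k ∈ Finset.range N, b.h (τ^[k] i), ?_⟩, ?_⟩, _, hr, rfl,
    fun t' ↦ ?_⟩
  · change σ _ = _
    rw [map_smul, hs]
  · change _ ∈ H
    exact LieSubalgebra.smul_mem _ _ (sum_mem fun k _ ↦ h_mem b _)
  · have h1 (k : ℕ) : normalizedForm b θ (t' : fixedSubalgebra σ) (b.h (τ^[k] i)) =
        fixedRoot b σ i t' * d := by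
      rw [← coe_toCartan, normalizedForm_h, hσ.normalizedForm_iterate_perm,
        ← hσ.fixedRoot_iterate k i]
      rfl
    rw [map_smul, map_sum, Finset.sum_congr rfl fun k _ ↦ h1 k, Finset.sum_const,
      Finset.card_range, smul_eq_mul, nsmul_eq_mul]
    push_cast
    rw [hdr]
    have : (N : ℂ) ≠ 0 := Nat.cast_ne_zero.mpr hσ.pos.ne'
    have := hd.ne'
    field_simp

lemma normalizedForm_fixedCartan {t : fixedCartan H σ} (ht : ∀ t' : fixedCartan H σ,
    normalizedForm b θ (t : fixedSubalgebra σ) (t' : fixedSubalgebra σ) = 0) : t = 0 := by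
  have h : toCartan H σ t = 0 := cartan_ext b fun i ↦ by
    obtain ⟨s, r, -, -, hs⟩ := hσ.exists_dual_fixedRoot hθ i
    rw [map_zero]
    exact (hs t).symm.trans (ht s)
  exact Subtype.ext (Subtype.ext (congrArg (fun h : H ↦ (h : L)) h))

/-- The square length of a nonzero weight is positive. -/
lemma exists_dual {ν : Dual ℂ (fixedCartan H σ)} (hν : ν ∈ rootCone b σ ∨ -ν ∈ rootCone b σ)
    (hν0 : ν ≠ 0) : ∃ t : fixedCartan H σ,
    (∀ t' : fixedCartan H σ,
      normalizedForm b θ (t' : fixedSubalgebra σ) (t : fixedSubalgebra σ) = ν t') ∧ 0 < ν t := by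
  choose s r _ hs hs' using hσ.exists_dual_fixedRoot hθ
  have key : ∃ t : fixedCartan H σ, ((t : fixedSubalgebra σ) : L) ∈ realCartan b ∧
      ∀ t' : fixedCartan H σ,
        normalizedForm b θ (t' : fixedSubalgebra σ) (t : fixedSubalgebra σ) = ν t' := by
    have hcone (n : ι → ℕ) : ∃ t : fixedCartan H σ, ((t : fixedSubalgebra σ) : L) ∈ realCartan b ∧
        ∀ t' : fixedCartan H σ, normalizedForm b θ (t' : fixedSubalgebra σ)
          (t : fixedSubalgebra σ) = (∑ i, (n i : ℂ) • fixedRoot b σ i) t' := by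
      have hcoe : (((∑ i, (n i : ℂ) • s i : fixedCartan H σ) : fixedSubalgebra σ) : L) =
          ∑ i, (n i : ℂ) • ((s i : fixedSubalgebra σ) : L) := by
        rw [AddSubmonoidClass.coe_finsetSum, AddSubmonoidClass.coe_finsetSum]
        rfl
      refine ⟨∑ i, (n i : ℂ) • s i, ?_, fun t' ↦ ?_⟩
      · rw [hcoe]
        refine sum_mem fun i _ ↦ ?_
        rw [hs]
        exact_mod_cast smul_mem_realCartan (smul_mem_realCartan
          (sum_mem fun k _ ↦ h_mem_realCartan b (τ^[k] i)) (r i)) (n i)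
      · rw [hcoe, map_sum, LinearMap.sum_apply]
        refine Finset.sum_congr rfl fun i _ ↦ ?_
        rw [map_smul, hs']
        rfl
    rcases hν with ⟨n, -, hn⟩ | ⟨n, -, hn⟩
    · rw [hn]
      exact hcone n
    · obtain ⟨t, ht, ht'⟩ := hcone n
      refine ⟨-t, neg_mem ht, fun t' ↦ ?_⟩
      rw [← hn] at ht'
      have := congrArg Neg.neg (ht' t')
      rw [LinearMap.neg_apply, neg_neg, ← map_neg] at this
      exact this
  obtain ⟨t, ⟨q, hq⟩, ht⟩ := key
  refine ⟨t, ht, ?_⟩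
  rw [← ht, hq]
  refine normalizedForm_pos b hθ q fun h0 ↦ hν0 (LinearMap.ext fun t' ↦ ?_)
  rw [← ht t', hq, h0, map_zero, LinearMap.zero_apply]

/-- A weight vector `x` in an eigenspace of `σ` has a dual weight vector `y` in the opposite
eigenspace, and `y`, `x` and their bracket span an `sl₂` for which weight vectors of positive
weight are not annihilated by `y`. -/
lemma exists_opposite {ζ : ℂ} (hζ : ζ ≠ 0) {ν : Dual ℂ (fixedCartan H σ)} {x : L} (hx0 : x ≠ 0)
    (hxσ : σ x = ζ • x) (hx : IsWtVec ν x) (hν0 : ν ≠ 0) :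
    ∃ (y : L) (t : fixedCartan H σ), σ y = ζ⁻¹ • y ∧ IsWtVec (-ν) y ∧ normalizedForm b θ x y = 1 ∧
      ⁅x, y⁆ = ((t : fixedSubalgebra σ) : L) ∧
      (∀ t' : fixedCartan H σ,
        normalizedForm b θ (t' : fixedSubalgebra σ) (t : fixedSubalgebra σ) = ν t') ∧ 0 < ν t ∧
      ∀ (ν' : Dual ℂ (fixedCartan H σ)) (z : L), z ≠ 0 → IsWtVec ν' z → 0 < ν' t → ⁅y, z⁆ ≠ 0 := by
  have hζN : ζ ^ N = 1 := by
    have h := iterate_of_eq_smul hxσ N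
    rw [hσ.iterate] at h
    refine smul_left_injective ℂ hx0 ?_
    simpa using h.symm
  have hN : (N : ℂ) ≠ 0 := Nat.cast_ne_zero.mpr hσ.pos.ne'
  obtain ⟨χ, w, hw, hxw⟩ := exists_isWtVec_normalizedForm_ne_zero (σ := σ) hθ hx0
  obtain rfl := normalizedForm_eq_zero hx hw hxw
  have havg : normalizedForm b θ x (twistedSum σ ζ N w) = N * normalizedForm b θ x w := by
    rw [twistedSum, map_sum, Finset.sum_congr rfl fun k _ ↦ ?_, Finset.sum_const, Finset.card_range,
      nsmul_eq_mul]
    have h := normalizedForm_iterate (b := b) (θ := θ) (σ := σ) k x w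
    rw [iterate_of_eq_smul hxσ, map_smul, LinearMap.smul_apply] at h
    rw [map_smul, h]
  have havg0 : normalizedForm b θ x (twistedSum σ ζ N w) ≠ 0 := by
    rw [havg]
    exact mul_ne_zero hN hxw
  set y := (normalizedForm b θ x (twistedSum σ ζ N w))⁻¹ • twistedSum σ ζ N w with hy
  have hyσ : σ y = ζ⁻¹ • y := by
    rw [hy, map_smul, map_twistedSum hζN hζ hσ.iterate, smul_comm]
  have hyw : IsWtVec (-ν) y := (hw.twistedSum ζ N).smul _
  have hxy : normalizedForm b θ x y = 1 := by
    rw [hy, map_smul, smul_eq_mul, inv_mul_cancel₀ havg0]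
  clear_value y
  have hmem : ⁅x, y⁆ ∈ H := by
    refine (hσ.mem_of_isWtVec (ν := 0) ?_).1 rfl
    have := hx.lie_ambient hyw
    rwa [add_neg_cancel] at this
  have hfix : σ ⁅x, y⁆ = ⁅x, y⁆ := by
    rw [LieEquiv.map_lie, hxσ, hyσ, smul_lie, lie_smul, smul_smul, mul_inv_cancel₀ hζ, one_smul]
  let t : fixedCartan H σ := ⟨⟨⁅x, y⁆, hfix⟩, hmem⟩
  have ht (t' : fixedCartan H σ) :
      normalizedForm b θ (t' : fixedSubalgebra σ) (t : fixedSubalgebra σ) = ν t' := by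
    change normalizedForm b θ (t' : fixedSubalgebra σ) ⁅x, y⁆ = _
    have h1 : ⁅((t' : fixedSubalgebra σ) : L), x⁆ = ν t' • x := hx t'
    rw [← normalizedForm_lie, h1, map_smul, LinearMap.smul_apply, hxy, smul_eq_mul, mul_one]
  have htpos : 0 < ν t := by
    obtain ⟨s, hs, hspos⟩ := hσ.exists_dual hθ
      ((isWt_cases b ⟨x, hx0, hx⟩).resolve_left hν0) hν0
    have : t - s = 0 := hσ.normalizedForm_fixedCartan hθ fun t' ↦ by
      rw [normalizedForm_symm]
      change normalizedForm b θ (t' : fixedSubalgebra σ)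
        (((t : fixedSubalgebra σ) : L) - ((s : fixedSubalgebra σ) : L)) = 0
      rw [map_sub, ht, hs, sub_self]
    rwa [sub_eq_zero.mp this]
  refine ⟨y, t, hyσ, hyw, hxy, rfl, ht, htpos, fun ν' z hz0 hz hpos hyz ↦ ?_⟩
  have hq := htpos.ne'
  have ht0 : ((t : fixedSubalgebra σ) : L) ≠ 0 := fun h0 ↦ hq <| by
    rw [← ht t, h0, map_zero]
  have hty : ⁅((t : fixedSubalgebra σ) : L), y⁆ = -ν t • y := hyw t
  have htx : ⁅((t : fixedSubalgebra σ) : L), x⁆ = ν t • x := hx t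
  have htz : ⁅((t : fixedSubalgebra σ) : L), z⁆ = ν' t • z := hz t
  have tri : IsSl2Triple (-((2 / ν t) • ((t : fixedSubalgebra σ) : L))) y ((2 / ν t) • x) := by
    refine ⟨neg_ne_zero.mpr (smul_ne_zero (div_ne_zero two_ne_zero hq) ht0), ?_, ?_, ?_⟩
    · rw [lie_smul, ← lie_skew, smul_neg]
    · rw [neg_lie, smul_lie, hty, smul_smul, ← neg_smul, mul_neg, neg_neg, div_mul_cancel₀ _ hq,
        ofNat_smul_eq_nsmul]
    · rw [neg_lie, smul_lie, lie_smul, htx, smul_comm (2 / ν t) (ν t) x, smul_smul (2 / ν t) (ν t),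
        div_mul_cancel₀ _ hq, ofNat_smul_eq_nsmul]
  have P : tri.HasPrimitiveVectorWith z (-(2 / ν t * ν' t)) :=
    { ne_zero := hz0
      lie_h := by rw [neg_lie, smul_lie, htz, smul_smul, neg_smul]
      lie_e := hyz }
  obtain ⟨n, hn⟩ := P.exists_nat
  have h1 : 0 < 2 / ν t * ν' t := mul_pos (div_pos two_pos htpos) hpos
  have h2 : (0 : ℂ) ≤ -(2 / ν t * ν' t) := hn ▸ Nat.cast_nonneg n
  exact (neg_nonneg.mp h2).not_gt h1

end IsMonomial

end FixedForm

section FixedSplit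

variable {ι L : Type*} [Fintype ι] [LieRing L] [LieAlgebra ℂ L] {H : LieSubalgebra ℂ L}
  [FiniteDimensional ℂ L] [LieAlgebra.IsSimple ℂ L] {b : LieAlgebra.Basis ι H}
  {σ : L ≃ₗ⁅ℂ⁆ L} {τ : Equiv.Perm ι} {c : ι → ℂ} {N : ℕ} {θ : Dual ℂ H}

lemma isWtVec_fixed_iff {ν : Dual ℂ (fixedCartan H σ)} {x : fixedSubalgebra σ} :
    IsWtVec ν x ↔ IsWtVec ν (x : L) :=
  forall_congr' fun _ ↦ Subtype.ext_iff

lemma mem_positiveRoots_iff (hσ : IsMonomial b σ τ c N) (hθ : IsHighestRoot b θ)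
    {ν : Dual ℂ (fixedCartan H σ)} : ν ∈ positiveRoots b σ ↔
      ν ∈ rootCone b σ ∧ ∃ x : fixedSubalgebra σ, x ≠ 0 ∧ IsWtVec ν x := by
  constructor
  · rintro ⟨x, hx, hx0, hxν⟩
    refine ⟨mem_rootCone_of_mem_lieSpan hθ (x := x) (fun h ↦ hx0 (Subtype.ext h))
      (isWtVec_fixed_iff.mp hxν) hx, x, hx0, hxν⟩
  · rintro ⟨hν, x, hx0, hx⟩
    exact ⟨x, (hσ.mem_of_isWtVec (isWtVec_fixed_iff.mp hx)).2 hν, hx0, hx⟩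

namespace IsMonomial

variable (hσ : IsMonomial b σ τ c N) (hθ : IsHighestRoot b θ)
include hσ hθ

lemma rootCone_ne_zero {ν : Dual ℂ (fixedCartan H σ)} (hν : ν ∈ rootCone b σ) : ν ≠ 0 := by
  rintro rfl
  obtain ⟨t, ht⟩ := hσ.exists_coweight (g := fun _ ↦ 1) fun _ ↦ rfl
  exact lt_irrefl _ (hσ.rootCone_ht ht hν)

/-- Nonzero weights have multiplicity one in each eigenspace of `σ`. -/
lemma exists_eq_smul {ζ : ℂ} (hζ : ζ ≠ 0) {ν : Dual ℂ (fixedCartan H σ)} {x z : L} (hx0 : x ≠ 0)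
    (hxσ : σ x = ζ • x) (hx : IsWtVec ν x) (hν0 : ν ≠ 0) (hzσ : σ z = ζ • z) (hz : IsWtVec ν z) :
    ∃ a : ℂ, z = a • x := by
  obtain ⟨y, t, hyσ, hy, hxy, -, -, hpos, hne⟩ := hσ.exists_opposite hθ hζ hx0 hxσ hx hν0
  refine ⟨normalizedForm b θ z y, sub_eq_zero.mp ?_⟩
  set z' := z - normalizedForm b θ z y • x with hz'
  have hz'w : IsWtVec ν z' := by
    rw [hz', sub_eq_add_neg, ← neg_smul]
    exact hz.add (hx.smul _)
  have hz'y : normalizedForm b θ z' y = 0 := by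
    rw [hz', map_sub, map_smul, LinearMap.sub_apply, LinearMap.smul_apply, hxy, smul_eq_mul,
      mul_one, sub_self]
  have hz'σ : σ z' = ζ • z' := by
    rw [hz', map_sub, map_smul, hzσ, hxσ, smul_sub, smul_comm]
  clear_value z'
  by_contra hz'0
  refine hne ν z' hz'0 hz'w hpos ?_
  rw [← lie_skew, neg_eq_zero]
  have hmem : ⁅z', y⁆ ∈ H := by
    refine (hσ.mem_of_isWtVec (ν := 0) ?_).1 rfl
    have := hz'w.lie_ambient hy
    rwa [add_neg_cancel] at this
  have hfix : σ ⁅z', y⁆ = ⁅z', y⁆ := by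
    rw [LieEquiv.map_lie, hz'σ, hyσ, smul_lie, lie_smul, smul_smul, mul_inv_cancel₀ hζ, one_smul]
  have h0 := hσ.normalizedForm_fixedCartan hθ (t := ⟨⟨⁅z', y⁆, hfix⟩, hmem⟩) fun t' ↦ by
    rw [normalizedForm_symm]
    change normalizedForm b θ (t' : fixedSubalgebra σ) ⁅z', y⁆ = 0
    have h1 : ⁅((t' : fixedSubalgebra σ) : L), z'⁆ = ν t' • z' := hz'w t'
    rw [← normalizedForm_lie, h1, map_smul, LinearMap.smul_apply, hz'y, smul_zero]
  exact congrArg (fun t : fixedCartan H σ ↦ ((t : fixedSubalgebra σ) : L)) h0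

variable (b σ) in
omit hσ hθ in
lemma finite_positiveRoots : (positiveRoots b σ).Finite := by
  have := isLieAbelian_fixedCartan b σ
  refine (finite_isWt (fixedCartan H σ) (fixedSubalgebra σ)).subset ?_
  rintro ν ⟨x, -, hx0, hx⟩
  exact ⟨x, hx0, hx⟩

/-- Every fixed vector is a combination of fixed weight vectors. -/
lemma mem_of_forall_isWtVec {S : Submodule ℂ (fixedSubalgebra σ)}
    (hS : ∀ (ν : Dual ℂ (fixedCartan H σ)) (x : fixedSubalgebra σ), x ≠ 0 → IsWtVec ν x → x ∈ S)
    (x : fixedSubalgebra σ) : x ∈ S := by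
  have key (y : L) : ∃ s ∈ S, (s : L) = twistedSum σ 1 N y := by
    have hy : y ∈ Submodule.span ℂ {w : L | ∃ χ ∈ {χ : Dual ℂ (fixedCartan H σ) |
        χ = 0 ∨ χ ∈ rootCone b σ ∨ -χ ∈ rootCone b σ}, IsWtVec χ w} := by
      rw [span_isWtVec]; trivial
    induction hy using Submodule.span_induction with
    | mem y hy =>
      obtain ⟨χ, -, hy⟩ := hy
      have hfix : σ (twistedSum σ 1 N y) = twistedSum σ 1 N y := by
        have := map_twistedSum (σ := σ) (one_pow N) one_ne_zero hσ.iterate y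
        rwa [inv_one, one_smul] at this
      refine ⟨⟨_, hfix⟩, ?_, rfl⟩
      by_cases h0 : (⟨_, hfix⟩ : fixedSubalgebra σ) = 0
      · rw [h0]; exact zero_mem S
      · exact hS χ _ h0 (isWtVec_fixed_iff.mpr (hy.twistedSum 1 N))
    | zero =>
      refine ⟨0, zero_mem S, ?_⟩
      rw [twistedSum]
      refine (Finset.sum_eq_zero fun k _ ↦ ?_).symm
      rw [iterate_map_zero, smul_zero]
    | add u v _ _ hu hv =>
      obtain ⟨s, hs, hs'⟩ := hu
      obtain ⟨t, ht, ht'⟩ := hv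
      refine ⟨s + t, add_mem hs ht, ?_⟩
      rw [show ((s + t : fixedSubalgebra σ) : L) = s + t from rfl, hs', ht', twistedSum, twistedSum, twistedSum,
        ← Finset.sum_add_distrib]
      refine Finset.sum_congr rfl fun k _ ↦ ?_
      rw [← smul_add, iterate_map_add]
    | smul a u _ hu =>
      obtain ⟨s, hs, hs'⟩ := hu
      refine ⟨a • s, S.smul_mem a hs, ?_⟩
      rw [show ((a • s : fixedSubalgebra σ) : L) = a • (s : L) from rfl, hs', twistedSum, twistedSum, Finset.smul_sum]
      refine Finset.sum_congr rfl fun k _ ↦ ?_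
      rw [iterate_smul, smul_comm]
  obtain ⟨s, hs, hs'⟩ := key (x : L)
  have hN : (N : ℂ) ≠ 0 := Nat.cast_ne_zero.mpr hσ.pos.ne'
  have : x = (N : ℂ)⁻¹ • s := by
    refine Subtype.ext ?_
    rw [show (((N : ℂ)⁻¹ • s : fixedSubalgebra σ) : L) = (N : ℂ)⁻¹ • (s : L) from rfl, hs', twistedSum,
      Finset.sum_congr rfl fun k _ ↦
      (by rw [iterate_coe, one_pow, one_smul] : (1 : ℂ) ^ k • σ^[k] (x : L) = x), Finset.sum_const,
      Finset.card_range, ← Nat.cast_smul_eq_nsmul ℂ, smul_smul, inv_mul_cancel₀ hN, one_smul]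
  rw [this]
  exact S.smul_mem _ hs

/-- The triangular decomposition of the fixed point subalgebra. -/
theorem exists_splitData : ∃ D : SplitData (fixedCartan H σ),
    (∀ x y, D.form x y = normalizedForm b θ x y) ∧
    (D.pos : Set (Dual ℂ (fixedCartan H σ))) = positiveRoots b σ ∧
    ∀ β ∈ D.pos, D.e β ∈ fixedNilradical b σ := by
  classical
  have hex (β : Dual ℂ (fixedCartan H σ)) : ∃ (x y : fixedSubalgebra σ) (t : fixedCartan H σ),
      β ∈ positiveRoots b σ → x ∈ fixedNilradical b σ ∧ IsWtVec β x ∧ IsWtVec (-β) y ∧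
        normalizedForm b θ x y = 1 ∧ ⁅x, y⁆ = t ∧ 0 < β t := by
    by_cases hβ : β ∈ positiveRoots b σ
    · obtain ⟨x, hxe, hx0, hx⟩ := hβ
      have hβ0 := hσ.rootCone_ne_zero hθ ((mem_positiveRoots_iff hσ hθ).mp ⟨x, hxe, hx0, hx⟩).1
      obtain ⟨y, t, hyσ, hy, hxy, ht, -, hpos, -⟩ := hσ.exists_opposite hθ (x := x) one_ne_zero
        (fun h ↦ hx0 (Subtype.ext h)) (by rw [one_smul]; exact map_coe x)
        (isWtVec_fixed_iff.mp hx) hβ0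
      rw [inv_one, one_smul] at hyσ
      exact ⟨x, ⟨y, hyσ⟩, t, fun _ ↦ ⟨hxe, hx, isWtVec_fixed_iff.mpr hy, hxy, Subtype.ext ht, hpos⟩⟩
    · exact ⟨0, 0, 0, fun h ↦ absurd h hβ⟩
  choose x y t h using hex
  have hfin := finite_positiveRoots b σ
  have hpos {β : Dual ℂ (fixedCartan H σ)} : β ∈ hfin.toFinset ↔ β ∈ positiveRoots b σ :=
    hfin.mem_toFinset
  obtain ⟨t₀, ht₀⟩ := hσ.exists_coweight (g := fun _ ↦ 1) fun _ ↦ rfl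
  have hx0 {β : Dual ℂ (fixedCartan H σ)} (hβ : β ∈ positiveRoots b σ) : (x β : L) ≠ 0 :=
    fun h0 ↦ by simpa [h0] using (h β hβ).2.2.2.1
  have hy0 {β : Dual ℂ (fixedCartan H σ)} (hβ : β ∈ positiveRoots b σ) : (y β : L) ≠ 0 :=
    fun h0 ↦ by simpa [h0] using (h β hβ).2.2.2.1
  have hone (z : fixedSubalgebra σ) : σ (z : L) = (1 : ℂ) • (z : L) := by
    rw [one_smul]; exact map_coe z
  let S : Submodule ℂ (fixedSubalgebra σ) := (fixedCartan H σ).toSubmodule ⊔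
    Submodule.span ℂ (x '' hfin.toFinset) ⊔ Submodule.span ℂ (y '' hfin.toFinset)
  have hS (ν : Dual ℂ (fixedCartan H σ)) (z : fixedSubalgebra σ) (hz0 : z ≠ 0)
      (hz : IsWtVec ν z) : z ∈ S := by
    have hz0' : (z : L) ≠ 0 := fun h ↦ hz0 (Subtype.ext h)
    have hzL := isWtVec_fixed_iff.mp hz
    rcases isWt_cases b ⟨(z : L), hz0', hzL⟩ with hν | hν | hν
    · exact Submodule.mem_sup_left (Submodule.mem_sup_left ((hσ.mem_of_isWtVec hzL).1 hν))
    · have hP : ν ∈ positiveRoots b σ := (mem_positiveRoots_iff hσ hθ).mpr ⟨hν, z, hz0, hz⟩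
      obtain ⟨a, ha⟩ := hσ.exists_eq_smul hθ one_ne_zero (hx0 hP) (hone _)
        (isWtVec_fixed_iff.mp (h ν hP).2.1) (hσ.rootCone_ne_zero hθ hν) (hone z) hzL
      rw [show z = a • x ν from Subtype.ext ha]
      exact Submodule.mem_sup_left (Submodule.mem_sup_right (Submodule.smul_mem _ a
        (Submodule.subset_span (Set.mem_image_of_mem x (hpos.mpr hP)))))
    · have hν0 : ν ≠ 0 := fun h0 ↦ hσ.rootCone_ne_zero hθ hν (by rw [h0, neg_zero])
      obtain ⟨w, -, hwσ, hw, hzw, -⟩ := hσ.exists_opposite hθ one_ne_zero hz0' (hone z) hzL hν0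
      rw [inv_one, one_smul] at hwσ
      have hP : -ν ∈ positiveRoots b σ := (mem_positiveRoots_iff hσ hθ).mpr ⟨hν, ⟨w, hwσ⟩,
        fun h0 ↦ by
          have h0' : w = 0 := congrArg Subtype.val h0
          simp [h0'] at hzw, isWtVec_fixed_iff.mpr hw⟩
      obtain ⟨a, ha⟩ := hσ.exists_eq_smul hθ one_ne_zero (hy0 hP) (hone _)
        (isWtVec_fixed_iff.mp (h _ hP).2.2.1) (by rwa [neg_neg]) (hone z) (by rwa [neg_neg])
      rw [show z = a • y (-ν) from Subtype.ext ha]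
      exact Submodule.mem_sup_right (Submodule.smul_mem _ a
        (Submodule.subset_span (Set.mem_image_of_mem y (hpos.mpr hP))))
  refine ⟨{
    form := (normalizedForm b θ).compl₁₂ (fixedSubalgebra σ).toSubmodule.subtype
      (fixedSubalgebra σ).toSubmodule.subtype
    form_symm := fun u v ↦ normalizedForm_symm b _ _
    form_lie := fun u v w ↦ normalizedForm_lie b _ _ _
    form_T := fun t ht ↦ hσ.normalizedForm_fixedCartan hθ ht
    pos := hfin.toFinset
    e := x
    f := y
    coh := t
    lie_e_f := fun β hβ ↦ (h β (hpos.mp hβ)).2.2.2.2.1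
    isWtVec_e := fun β hβ ↦ (h β (hpos.mp hβ)).2.1
    isWtVec_f := fun β hβ ↦ (h β (hpos.mp hβ)).2.2.1
    form_e_f := fun β hβ ↦ (h β (hpos.mp hβ)).2.2.2.1
    span_eq_top := ?_
    ht := t₀
    ht_pos := fun β hβ ↦ hσ.rootCone_ht ht₀ ((mem_positiveRoots_iff hσ hθ).mp (hpos.mp hβ)).1
    norm_pos := fun β hβ ↦ (h β (hpos.mp hβ)).2.2.2.2.2 }, fun _ _ ↦ rfl, hfin.coe_toFinset,
      fun β hβ ↦ (h β (hpos.mp hβ)).1⟩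
  exact (eq_top_iff.mpr fun z _ ↦ hσ.mem_of_forall_isWtVec hθ hS z)

end IsMonomial

end FixedSplit

/-! ### Weights of the eigenspaces of a special automorphism -/

section Special

variable {ι L : Type*} [Fintype ι] [LieRing L] [LieAlgebra ℂ L] {H : LieSubalgebra ℂ L}

/-- The automorphism `σ` permutes the Chevalley generators up to scalars, and these scalars are
trivial except for the nodes in `mid`. The set `mid` is empty for a diagram automorphism and
consists of the two middle nodes for the automorphism of order four of `A_{2n}`. -/
structure IsSpecialMonomial (b : LieAlgebra.Basis ι H) (σ : L ≃ₗ⁅ℂ⁆ L) (τ : Equiv.Perm ι)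
    (c : ι → ℂ) (N : ℕ) (mid : Set ι) : Prop extends IsMonomial b σ τ c N where
  perm_mem : ∀ i, τ i ∈ mid ↔ i ∈ mid
  c_eq_one : ∀ i ∉ mid, c i = 1
  c_mul : ∀ i ∈ mid, c i * c (τ i) = -1
  perm_ne : ∀ i ∈ mid, τ i ≠ i
  cartanMatrix_ne_zero : ∀ i ∈ mid, b.A (τ i) i ≠ 0
  perm_perm : mid.Nonempty → ∀ i, τ (τ i) = i
  eq_or_eq : ∀ i ∈ mid, ∀ j ∈ mid, j = i ∨ j = τ i

variable [FiniteDimensional ℂ L] [LieAlgebra.IsSimple ℂ L] {b : LieAlgebra.Basis ι H}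
  {σ : L ≃ₗ⁅ℂ⁆ L} {τ : Equiv.Perm ι} {c : ι → ℂ} {N : ℕ} {θ : Dual ℂ H} {mid : Set ι}

lemma normalizedForm_e_f_of_ne {i j : ι} (hij : j ≠ i) : normalizedForm b θ (b.e j) (b.f i) = 0 := by
  have h1 := normalizedForm_lie b (θ := θ) (b.h j) (b.e j) (b.f i)
  rw [b.lie_e_f_ne j i hij, map_zero, (b.sl2 j).lie_h_e_nsmul, map_nsmul, LinearMap.smul_apply] at h1
  simpa using h1

namespace IsSpecialMonomial

section

variable (hσ : IsSpecialMonomial b σ τ c N mid) (hθ : IsHighestRoot b θ)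
include hσ

lemma iterate_mem_iff (k : ℕ) (i : ι) : τ^[k] i ∈ mid ↔ i ∈ mid := by
  induction k with
  | zero => rfl
  | succ k ih => rw [Function.iterate_succ_apply', hσ.perm_mem, ih]

lemma iterate_e {i : ι} (hi : i ∉ mid) (k : ℕ) : σ^[k] (b.e i) = b.e (τ^[k] i) := by
  induction k with
  | zero => rfl
  | succ k ih =>
    rw [Function.iterate_succ_apply', ih, hσ.map_e,
      hσ.c_eq_one _ fun h ↦ hi ((hσ.iterate_mem_iff k i).mp h), one_smul,
      ← Function.iterate_succ_apply' τ]

include hθ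

/-- Outside `mid`, the sum of the conjugates of a simple root vector is a root vector for the fixed
point subalgebra. -/
lemma fixedRoot_mem {i : ι} (hi : i ∉ mid) : fixedRoot b σ i ∈ positiveRoots b σ := by
  classical
  have hfix : σ (twistedSum σ 1 N (b.e i)) = twistedSum σ 1 N (b.e i) := by
    have := map_twistedSum (σ := σ) (one_pow N) one_ne_zero hσ.iterate (b.e i)
    rwa [inv_one, one_smul] at this
  have hd := normalizedForm_e_f_pos b hθ i
  have hpos : 0 < normalizedForm b θ (twistedSum σ 1 N (b.e i)) (b.f i) := by
    have h1 (k : ℕ) : 0 ≤ normalizedForm b θ ((1 : ℂ) ^ k • σ^[k] (b.e i)) (b.f i) := by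
      rw [one_pow, one_smul, hσ.iterate_e hi]
      by_cases h : τ^[k] i = i
      · rw [h]; exact hd.le
      · rw [normalizedForm_e_f_of_ne h]
    rw [twistedSum, map_sum, LinearMap.sum_apply]
    refine Finset.sum_pos' (fun k _ ↦ h1 k) ⟨0, Finset.mem_range.mpr hσ.pos, ?_⟩
    simpa using hd
  refine (mem_positiveRoots_iff hσ.toIsMonomial hθ).mpr ⟨fixedRoot_mem_rootCone i, ⟨_, hfix⟩,
    fun h0 ↦ hpos.ne' ?_, isWtVec_fixed_iff.mpr ((isWtVec_e b σ i).twistedSum 1 N)⟩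
  have h0' : twistedSum σ 1 N (b.e i) = 0 := congrArg Subtype.val h0
  rw [h0', map_zero, LinearMap.zero_apply]

/-- For a node in `mid`, the bracket of the two conjugate simple root vectors is a root vector for
the fixed point subalgebra. -/
lemma two_smul_fixedRoot_mem {i : ι} (hi : i ∈ mid) :
    (2 : ℂ) • fixedRoot b σ i ∈ positiveRoots b σ := by
  have hττ := hσ.perm_perm ⟨i, hi⟩ i
  have hfix : σ ⁅b.e i, b.e (τ i)⁆ = ⁅b.e i, b.e (τ i)⁆ := by
    rw [LieEquiv.map_lie, hσ.map_e, hσ.map_e, hττ, smul_lie, lie_smul, smul_smul, hσ.c_mul i hi,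
      neg_one_smul, lie_skew]
  have hwt : (2 : ℂ) • fixedRoot b σ i = fixedRoot b σ i + fixedRoot b σ (τ i) := by
    rw [hσ.fixedRoot_perm, two_smul]
  rw [hwt]
  refine (mem_positiveRoots_iff hσ.toIsMonomial hθ).mpr
    ⟨rootCone_add (fixedRoot_mem_rootCone i) (fixedRoot_mem_rootCone _), ⟨_, hfix⟩,
    fun h0 ↦ hσ.cartanMatrix_ne_zero i hi ?_,
    isWtVec_fixed_iff.mpr ((isWtVec_e b σ i).lie_ambient (isWtVec_e b σ _))⟩
  have h0' : ⁅b.e i, b.e (τ i)⁆ = 0 := congrArg Subtype.val h0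
  have h1 : ⁅b.f i, ⁅b.e i, b.e (τ i)⁆⁆ = -(b.A (τ i) i • b.e (τ i)) := by
    rw [leibniz_lie, ← lie_skew (b.f i) (b.e i), (b.sl2 i).lie_e_f, neg_lie, b.lie_h_e,
      ← lie_skew (b.f i), b.lie_e_f_ne _ _ (hσ.perm_ne i hi), neg_zero, lie_zero, add_zero]
  rw [h0', lie_zero, eq_comm, neg_eq_zero, ← Int.cast_smul_eq_zsmul ℂ] at h1
  have := (smul_eq_zero.mp h1).resolve_right (b.sl2 (τ i)).e_ne_zero
  exact_mod_cast this

omit hθ in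
/-- The square of the automorphism of order four is `(-1) ^ n` on the root vectors in which the
middle simple roots occur with total multiplicity `n`. -/
lemma map_map_of_isWtVec [DecidablePred (· ∈ mid)] (hmid : mid.Nonempty) {t : fixedCartan H σ}
    (ht : ∀ i, fixedRoot b σ i t = if i ∈ mid then 1 else 0) {ν : Dual ℂ (fixedCartan H σ)} {y : L}
    (hy : IsWtVec ν y) : σ (σ y) = Complex.exp (Real.pi * Complex.I * ν t) • y := by
  let P : ℂ → Submodule ℂ L := fun n ↦
    { carrier := {y | σ (σ y) = Complex.exp (Real.pi * Complex.I * n) • y}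
      add_mem' := fun {x y} (hx : _ = _) (hy : _ = _) ↦ by
        change _ = _
        rw [map_add, map_add, hx, hy, smul_add]
      zero_mem' := by simp
      smul_mem' := fun a x (hx : _ = _) ↦ by
        change _ = _
        rw [map_smul, map_smul, hx, smul_comm] }
  have hc (i : ι) : c (τ i) * c i = Complex.exp (Real.pi * Complex.I * if i ∈ mid then 1 else 0) := by
    split_ifs with h
    · rw [mul_one, Complex.exp_pi_mul_I, mul_comm, hσ.c_mul i h]
    · rw [mul_zero, Complex.exp_zero, hσ.c_eq_one i h,
        hσ.c_eq_one _ fun h' ↦ h ((hσ.perm_mem i).mp h'), one_mul]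
  refine mem_of_lie_eq_smul_of_generators b (x := ((t : fixedSubalgebra σ) : L)) P ?_
    (g := fun i ↦ if i ∈ mid then 1 else 0) (fun i ↦ ?_) (fun i ↦ ?_) (fun i ↦ ?_) (fun i ↦ ?_)
    (hy t)
  · intro n m y (hy : _ = _) z (hz : _ = _)
    change _ = _
    rw [LieEquiv.map_lie, LieEquiv.map_lie, hy, hz, smul_lie, lie_smul, smul_smul, mul_add,
      Complex.exp_add]
  · rw [← ht]; exact isWtVec_e b σ i t
  · rw [← ht]; exact isWtVec_f b σ i t
  · change _ = _
    rw [hσ.map_e, map_smul, hσ.map_e, hσ.perm_perm hmid, smul_smul, mul_comm, hc]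
  · change _ = _
    rw [hσ.map_f, map_smul, hσ.map_f, hσ.perm_perm hmid, smul_smul, ← mul_inv, mul_comm (c i), hc,
      mul_neg, Complex.exp_neg]

end

section

variable {D : SplitData (fixedCartan H σ)}

lemma ip_eq_of_forall (hD : ∀ x y, D.form x y = normalizedForm b θ x y)
    {ν : Dual ℂ (fixedCartan H σ)} {t : fixedCartan H σ}
    (ht : ∀ t' : fixedCartan H σ,
      normalizedForm b θ (t' : fixedSubalgebra σ) (t : fixedSubalgebra σ) = ν t')
    (lam : Dual ℂ (fixedCartan H σ)) : D.ip lam ν = lam t := by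
  have h : D.toDual t = ν := LinearMap.ext fun t' ↦ by
    rw [D.toDual_apply, D.form_symm, hD, ht]
  rw [SplitData.ip, ← h, LinearEquiv.symm_apply_apply]

variable (hσ : IsSpecialMonomial b σ τ c N mid) (hθ : IsHighestRoot b θ)
  (hD : ∀ x y, D.form x y = normalizedForm b θ x y)
  (hpos : (D.pos : Set (Dual ℂ (fixedCartan H σ))) = positiveRoots b σ)
include hσ hθ hD

lemma ip_fixedRoot_nonpos {i j : ι} (hij : fixedRoot b σ i ≠ fixedRoot b σ j) :
    D.ip (fixedRoot b σ i) (fixedRoot b σ j) ≤ 0 ∧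
      (D.ip (fixedRoot b σ i) (fixedRoot b σ j) = 0 → b.A i j = 0) := by
  obtain ⟨t, r, hr, ht, ht'⟩ := hσ.exists_dual_fixedRoot hθ j
  have h1 : D.ip (fixedRoot b σ i) (fixedRoot b σ j) =
      r * ∑ k ∈ Finset.range N, (b.A i (τ^[k] j) : ℂ) := by
    rw [ip_eq_of_forall hD ht']
    have h2 : toCartan H σ t = (r : ℂ) • ∑ k ∈ Finset.range N, b.h' (τ^[k] j) := by
      refine Subtype.ext ?_
      change _ = (r : ℂ) • ((∑ k ∈ Finset.range N, b.h' (τ^[k] j) : H) : L)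
      rw [coe_toCartan, ht, AddSubmonoidClass.coe_finsetSum]
      rfl
    change b.baseSupp i (toCartan H σ t) = _
    rw [h2, map_smul, map_sum, smul_eq_mul]
    simp only [b.baseSupp_apply_h']
  have hterm (k : ℕ) : (b.A i (τ^[k] j) : ℂ) ≤ 0 := by
    have : i ≠ τ^[k] j := fun h ↦ hij (by rw [h, hσ.fixedRoot_iterate])
    exact_mod_cast (cartanMatrix_nonpos b this).1
  have hr' : (0 : ℂ) < r := by exact_mod_cast hr
  rw [h1]
  refine ⟨mul_nonpos_of_nonneg_of_nonpos hr'.le (Finset.sum_nonpos fun k _ ↦ hterm k), fun h0 ↦ ?_⟩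
  have h3 := (mul_eq_zero.mp h0).resolve_left hr'.ne'
  have h4 := (Finset.sum_eq_zero_iff_of_nonpos fun k _ ↦ hterm k).mp h3 0
    (Finset.mem_range.mpr hσ.pos)
  exact_mod_cast h4

include hpos

/-- The distinct restrictions of the simple roots. -/
lemma isBase : D.IsBase (Subtype.val : Set.range (fixedRoot b σ) → Dual ℂ (fixedCartan H σ)) where
  exists_coweight g := by
    obtain ⟨t, ht⟩ := hσ.exists_coweight (g := fun i ↦ g ⟨fixedRoot b σ i, i, rfl⟩) fun i ↦ by
      simp only [hσ.fixedRoot_perm]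
    refine ⟨t, ?_⟩
    rintro ⟨_, i, rfl⟩
    exact ht i
  mem_pos := by
    rintro ⟨_, i, rfl⟩
    by_cases hi : i ∈ mid
    · right
      rw [← Finset.mem_coe, hpos]
      exact hσ.two_smul_fixedRoot_mem hθ hi
    · left
      rw [← Finset.mem_coe, hpos]
      exact hσ.fixedRoot_mem hθ hi
  ip_nonpos := by
    rintro ⟨_, i, rfl⟩ ⟨_, j, rfl⟩ hij
    exact (hσ.ip_fixedRoot_nonpos hθ hD fun h ↦ hij (Subtype.ext h)).1
  connected S := by
    rintro ⟨⟨_, i, rfl⟩, hi⟩ ⟨⟨_, j, rfl⟩, hj⟩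
    obtain ⟨k, hk, l, hl, hkl⟩ := exists_cartanMatrix_ne_zero b
      (S := {k | (⟨fixedRoot b σ k, k, rfl⟩ : Set.range (fixedRoot b σ)) ∈ S}) ⟨i, hi⟩ ⟨j, hj⟩
    refine ⟨_, hk, _, hl, fun h0 ↦ hkl ((hσ.ip_fixedRoot_nonpos hθ hD fun h ↦ hl ?_).2 ?_)⟩
    · change _ ∈ S
      have : (⟨fixedRoot b σ l, l, rfl⟩ : Set.range (fixedRoot b σ)) = ⟨fixedRoot b σ k, k, rfl⟩ :=
        Subtype.ext h
      rw [this]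
      exact hk
    · rw [D.ip_symm]
      exact h0

/-- The weights of an eigenspace of a special automorphism lie between the negative of its maximal
weight and its maximal weight. -/
theorem weights_le [IsLieAbelian (fixedCartan H σ)] (m : ℤ) {θ' β : Dual ℂ (fixedCartan H σ)}
    (hθ' : D.IsMaximal (gradedPiece σ m) θ')
    (hβ : IsWt (fixedCartan H σ) (gradedPiece σ m) β) :
    θ' - β ∈ AddSubmonoid.closure (D.pos : Set (Dual ℂ (fixedCartan H σ))) ∧
      θ' + β ∈ AddSubmonoid.closure (D.pos : Set (Dual ℂ (fixedCartan H σ))) := by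
  classical
  set ζ := rootOfUnity σ ^ m with hζdef
  have hζ : ζ ≠ 0 := zpow_ne_zero _ (Complex.exp_ne_zero _)
  have hwt {ν : Dual ℂ (fixedCartan H σ)} (hν : IsWt (fixedCartan H σ) (gradedPiece σ m) ν) :
      ∃ x : L, x ≠ 0 ∧ σ x = ζ • x ∧ IsWtVec ν x := by
    obtain ⟨x, hx0, hx⟩ := hν
    exact ⟨x, fun h ↦ hx0 (Subtype.ext h), x.2, fun t ↦ congrArg Subtype.val (hx t)⟩
  have hcase {ν : Dual ℂ (fixedCartan H σ)} (hν : IsWt (fixedCartan H σ) (gradedPiece σ m) ν) :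
      ν = 0 ∨ ν ∈ rootCone b σ ∨ -ν ∈ rootCone b σ := by
    obtain ⟨x, hx0, -, hx⟩ := hwt hν
    exact isWt_cases b ⟨x, hx0, hx⟩
  have : Fintype (Set.range (fixedRoot b σ)) := Fintype.ofFinite _
  have hsum (n : ι → ℕ) : ∃ k : Set.range (fixedRoot b σ) → ℕ,
      ∑ i, (n i : ℂ) • fixedRoot b σ i = ∑ j, (k j : ℂ) • (j : Dual ℂ (fixedCartan H σ)) := by
    refine ⟨fun j ↦ ∑ i with Set.rangeFactorization (fixedRoot b σ) i = j, n i, ?_⟩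
    rw [← Finset.sum_fiberwise _ (Set.rangeFactorization (fixedRoot b σ))]
    refine Finset.sum_congr rfl fun j _ ↦ ?_
    rw [Nat.cast_sum, Finset.sum_smul]
    refine Finset.sum_congr rfl fun i hi ↦ ?_
    rw [← (Finset.mem_filter.mp hi).2]
    rfl
  refine (hσ.isBase hθ hD hpos).weights_le (M := gradedPiece σ m) ?_ ?_ ?_ ?_ hθ' hβ
  · intro ν hν
    rcases hcase hν with rfl | ⟨n, -, hn⟩ | ⟨n, -, hn⟩
    · exact ⟨0, .inl (by simp)⟩
    · obtain ⟨k, hk⟩ := hsum n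
      exact ⟨k, .inl (hn.trans hk)⟩
    · obtain ⟨k, hk⟩ := hsum n
      exact ⟨k, .inr (by rw [← hk, ← hn, neg_neg])⟩
  · intro ν hν hν0
    obtain ⟨t, ht, htpos⟩ := hσ.exists_dual hθ ((hcase hν).resolve_left hν0) hν0
    rwa [ip_eq_of_forall hD ht]
  · intro h0 n hn
    -- a middle simple root occurs with an even coefficient, as `σ ^ 2` fixes the Cartan subalgebra
    have heven {i : ι} (hi : i ∈ mid) : Even (n ⟨fixedRoot b σ i, i, rfl⟩) := by
      obtain ⟨t, ht⟩ := hσ.exists_coweight (g := fun i ↦ if i ∈ mid then 1 else 0)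
        fun i ↦ by simp only [hσ.perm_mem]
      obtain ⟨x, hx0, hxσ, hx⟩ := hwt h0
      obtain ⟨y, hy0, hyσ, hy⟩ := hwt hn
      have hx' := hσ.map_map_of_isWtVec ⟨i, hi⟩ ht hx
      have hy' := hσ.map_map_of_isWtVec ⟨i, hi⟩ ht hy
      rw [hxσ, map_smul, hxσ, LinearMap.zero_apply, mul_zero, Complex.exp_zero, smul_smul] at hx'
      rw [hyσ, map_smul, hyσ, smul_smul, smul_left_injective ℂ hx0 hx'] at hy'
      have h1 := smul_left_injective ℂ hy0 hy'
      have h2 : (∑ j, (n j : ℂ) • (j : Dual ℂ (fixedCartan H σ))) t =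
          n ⟨fixedRoot b σ i, i, rfl⟩ := by
        rw [LinearMap.sum_apply, Finset.sum_eq_single ⟨fixedRoot b σ i, i, rfl⟩]
        · rw [LinearMap.smul_apply, ht, if_pos hi, smul_eq_mul, mul_one]
        · rintro ⟨_, j, rfl⟩ - hj
          rw [LinearMap.smul_apply, ht, if_neg, smul_zero]
          intro hjm
          refine hj (Subtype.ext ?_)
          rcases hσ.eq_or_eq i hi j hjm with rfl | rfl
          · rfl
          · exact hσ.fixedRoot_perm i
        · exact fun h ↦ absurd (Finset.mem_univ _) h
      rw [h2, mul_comm, Complex.exp_nat_mul, Complex.exp_pi_mul_I] at h1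
      by_contra hodd
      rw [Nat.not_even_iff_odd] at hodd
      rw [hodd.neg_one_pow] at h1
      norm_num at h1
    refine sum_mem ?_
    rintro ⟨_, i, rfl⟩ -
    rw [hpos]
    by_cases hi : i ∈ mid
    · obtain ⟨q, hq⟩ := heven hi
      have : (n ⟨fixedRoot b σ i, i, rfl⟩ : ℂ) • fixedRoot b σ i =
          q • ((2 : ℂ) • fixedRoot b σ i) := by
        rw [hq, ← Nat.cast_smul_eq_nsmul ℂ q, smul_smul]
        push_cast
        ring_nf
      exact this ▸ nsmul_mem (AddSubmonoid.subset_closure (hσ.two_smul_fixedRoot_mem hθ hi)) q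
    · rw [Nat.cast_smul_eq_nsmul]
      exact nsmul_mem (AddSubmonoid.subset_closure (hσ.fixedRoot_mem hθ hi)) _
  · intro ν ν' hν hν' hip
    obtain ⟨x, hx0, hxσ, hx⟩ := hwt hν
    obtain ⟨y, hy0, hyσ, hy⟩ := hwt hν'
    have hν'0 : ν' ≠ 0 := by
      rintro rfl
      rw [D.ip_symm] at hip
      exact lt_irrefl _ hip
    obtain ⟨z, t, hzσ, hz, -, -, ht, -, hne⟩ := hσ.exists_opposite hθ hζ hy0 hyσ hy hν'0
    rw [ip_eq_of_forall hD ht] at hip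
    have hfix : σ ⁅z, x⁆ = ⁅z, x⁆ := by
      rw [LieEquiv.map_lie, hxσ, hzσ, smul_lie, lie_smul, smul_smul, inv_mul_cancel₀ hζ, one_smul]
    refine ⟨⟨_, hfix⟩, fun h ↦ hne ν x hx0 hx hip (congrArg Subtype.val h), ?_⟩
    rw [isWtVec_fixed_iff, sub_eq_neg_add]
    exact hz.lie_ambient hx

end

end IsSpecialMonomial

end Special

/-! ### Special automorphisms permute the Chevalley generators up to scalars -/

section Classify

variable {ι L : Type*} [Fintype ι] [LieRing L] [LieAlgebra ℂ L] {H : LieSubalgebra ℂ L}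
  {b : LieAlgebra.Basis ι H} {σ : L ≃ₗ⁅ℂ⁆ L} {τ : Equiv.Perm ι} {c : ι → ℂ}

lemma iterate_eq_of_generators {N : ℕ} (he : ∀ i, σ^[N] (b.e i) = b.e i)
    (hf : ∀ i, σ^[N] (b.f i) = b.f i) (x : L) : σ^[N] x = x := by
  let S : LieSubalgebra ℂ L :=
    { carrier := {x | σ^[N] x = x}
      add_mem' := fun {x y} (hx : _ = _) (hy : _ = _) ↦ by
        change _ = _
        rw [iterate_map_add, hx, hy]
      zero_mem' := iterate_map_zero σ N
      smul_mem' := fun c x (hx : _ = _) ↦ by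
        change _ = _
        rw [iterate_smul, hx]
      lie_mem' := fun {x y} (hx : _ = _) (hy : _ = _) ↦ by
        change _ = _
        rw [iterate_lie, hx, hy] }
  exact mem_of_forall_generators b (S := S) he hf x

lemma IsDiagramAutomorphism.exists_isSpecialMonomial (h : IsDiagramAutomorphism b σ) :
    ∃ τ c N mid, IsSpecialMonomial b σ τ c N mid := by
  obtain ⟨τ, hτ⟩ := h
  have hN (i : ι) : τ^[orderOf τ] i = i := by
    rw [Equiv.Perm.iterate_eq_pow, pow_orderOf_eq_one, Equiv.Perm.one_apply]
  refine ⟨τ, fun _ ↦ 1, orderOf τ, ∅,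
    { c_ne_zero := fun _ ↦ one_ne_zero
      map_e := fun i ↦ by rw [one_smul, (hτ i).1]
      map_f := fun i ↦ by rw [inv_one, one_smul, (hτ i).2]
      pos := orderOf_pos τ
      iterate := iterate_eq_of_generators (b := b) (fun i ↦ ?_) (fun i ↦ ?_)
      perm_mem := fun _ ↦ Iff.rfl
      c_eq_one := fun _ _ ↦ rfl
      c_mul := fun _ h ↦ absurd h (Set.notMem_empty _)
      perm_ne := fun _ h ↦ absurd h (Set.notMem_empty _)
      cartanMatrix_ne_zero := fun _ h ↦ absurd h (Set.notMem_empty _)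
      perm_perm := fun h ↦ absurd h Set.not_nonempty_empty
      eq_or_eq := fun _ h ↦ absurd h (Set.notMem_empty _) }⟩
  · have h (k : ℕ) : σ^[k] (b.e i) = b.e (τ^[k] i) := by
      induction k with
      | zero => rfl
      | succ k ih => rw [Function.iterate_succ_apply', ih, (hτ _).1, Function.iterate_succ_apply']
    rw [h, hN]
  · have h (k : ℕ) : σ^[k] (b.f i) = b.f (τ^[k] i) := by
      induction k with
      | zero => rfl
      | succ k ih => rw [Function.iterate_succ_apply', ih, (hτ _).2, Function.iterate_succ_apply']
    rw [h, hN]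

lemma IsSpecialMonomial.symm {N : ℕ} {mid : Set ι} (h : IsSpecialMonomial b σ τ c N mid)
    (hτ : ∀ i, τ (τ i) = i) :
    IsSpecialMonomial b σ.symm τ (fun i ↦ (c (τ i))⁻¹) N mid where
  c_ne_zero i := inv_ne_zero (h.c_ne_zero _)
  map_e i := by
    rw [LieEquiv.symm_apply_eq, map_smul, h.map_e, hτ, smul_smul,
      inv_mul_cancel₀ (h.c_ne_zero _), one_smul]
  map_f i := by
    rw [LieEquiv.symm_apply_eq, map_smul, h.map_f, hτ, smul_smul,
      inv_mul_cancel₀ (inv_ne_zero (h.c_ne_zero _)), one_smul]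
  pos := h.pos
  iterate x := by
    conv_lhs => rw [← h.iterate x]
    exact (show Function.LeftInverse σ.symm σ from σ.symm_apply_apply).iterate N x
  perm_mem := h.perm_mem
  c_eq_one i hi := by rw [h.c_eq_one _ fun h' ↦ hi ((h.perm_mem i).mp h'), inv_one]
  c_mul i hi := by rw [hτ, ← mul_inv, mul_comm, h.c_mul i hi, inv_neg, inv_one]
  perm_ne := h.perm_ne
  cartanMatrix_ne_zero := h.cartanMatrix_ne_zero
  perm_perm := h.perm_perm
  eq_or_eq := h.eq_or_eq

variable [FiniteDimensional ℂ L] [LieAlgebra.IsSimple ℂ L]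

variable (b) in
/-- There is a lowest weight vector. -/
lemma exists_lowest : ∃ (ν : Dual ℂ H) (y : L), y ≠ 0 ∧ IsWtVec ν y ∧ ∀ i, ⁅b.f i, y⁆ = 0 := by
  have := b.isLieAbelian_cartan
  have hnt : Nontrivial L := by
    by_contra hL
    rw [not_nontrivial_iff_subsingleton] at hL
    exact LieAlgebra.IsSimple.non_abelian (R := ℂ) (L := L) ⟨fun x y ↦ Subsingleton.elim _ _⟩
  obtain ⟨h₀, h1⟩ := exists_baseSupp_eq b fun _ ↦ 1
  obtain ⟨ν, ⟨y, hy0, hy⟩, hmin⟩ := Set.exists_min_image {ν | IsWt H L ν}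
    (fun ν : Dual ℂ H ↦ (ν h₀).re) (finite_isWt H L) (exists_isWt H L)
  refine ⟨ν, y, hy0, hy, fun i ↦ ?_⟩
  by_contra hne
  have hf : IsWtVec (-b.baseSupp i) (b.f i) := fun t ↦ lie_f_eq b t i
  have h2 := hmin (-b.baseSupp i + ν) ⟨_, hne, hf.lie hy⟩
  rw [LinearMap.add_apply, LinearMap.neg_apply, h1, Complex.add_re, Complex.neg_re,
    Complex.one_re] at h2
  linarith

/-- An automorphism that permutes the `e i` up to scalars, by a symmetry of the Cartan matrix, also
permutes the `h i`, if it fixes the lowest weight vectors: the elements `σ (h j) - h (τ j)` act on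
`L` by the scalar by which they act on a lowest weight vector. -/
lemma map_h_of_lowest (hA : ∀ i j, b.A (τ i) (τ j) = b.A i j) (hc : ∀ i, c i ≠ 0)
    (he : ∀ i, σ (b.e i) = c i • b.e (τ i)) (hlow : ∀ y : L, (∀ i, ⁅b.f i, y⁆ = 0) → σ y = y)
    (j : ι) : σ (b.h j) = b.h (τ j) := by
  obtain ⟨ν, y, hy0, hy, hyf⟩ := exists_lowest b
  rw [← sub_eq_zero]
  set z := σ (b.h j) - b.h (τ j) with hz
  have hze (i : ι) : ⁅z, b.e i⁆ = 0 := by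
    obtain ⟨i, rfl⟩ := τ.surjective i
    have h1 := congrArg σ (b.lie_h_e i j)
    rw [LieEquiv.map_lie, he, lie_smul, map_zsmul, he, smul_comm (b.A i j)] at h1
    rw [hz, sub_lie, smul_right_injective L (hc i) h1, b.lie_h_e, hA, sub_self]
  obtain ⟨s, hs⟩ : ∃ s : ℂ, ⁅z, y⁆ = s • y := by
    have h1 : ⁅b.h j, y⁆ = ν (b.h' j) • y := hy (b.h' j)
    have h2 : ⁅b.h (τ j), y⁆ = ν (b.h' (τ j)) • y := hy (b.h' (τ j))
    have h3 := congrArg σ h1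
    rw [LieEquiv.map_lie, map_smul, hlow y hyf] at h3
    exact ⟨_, by rw [hz, sub_lie, h3, h2, ← sub_smul]⟩
  have hzn (w : L) (hw : w ∈ LieSubalgebra.lieSpan ℂ L (Set.range b.e)) : ⁅z, w⁆ = 0 := by
    induction hw using LieSubalgebra.lieSpan_induction with
    | mem w hw =>
      obtain ⟨i, rfl⟩ := hw
      exact hze i
    | zero => exact lie_zero z
    | add u v _ _ hu hv => rw [lie_add, hu, hv, add_zero]
    | smul a u _ hu => rw [lie_smul, hu, smul_zero]
    | lie u v _ _ hu hv => rw [leibniz_lie, hu, hv, zero_lie, lie_zero, add_zero]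
  let X : Submodule ℂ L := (LieModule.toEnd ℂ L L z).eigenspace s
  have hX {x : L} : x ∈ X ↔ ⁅z, x⁆ = s • x := Module.End.mem_eigenspace_iff
  have hyn (w : L) (hw : w ∈ LieSubalgebra.lieSpan ℂ L (Set.range b.f)) : ⁅w, y⁆ = 0 := by
    induction hw using LieSubalgebra.lieSpan_induction with
    | mem w hw =>
      obtain ⟨i, rfl⟩ := hw
      exact hyf i
    | zero => exact zero_lie y
    | add u v _ _ hu hv => rw [add_lie, hu, hv, add_zero]
    | smul a u _ hu => rw [smul_lie, hu, smul_zero]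
    | lie u v _ _ hu hv => rw [lie_lie, hu, hv, lie_zero, lie_zero, sub_zero]
  have htop : X = ⊤ := by
    refine eq_top_of_lie_mem (K := L) (F := LieSubalgebra.lieSpan ℂ L (Set.range b.e)) hy0
      (fun x ↦ ?_) (hX.mpr hs) fun w hw x hx ↦ hX.mpr ?_
    · obtain ⟨u, hu, v, hv, w, hw, rfl⟩ := exists_triangular b x
      refine add_mem (Submodule.mem_sup_right (add_mem ?_ ?_))
        (Submodule.mem_sup_left (Submodule.subset_span hw))
      · exact (mem_lineStabilizer _ _).mpr ⟨ν ⟨u, hu⟩, (hy ⟨u, hu⟩).symm⟩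
      · exact (mem_lineStabilizer _ _).mpr ⟨0, by rw [hyn v hv, zero_smul]⟩
    · rw [leibniz_lie, hzn w hw, zero_lie, zero_add, hX.mp hx, lie_smul]
  have hall (x : L) : ⁅z, x⁆ = s • x := hX.mp (htop ▸ Submodule.mem_top)
  by_contra hz0
  have hs0 : s = 0 := by
    have h1 := hall z
    rw [lie_self, eq_comm] at h1
    exact (smul_eq_zero.mp h1).resolve_right hz0
  refine hz0 (eq_zero_of_lie_generators b (fun i ↦ ?_) fun i ↦ ?_) <;>
    rw [← lie_skew, hall, hs0, zero_smul, neg_zero]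

/-- An automorphism that permutes the `e i` up to scalars, and the `h i`, also permutes the `f i` up
to the inverse scalars, since no vector of weight minus a simple root is annihilated by all
`e i`. -/
lemma map_f_of_map_h (hc : ∀ i, c i ≠ 0)
    (he : ∀ i, σ (b.e i) = c i • b.e (τ i)) (hh : ∀ j, σ (b.h j) = b.h (τ j)) (k : ι) :
    σ (b.f k) = (c k)⁻¹ • b.f (τ k) := by
  rw [← sub_eq_zero]
  set g := σ (b.f k) - (c k)⁻¹ • b.f (τ k) with hg
  by_contra hg0
  have hge : ⁅b.e (τ k), g⁆ = 0 := by
    have h1 := congrArg σ (b.sl2 k).lie_e_f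
    rw [LieEquiv.map_lie, he, hh, smul_lie] at h1
    rw [hg, lie_sub, lie_smul, (b.sl2 (τ k)).lie_e_f, ← h1, smul_smul, inv_mul_cancel₀ (hc k),
      one_smul, sub_self]
  have hgh : ⁅b.h (τ k), g⁆ = (-2 : ℂ) • g := by
    have h1 := congrArg σ (b.sl2 k).lie_h_f_nsmul
    rw [LieEquiv.map_lie, hh, map_neg, map_nsmul] at h1
    rw [hg, lie_sub, lie_smul, h1, (b.sl2 (τ k)).lie_h_f_nsmul]
    module
  have P : (b.sl2 (τ k)).HasPrimitiveVectorWith g (-2 : ℂ) := ⟨hg0, hgh, hge⟩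
  obtain ⟨n, hn⟩ := P.exists_nat
  have h2 : ((-2 : ℤ) : ℂ) = (n : ℤ) := by exact_mod_cast hn
  have h3 : (-2 : ℤ) = n := by exact_mod_cast h2
  lia

/-- The automorphism of order four of `A_{2n}`. -/
lemma IsOrderFourAutomorphism.exists_isSpecialMonomial (h : IsOrderFourAutomorphism b σ) :
    ∃ τ c N mid, IsSpecialMonomial b σ τ c N mid ∧ ∀ i, τ (τ i) = i := by
  classical
  obtain ⟨n, u, hA, he, hlow⟩ := h
  let τ : Equiv.Perm ι := (u.symm.trans Fin.revPerm).trans u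
  have hτ (k : Fin (2 * n)) : τ (u k) = u k.rev := by simp [τ]
  have hττ (i : ι) : τ (τ i) = i := by
    obtain ⟨k, rfl⟩ := u.surjective i
    rw [hτ, hτ, Fin.rev_rev]
  let mid : Set ι := {i | (u.symm i : ℕ) + 1 = n ∨ (u.symm i : ℕ) = n}
  have hmid (k : Fin (2 * n)) : u k ∈ mid ↔ (k : ℕ) + 1 = n ∨ (k : ℕ) = n := by simp [mid]
  let c : ι → ℂ := fun i ↦ if i ∈ mid then Complex.I else 1
  have hc (i : ι) : c i ≠ 0 := by
    simp only [c]
    split_ifs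
    exacts [Complex.I_ne_zero, one_ne_zero]
  have he' (i : ι) : σ (b.e i) = c i • b.e (τ i) := by
    obtain ⟨k, rfl⟩ := u.surjective i
    rw [he, hτ]
    simp only [c, hmid]
  have hAτ (i j : ι) : b.A (τ i) (τ j) = b.A i j := by
    obtain ⟨k, rfl⟩ := u.surjective i
    obtain ⟨l, rfl⟩ := u.surjective j
    rw [hτ, hτ, hA, hA]
    simp only [CartanMatrix.A, Matrix.of_apply, Fin.rev_inj, Fin.val_rev]
    have := k.2
    have := l.2
    congr 1
    refine if_congr ?_ rfl rfl
    lia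
  have hh := map_h_of_lowest hAτ hc he' hlow
  have hf := map_f_of_map_h hc he' hh
  have hmem (i : ι) : τ i ∈ mid ↔ i ∈ mid := by
    obtain ⟨k, rfl⟩ := u.surjective i
    have := k.2
    rw [hτ, hmid, hmid, Fin.val_rev]
    lia
  have hcc (i : ι) : c (τ i) = c i := by simp only [c, hmem]
  have hc4 (i : ι) : c i * c i * c i * c i = 1 := by
    simp only [c]
    split_ifs <;> simp
  have hne {i : ι} (hi : i ∈ mid) : τ i ≠ i := by
    obtain ⟨k, rfl⟩ := u.surjective i
    rw [hmid] at hi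
    have := k.2
    rw [hτ, Ne, u.injective.eq_iff, Fin.ext_iff, Fin.val_rev]
    lia
  refine ⟨τ, c, 4, mid,
    { c_ne_zero := hc
      map_e := he'
      map_f := hf
      pos := by norm_num
      iterate := iterate_eq_of_generators (b := b) (fun i ↦ ?_) (fun i ↦ ?_)
      perm_mem := hmem
      c_eq_one := fun i hi ↦ if_neg hi
      c_mul := fun i hi ↦ by
        rw [hcc]
        simp only [c, if_pos hi, Complex.I_mul_I]
      perm_ne := fun i hi ↦ hne hi
      cartanMatrix_ne_zero := fun i hi ↦ ?_
      perm_perm := fun _ ↦ hττ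
      eq_or_eq := fun i hi j hj ↦ ?_ }, hττ⟩
  · simp only [Function.iterate_succ, Function.iterate_zero, Function.comp_apply, id_eq, he',
      map_smul, hττ, smul_smul, hcc]
    rw [hc4, one_smul]
  · simp only [Function.iterate_succ, Function.iterate_zero, Function.comp_apply, id_eq, hf,
      map_smul, hττ, smul_smul, hcc]
    rw [← mul_inv, ← mul_inv, ← mul_inv, hc4, inv_one, one_smul]
  · obtain ⟨k, rfl⟩ := u.surjective i
    have hk := k.2
    rw [hmid] at hi
    rw [hτ, hA]
    simp only [CartanMatrix.A, Matrix.of_apply, Fin.val_rev, Fin.ext_iff]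
    split_ifs <;> lia
  · obtain ⟨k, rfl⟩ := u.surjective i
    obtain ⟨l, rfl⟩ := u.surjective j
    have hk := k.2
    rw [hmid] at hi hj
    rw [hτ, u.injective.eq_iff, u.injective.eq_iff, Fin.ext_iff, Fin.ext_iff, Fin.val_rev]
    lia

lemma IsSpecial.exists_isSpecialMonomial (h : IsSpecial b σ) :
    ∃ τ c N mid, IsSpecialMonomial b σ τ c N mid := by
  rcases h with h | h | h
  · exact h.exists_isSpecialMonomial
  · obtain ⟨τ, c, N, mid, h, -⟩ := h.exists_isSpecialMonomial
    exact ⟨τ, c, N, mid, h⟩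
  · obtain ⟨τ, c, N, mid, h, hτ⟩ := h.exists_isSpecialMonomial
    exact ⟨τ, _, N, mid, h.symm hτ⟩

end Classify

end TwistedCasimir

open scoped ComplexOrder in
open TwistedCasimir in
theorem mainTheorem6
    {ι L : Type*} [Fintype ι] [LieRing L] [LieAlgebra ℂ L] [FiniteDimensional ℂ L]
    [LieAlgebra.IsSimple ℂ L]
    -- Chevalley generators, and the highest root of `L`, which normalizes the invariant form
    {H : LieSubalgebra ℂ L} (b : LieAlgebra.Basis ι H)
    (θL : Dual ℂ H) (hθL : IsHighestRoot b θL)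
    -- a special automorphism, and the class of `i` modulo its order
    (σ : L ≃ₗ⁅ℂ⁆ L) (hσ : IsSpecial b σ) (i : ℤ)
    (hexc : ¬ (IsTypeD4 b ∧ order σ = 3 ∧ (3 : ℤ) ∣ i))
    -- the irreducible module `V(mu)` of the fixed point subalgebra
    {V : Type*} [AddCommGroup V] [Module ℂ V] [LieRingModule (fixedSubalgebra σ) V]
    [LieModule ℂ (fixedSubalgebra σ) V] [FiniteDimensional ℂ V]
    [LieModule.IsIrreducible ℂ (fixedSubalgebra σ) V]
    (mu : Dual ℂ (fixedCartan H σ)) (hmu : HasHighestWeight b σ V mu)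
    -- the maximal weight of the graded piece
    (θ : Dual ℂ (fixedCartan H σ)) (hθ : IsMaximalWeight b σ (gradedPiece σ i) θ)
    -- a basis of the fixed point subalgebra and its dual basis
    {κ : Type*} [Fintype κ] [DecidableEq κ] (B₀ : Basis κ ℂ (fixedSubalgebra σ))
    (B₀' : κ → fixedSubalgebra σ)
    (hdual : ∀ j k, normalizedForm b θL (B₀ j : L) (B₀' k : L) = if j = k then 1 else 0) :
    -- the form is nondegenerate on the Cartan subalgebra, so that `dualForm` is the induced form
    Function.Bijective (cartanToDual (normalizedForm b θL) H σ) ∧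
    ∀ e : ℂ, (casimirOperator B₀ B₀' (gradedPiece σ i) V).HasEigenvalue e →
      ∃ lo r hi : ℝ,
        (lo : ℂ) = -dualForm (normalizedForm b θL) (mu + (2 : ℂ) • rho b σ) θ ∧
        (r : ℂ) = e ∧
        (hi : ℂ) = dualForm (normalizedForm b θL) mu θ ∧
        lo ≤ r ∧ r ≤ hi := by
  have := isLieAbelian_fixedCartan b σ
  obtain ⟨τ, c, N, mid, hm⟩ := hσ.exists_isSpecialMonomial
  obtain ⟨D, hD, hpos, hDe⟩ := hm.exists_splitData hθL
  have hdualMap (t : fixedCartan H σ) :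
      cartanToDual (normalizedForm b θL) H σ t = D.toDual t :=
    LinearMap.ext fun t' ↦ (hD t t').symm
  have hbij : Function.Bijective (cartanToDual (normalizedForm b θL) H σ) := by
    rw [show ⇑(cartanToDual (normalizedForm b θL) H σ) = D.toDual from funext hdualMap]
    exact D.toDual.bijective
  have hip (lam mu : Dual ℂ (fixedCartan H σ)) :
      dualForm (normalizedForm b θL) lam mu = D.ip lam mu := by
    rw [dualForm, SplitData.ip]
    congr 1
    rw [LinearEquiv.eq_symm_apply, ← hdualMap]
    exact Function.invFun_eq (hbij.2 mu)
  have hrho : rho b σ = D.rho := by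
    rw [rho, ← hpos, finsum_mem_coe_finset, SplitData.rho]
  have hmax : D.IsMaximal (gradedPiece σ i) θ :=
    ⟨hθ.1, fun ν hν h ↦ hθ.2 ν hν (by rwa [hpos] at h)⟩
  have hwt (β) (hβ : IsWt (fixedCartan H σ) (gradedPiece σ i) β) (ν) (hν : D.Dominant ν) :
      0 ≤ D.ip ν (θ - β) ∧ 0 ≤ D.ip ν (θ + β) := by
    obtain ⟨h1, h2⟩ := hm.weights_le hθL hD hpos i hmax hβ
    exact ⟨hν.ip_nonneg h1, hν.ip_nonneg h2⟩
  obtain ⟨v, hv0, hv, hve⟩ := hmu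
  have hprim : D.IsPrim mu v := ⟨hv0, hv, fun β hβ ↦ hve _ (hDe β hβ)⟩
  have hreal {ν} (hν : D.Dominant ν) : 0 ≤ D.ip ν θ := by
    have h := (hwt θ hθ.1 ν hν).2
    rw [D.ip_add_right, ← two_mul] at h
    exact SplitData.nonneg_of_two_mul_nonneg h
  have h1 := hreal hprim.dominant
  have h2 := hreal (ν := mu + (2 : ℂ) • D.rho)
    (hprim.dominant.add fun γ hγ ↦ mul_nonneg zero_le_two (D.dominant_rho γ hγ))
  refine ⟨hbij, fun e he ↦ ?_⟩
  obtain ⟨hlo, hhi⟩ := hprim.bounds (b := B₀) (b' := B₀')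
    (fun j k ↦ (hD _ _).trans (hdual j k)) _ rfl hwt he
  rw [hip, hip, hrho]
  rw [Complex.le_def] at h1 h2 hlo hhi
  refine ⟨_, e.re, (D.ip mu θ).re, Complex.ext rfl ?_, Complex.ext rfl ?_, Complex.ext rfl ?_,
    hlo.1, hhi.1⟩
  · rw [Complex.ofReal_im, Complex.neg_im, ← h2.2, Complex.zero_im, neg_zero]
  · rw [Complex.ofReal_im, hhi.2, ← h1.2, Complex.zero_im]
  · rw [Complex.ofReal_im, ← h1.2, Complex.zero_im]
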